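/- Let $f(x,y)=(2x+y,\,x+y) \bmod 1$ be Thom's (cat) map, viewed as a map of $\mathbb{R}^2$ into the invariant square $\Lambda=[0,1)^2$, and let $\nu$ be Lebesgue measure on $\Lambda$, which is an $f$-invariant probability measure. Fix $\alpha>0$. For $p_M=(x_M,y_M)\in\mathbb{R}^2$ let $\phi_\alpha(p)=1-\operatorname{dist}(p,p_M)^\alpha$, where $\operatorname{dist}$ is the Euclidean distance, and let $M_n=\max(X_1,\dots,X_n)$ with $X_i=\phi_\alpha\circ f^i$, regarded as random variables on $(\Lambda,\nu)$. Say that $\xi\in\mathbb{R}$ is a tail index of a GEV limit distribution of $(M_n)$ if there are sequences $a_n>0$ and $b_n\in\mathbb{R}$ and parameters $\mu\in\mathbb{R}$, $\sigma>0$ such that, for every $x\in\mathbb{R}$, $$\lim_{n\to\infty}\nu\{a_n(M_n-b_n)\le x\}=G_{\xi,\mu,\sigma}(x),$$ where $G_{\xi,\mu,\sigma}$ is the generalised extreme value distribution function: $G_{\xi,\mu,\sigma}(x)=\exp\left(-\left[1+\xi\,\tfrac{x-\mu}{\sigma}\right]^{-1/\xi}\right)$ where $1+\xi\,\tfrac{x-\mu}{\sigma}>0$,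 extended by $1$ elsewhere if $\xi<0$ and by $0$ elsewhere if $\xi>0$, and $G_{0,\mu,\sigma}(x)=\exp\left(-e^{-(x-\mu)/\sigma}\right)$. Then for Lebesgue-almost every $p_M\in\mathbb{R}^2$ such a $\xi$ exists and is unique in each of the following three cases, and it is given by $$-\frac1\xi=\frac2\alpha\quad\text{if }p_M\in\Lambda;$$ $$-\frac1\xi=\frac32\quad\text{if }p_M\notin\Lambda\text{ and either }y_M\in(0,1)\text{ or }x_M\in(0,1);$$ $$-\frac1\xi=2\quad\text{if }p_M\notin\Lambda\text{ and both }x_M\notin[0,1]\text{ and }y_M\notin[0,1].$$ -/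

import Mathlib

open Set Filter Topology MeasureTheory

noncomputable section

namespace ThomMap

/-- The Euclidean plane `ℝ²`. -/
abbrev Plane : Type := EuclideanSpace ℝ (Fin 2)

/-- Thom's map (the cat map) `f(x, y) = (2x + y, x + y) mod 1`, as a map of the plane into
the half-open unit square; `Int.fract` is reduction mod 1. -/
def thomMap (p : Plane) : Plane :=
  !₂[Int.fract (2 * p 0 + p 1), Int.fract (p 0 + p 1)]

/-- The invariant square `Λ = [0, 1)²`. -/
def unitSquare : Set Plane := {p | p 0 ∈ Ico (0 : ℝ) 1 ∧ p 1 ∈ Ico (0 : ℝ) 1}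

/-- The invariant probability measure `ν`: Lebesgue measure carried by `Λ`. -/
def lebesgueSquare : Measure Plane := (volume : Measure Plane).restrict unitSquare

/-- The observable `φ_α(p) = 1 - dist(p, p_M)^α` (Euclidean distance). -/
def observable (α : ℝ) (pM : Plane) (p : Plane) : ℝ := 1 - dist p pM ^ α

/-- The maxima `M_n = max (X_1, …, X_n)` of the process `X_i = φ ∘ f^i`
(the value at `n = 0` is irrelevant). -/
def blockMax {S : Type*} (f : S → S) (φ : S → ℝ) (n : ℕ) (p : S) : ℝ :=
  ⨆ i : Fin n, φ (f^[(i : ℕ) + 1] p)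

/-- The distribution function of the generalised extreme value law with tail index `ξ`,
location `μ` and scale `σ`; the case `ξ = 0` is the Gumbel law. Outside the set where
`1 + ξ (x - μ) / σ > 0` it is `1` (to the right of the support, `ξ < 0`) or `0`
(to the left of the support, `ξ > 0`). -/
def gevCDF (ξ μ σ x : ℝ) : ℝ :=
  if ξ = 0 then Real.exp (-Real.exp (-((x - μ) / σ)))
  else if 0 < 1 + ξ * ((x - μ) / σ) then
    Real.exp (-(1 + ξ * ((x - μ) / σ)) ^ (-1 / ξ))
  else if ξ < 0 then 1 else 0

/-- `ξ` is a tail index of a GEV limit distribution of the sequence `M_n`: for some normalising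
sequences `a_n > 0`, `b_n`, the distribution functions of `a_n (M_n - b_n)` converge pointwise
to a GEV distribution function with tail index `ξ`. -/
def IsGEVTailIndex {Ω : Type*} [MeasurableSpace Ω] (P : Measure Ω) (M : ℕ → Ω → ℝ)
    (ξ : ℝ) : Prop :=
  ∃ (a b : ℕ → ℝ) (μ σ : ℝ), (∀ n, 0 < a n) ∧ 0 < σ ∧
    ∀ x : ℝ, Tendsto (fun n => P.real {ω | a n * (M n ω - b n) ≤ x}) atTop
      (𝓝 (gevCDF ξ μ σ x))

end ThomMap

end

/-!
The map `f` is the automorphism `cat` of the torus read in the coordinates `[0, 1)²`, and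
`M_n` stays below the level `1 - R ^ α` exactly when the orbit, at the times `1, …, n`, avoids the set
`disc` of points at distance less than `R` from the centre (`measureReal_blockMax_le`). So the
theorem is a statement about the probability of avoiding small sets, and its proof has four
ingredients.

*Poisson limit.* Translating by a multiple of the stable vector hardly changes whether the far
future of an orbit avoids a set `E` with thin boundary. The multiples of the stable vector are
equidistributed on the torus, because the golden ratio is badly approximable; averaging over them
shows that `E` is exponentially decorrelated from its avoidance after a gap
(`abs_decorrelation_le`). Hence the probability of avoiding `E` for `m` steps is multiplied by nearly
`1 - vol E` when `m` grows by one, provided that `E` has few short returns, and the avoidance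
probability for `n` steps tends to `exp (-τ)` if `n * vol E → τ` (`tendsto_avoid`). When short returns are not
negligible, `E = A \ cat ⁻¹' A`, the set of points about to leave `A`, replaces `A`: avoiding one is
nearly the same as avoiding the other (`tendsto_avoid_of_exit`). This takes care of the extremal index.

*Short returns.* For a centre inside the square, almost every point is slowly recurrent by the
Borel–Cantelli lemma (`ae_slowlyRecurrent`), which excludes returns at the first times; the later ones
are controlled by equidistribution of preimages of arcs (`measureReal_box_le`). For a centre beyond a
side, the exceedance set lies in a thin strip, which meets its images transversally
(`measureReal_strip_fst_le`). For a centre beyond a corner, the exceedance set is a small triangle at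
the fixed point of `cat`. The matrix either maps the quadrant that contains the square into itself and
moves its points away from the corner, or its inverse does; in both cases an orbit which has left the
triangle does not come back to it while it stays near the fixed point (`no_return_corner`).

*Areas.* With `R₀` the distance from the centre to the square, the exit set for the radius `R₀ + ε` has
area of order `ε ^ κ`, with `κ = 2` for a disc (`eventually_measureReal_disc`), `κ = 3 / 2` for a cap cut
off by the circle from a side (`exists_tendsto_cap`) and `κ = 2` for a triangle at a corner
(`exists_tendsto_corner`). The level depends on `ε` as `ε ^ α` if `R₀ = 0` and linearly if `R₀ > 0`, so
that the limit of the normalised maxima is `exp (-C (-x) ^ κ')` with `κ'` equal to `2 / α`, `3 / 2` and `2`.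

*Uniqueness.* The spacings of the quantiles at the levels `exp (-1)`, `exp (-2)`, `exp (-4)` of a generalised
extreme value law have the ratio `2 ^ (-ξ)`, which is not affected by changes of the normalisation
(`IsGEVTailIndex.unique`); so the limit determines the tail index (`isGEVTailIndex_iff`).
-/

namespace ThomMap

/-! ### The automorphism of the torus -/

/-- The two-dimensional torus `(ℝ/ℤ)²`, with the supremum norm and Haar probability measure. -/
abbrev Torus : Type := UnitAddCircle × UnitAddCircle

instance : IsProbabilityMeasure (volume : Measure UnitAddCircle) := ⟨UnitAddCircle.measure_univ⟩

instance : (volume : Measure Torus).IsAddHaarMeasure :=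
  inferInstanceAs
    ((volume : Measure UnitAddCircle).prod (volume : Measure UnitAddCircle)).IsAddHaarMeasure

/-- Thom's map as an automorphism of the torus. -/
def cat : Torus →+ Torus where
  toFun t := ((2 : ℤ) • t.1 + t.2, t.1 + t.2)
  map_zero' := by simp
  map_add' s t := by
    ext
    · simp only [Prod.fst_add, Prod.snd_add, smul_add]; abel
    · simp only [Prod.fst_add, Prod.snd_add]; abel

theorem cat_apply (t : Torus) : cat t = ((2 : ℤ) • t.1 + t.2, t.1 + t.2) := rfl

theorem continuous_cat : Continuous cat := by
  change Continuous fun t : Torus => ((2 : ℤ) • t.1 + t.2, t.1 + t.2)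
  fun_prop

theorem measurePreserving_cat : MeasurePreserving cat := by
  refine AddMonoidHom.measurePreserving continuous_cat (fun t => ⟨(t.1 - t.2, t.2 + t.2 - t.1), ?_⟩)
    rfl
  ext
  · simp only [cat_apply, two_smul]; abel
  · simp only [cat_apply]; abel

theorem measurePreserving_cat_iterate (j : ℕ) : MeasurePreserving cat^[j] :=
  measurePreserving_cat.iterate j

theorem cat_iterate_add (j : ℕ) (s t : Torus) : cat^[j] (s + t) = cat^[j] s + cat^[j] t := by
  induction j generalizing s t with
  | zero => rfl
  | succ j ih => simp only [Function.iterate_succ_apply, map_add, ih]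

theorem cat_iterate_sub (j : ℕ) (s t : Torus) : cat^[j] (s - t) = cat^[j] s - cat^[j] t := by
  induction j generalizing s t with
  | zero => rfl
  | succ j ih => simp only [Function.iterate_succ_apply, map_sub, ih]

theorem fib_two_mul_add_two (j : ℕ) :
    Nat.fib (2 * (j + 1)) = Nat.fib (2 * j + 1) + Nat.fib (2 * j) := by
  rw [show 2 * (j + 1) = 2 * j + 2 by ring, Nat.fib_add_two, add_comm]

theorem fib_two_mul_add_three (j : ℕ) :
    Nat.fib (2 * (j + 1) + 1) = 2 * Nat.fib (2 * j + 1) + Nat.fib (2 * j) := by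
  rw [show 2 * (j + 1) + 1 = 2 * j + 1 + 2 by ring, Nat.fib_add_two, Nat.fib_add_two]
  ring

/-- The powers of the matrix `(2 1; 1 1)` have Fibonacci entries. -/
theorem cat_iterate_apply (j : ℕ) (t : Torus) :
    cat^[j] t = ((Nat.fib (2 * j + 1) : ℤ) • t.1 + (Nat.fib (2 * j) : ℤ) • t.2,
      (Nat.fib (2 * j) : ℤ) • t.1 + ((Nat.fib (2 * j + 1) : ℤ) - Nat.fib (2 * j)) • t.2) := by
  induction j with
  | zero => simp
  | succ j ih =>
    rw [Function.iterate_succ_apply', ih, cat_apply, fib_two_mul_add_two, fib_two_mul_add_three]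
    ext <;> push_cast <;> module

theorem norm_cat_le (t : Torus) : ‖cat t‖ ≤ 3 * ‖t‖ := by
  rw [cat_apply, Prod.norm_def, two_smul]
  have h1 := norm_fst_le t
  have h2 := norm_snd_le t
  have h3 := norm_add_le (t.1 + t.1) t.2
  have h4 := norm_add_le t.1 t.1
  have h5 := norm_add_le t.1 t.2
  have h6 := norm_nonneg t
  refine max_le ?_ ?_ <;> dsimp only <;> linarith

theorem norm_cat_iterate_le (j : ℕ) (t : Torus) : ‖cat^[j] t‖ ≤ 3 ^ j * ‖t‖ := by
  induction j with
  | zero => simp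
  | succ j ih =>
    rw [Function.iterate_succ_apply', pow_succ]
    linarith [norm_cat_le (cat^[j] t)]

theorem surjective_zsmul_add (a : ℤ) {b : ℤ} (hb : b ≠ 0) (x z : UnitAddCircle) :
    ∃ y : UnitAddCircle, a • x + b • y = z := by
  obtain ⟨w, hw⟩ := QuotientAddGroup.mk_surjective (z - a • x)
  refine ⟨((w / b : ℝ) : UnitAddCircle), ?_⟩
  have hb' : (b : ℝ) ≠ 0 := by exact_mod_cast hb
  have : b • ((w / b : ℝ) : UnitAddCircle) = ((w : ℝ) : UnitAddCircle) := by
    rw [← AddCircle.coe_zsmul, zsmul_eq_mul, mul_div_cancel₀ _ hb']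
  rw [this, show ((w : ℝ) : UnitAddCircle) = z - a • x from hw]
  abel

theorem measurePreserving_zsmul_add (a : ℤ) {b : ℤ} (hb : b ≠ 0) :
    MeasurePreserving (fun t : Torus => a • t.1 + b • t.2) := by
  let g : Torus →+ UnitAddCircle :=
    { toFun := fun t => a • t.1 + b • t.2
      map_zero' := by simp
      map_add' := fun s t => by
        simp only [Prod.fst_add, Prod.snd_add, smul_add]; abel }
  refine AddMonoidHom.measurePreserving (f := g)
    (by change Continuous fun t : Torus => a • t.1 + b • t.2; fun_prop) (fun z => ?_) (by simp)
  obtain ⟨y, hy⟩ := surjective_zsmul_add a hb 0 z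
  exact ⟨(0, y), hy⟩

theorem measurePreserving_shear (a : ℤ) {b : ℤ} (hb : b ≠ 0) :
    MeasurePreserving (fun t : Torus => (t.1, a • t.1 + b • t.2)) := by
  let g : Torus →+ Torus :=
    { toFun := fun t => (t.1, a • t.1 + b • t.2)
      map_zero' := by simp
      map_add' := fun s t => by
        ext
        · rfl
        · simp only [Prod.fst_add, Prod.snd_add, smul_add]; abel }
  refine AddMonoidHom.measurePreserving (f := g)
    (by change Continuous fun t : Torus => (t.1, a • t.1 + b • t.2); fun_prop) (fun z => ?_) rfl
  obtain ⟨y, hy⟩ := surjective_zsmul_add a hb z.1 z.2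
  exact ⟨(z.1, y), Prod.ext rfl hy⟩

theorem measurePreserving_zsmul {b : ℤ} (hb : b ≠ 0) :
    MeasurePreserving (fun y : UnitAddCircle => b • y) := by
  refine AddMonoidHom.measurePreserving (f := DistribSMul.toAddMonoidHom UnitAddCircle b)
    (by change Continuous fun t : UnitAddCircle => b • t; fun_prop) (fun z => ?_) rfl
  obtain ⟨y, hy⟩ := surjective_zsmul_add 0 hb 0 z
  exact ⟨y, by simpa using hy⟩

theorem measurePreserving_translate (v : Torus) : MeasurePreserving (fun t : Torus => t + v) :=
  measurePreserving_add_right _ v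

/-! ### The stable direction -/

open Real in
/-- The translation vector `c • (1, -φ)`; the line `ℝ • (1, -φ)` is the eigenline of the matrix
`(2 1; 1 1)` for its contracting eigenvalue `ψ ^ 2`, where `ψ = 1 - φ`. -/
noncomputable def stab (c : ℝ) : Torus := ((c : UnitAddCircle), ((-(c * goldenRatio) : ℝ) : UnitAddCircle))

open Real in
theorem cat_stab (c : ℝ) : cat (stab c) = stab (goldenConj ^ 2 * c) := by
  have h1 : goldenConj = 1 - goldenRatio := by rw [← goldenRatio_add_goldenConj]; ring
  have h2 := goldenRatio_sq
  simp only [cat_apply, stab]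
  rw [← AddCircle.coe_zsmul, ← AddCircle.coe_add, ← AddCircle.coe_add]
  congr 2
  · rw [goldenConj_sq, h1, zsmul_eq_mul]; push_cast; ring
  · rw [goldenConj_sq, h1]; linear_combination (-c) * h2

open Real in
theorem cat_iterate_stab (j : ℕ) (c : ℝ) : cat^[j] (stab c) = stab ((goldenConj ^ 2) ^ j * c) := by
  induction j with
  | zero => simp
  | succ j ih => rw [Function.iterate_succ_apply', ih, cat_stab, pow_succ']; ring_nf

theorem norm_coe_le_abs (x : ℝ) : ‖(x : UnitAddCircle)‖ ≤ |x| := by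
  rw [UnitAddCircle.norm_eq]
  simpa using round_le x 0

theorem norm_stab_le (c : ℝ) : ‖stab c‖ ≤ 2 * |c| := by
  refine max_le ((norm_coe_le_abs c).trans ?_) ((norm_coe_le_abs _).trans ?_)
  · linarith [abs_nonneg c]
  · rw [abs_neg, abs_mul, abs_of_pos Real.goldenRatio_pos]
    nlinarith [abs_nonneg c, Real.goldenRatio_lt_two]

/-! ### Sets with thin boundary -/

/-- The `r`-neighbourhood of the boundary of `E` has measure at most `K * r`, in the form: up to a
set of measure at most `K * r`, points at distance at most `r` agree on membership in `E`. -/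
def ThinBoundary (E : Set Torus) (K : ℝ) : Prop :=
  ∀ r : ℝ, 0 ≤ r → ∃ S : Set Torus, MeasurableSet S ∧ volume.real S ≤ K * r ∧
    ∀ s t : Torus, ‖s - t‖ ≤ r → t ∉ S → (s ∈ E ↔ t ∈ E)

theorem ThinBoundary.nonneg {E : Set Torus} {K : ℝ} (h : ThinBoundary E K) : 0 ≤ K := by
  obtain ⟨S, -, hS, -⟩ := h 1 zero_le_one
  linarith [measureReal_nonneg (μ := volume) (s := S)]

theorem ThinBoundary.diff_preimage_cat {A : Set Torus} {K : ℝ} (h : ThinBoundary A K) :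
    ThinBoundary (A \ cat ⁻¹' A) (4 * K) := by
  intro r hr
  obtain ⟨S, hSm, hS, hSA⟩ := h r hr
  obtain ⟨S', hSm', hS', hSA'⟩ := h (3 * r) (by positivity)
  refine ⟨S ∪ cat ⁻¹' S', hSm.union (measurePreserving_cat.measurable hSm'), ?_, ?_⟩
  · refine (measureReal_union_le _ _).trans ?_
    rw [measurePreserving_cat.measureReal_preimage hSm'.nullMeasurableSet]
    linarith
  · intro s t hst ht
    have h1 : t ∉ S := fun h => ht (Or.inl h)
    have h2 : cat t ∉ S' := fun h => ht (Or.inr h)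
    have h3 : ‖cat s - cat t‖ ≤ 3 * r := by
      rw [← map_sub]; exact (norm_cat_le _).trans (by linarith)
    simp only [Set.mem_sdiff, mem_preimage, hSA s t hst h1, hSA' _ _ h3 h2]

/-- Points whose orbit avoids `E` at the times `0, …, m - 1`. -/
def avoid (E : Set Torus) (m : ℕ) : Set Torus := {t | ∀ i < m, cat^[i] t ∉ E}

theorem measurableSet_avoid {E : Set Torus} (hE : MeasurableSet E) (m : ℕ) :
    MeasurableSet (avoid E m) := by
  have : avoid E m = ⋂ i < m, cat^[i] ⁻¹' Eᶜ := by ext; simp [avoid]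
  rw [this]
  exact MeasurableSet.biInter (to_countable _)
    fun i _ => (measurePreserving_cat_iterate i).measurable hE.compl

theorem goldenConj_sq_lt_half : Real.goldenConj ^ 2 < 1 / 2 := by
  rw [Real.goldenConj_sq, Real.goldenConj]
  have : (2 : ℝ) < √5 := by
    rw [Real.lt_sqrt (by norm_num)]; norm_num
  linarith

/-- Orbits along the stable direction get exponentially close, so that the errors made at the times
`0, …, m - 1` sum to a bound that does not depend on `m`. -/
theorem exists_avoid_translate {E : Set Torus} {K : ℝ} (h : ThinBoundary E K) (m : ℕ) (c : ℝ) :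
    ∃ S : Set Torus, MeasurableSet S ∧ volume.real S ≤ 4 * K * |c| ∧
      ∀ t, t ∉ S → (t + stab c ∈ avoid E m ↔ t ∈ avoid E m) := by
  set q : ℝ := Real.goldenConj ^ 2 with hq
  have hq0 : 0 ≤ q := sq_nonneg _
  have hq1 : q < 1 / 2 := goldenConj_sq_lt_half
  choose S hSm hS hSE using fun i : ℕ => h (2 * (q ^ i * |c|)) (by positivity)
  refine ⟨⋃ i ∈ Finset.range m, cat^[i] ⁻¹' S i, ?_, ?_, ?_⟩
  · exact Finset.measurableSet_biUnion _
      fun i _ => (measurePreserving_cat_iterate i).measurable (hSm i)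
  · refine (measureReal_biUnion_finset_le _ _).trans ?_
    have h1 : ∀ i ∈ Finset.range m, volume.real (cat^[i] ⁻¹' S i) ≤ K * (2 * (q ^ i * |c|)) := by
      intro i _
      rw [(measurePreserving_cat_iterate i).measureReal_preimage (hSm i).nullMeasurableSet]
      exact hS i
    refine (Finset.sum_le_sum h1).trans ?_
    have h2 : ∑ i ∈ Finset.range m, q ^ i ≤ 2 := by
      refine (Summable.sum_le_tsum _ (fun i _ => by positivity)
        (summable_geometric_of_lt_one hq0 (by linarith))).trans ?_
      rw [tsum_geometric_of_lt_one hq0 (by linarith)]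
      rw [inv_le_comm₀ (by linarith) (by norm_num)]
      linarith
    calc ∑ i ∈ Finset.range m, K * (2 * (q ^ i * |c|))
        = 2 * K * |c| * ∑ i ∈ Finset.range m, q ^ i := by
          rw [Finset.mul_sum]; exact Finset.sum_congr rfl fun i _ => by ring
      _ ≤ 2 * K * |c| * 2 := by
          gcongr; have := h.nonneg; positivity
      _ = 4 * K * |c| := by ring
  · intro t ht
    simp only [mem_iUnion, Finset.mem_range, mem_preimage, not_exists] at ht
    refine forall₂_congr fun i hi => not_congr (hSE i _ _ ?_ (ht i hi))
    rw [cat_iterate_add, add_sub_cancel_left, cat_iterate_stab]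
    refine (norm_stab_le _).trans ?_
    rw [abs_mul, abs_of_nonneg (by positivity)]

/-! ### Equidistribution of stable translations -/

open Real in
theorem fib_le_goldenRatio_pow (n : ℕ) :
    (Nat.fib n : ℝ) ≤ goldenRatio ^ n ∧ (Nat.fib (n + 1) : ℝ) ≤ goldenRatio ^ (n + 1) := by
  induction n with
  | zero => simpa using one_lt_goldenRatio.le
  | succ n ih =>
    refine ⟨ih.2, ?_⟩
    rw [show n + 1 + 1 = n + 2 by ring, Nat.fib_add_two, pow_add, goldenRatio_sq]
    push_cast
    have := ih.2
    rw [pow_succ] at this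
    linarith [ih.1]

open Real in
theorem goldenRatio_pow_le_fib (n : ℕ) :
    goldenRatio ^ (n + 1) ≤ 4 * (Nat.fib (n + 1) : ℝ) ∧
      goldenRatio ^ (n + 2) ≤ 4 * (Nat.fib (n + 2) : ℝ) := by
  induction n with
  | zero =>
    have := goldenRatio_lt_two
    simp only [zero_add, goldenRatio_sq, Nat.fib_one, Nat.fib_two]
    constructor <;> norm_num <;> linarith
  | succ n ih =>
    refine ⟨ih.2, ?_⟩
    have h1 : goldenRatio ^ (n + 1 + 2) = goldenRatio ^ (n + 1 + 1) + goldenRatio ^ (n + 1) := by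
      rw [pow_add _ (n + 1) 2, goldenRatio_sq, pow_succ _ (n + 1)]; ring
    rw [h1, Nat.fib_add_two]
    push_cast
    have := ih.2
    rw [show n + 2 = n + 1 + 1 by ring] at this
    linarith [ih.1]

open Real in
theorem abs_goldenConj_pow (n : ℕ) : |goldenConj| ^ n = (goldenRatio ^ n)⁻¹ := by
  rw [← inv_pow, inv_goldenRatio, abs_of_neg goldenConj_neg]

open Real in
/-- Rotation by the golden ratio: its first `fib n` orbit points are a perturbation of the
`fib n`-th roots of unity, because `fib (n + 1) / fib n` approximates `φ`. -/
theorem exists_equiv_norm_le {n : ℕ} [NeZero (Nat.fib n)] (q : UnitAddCircle) :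
    ∃ e : ZMod (Nat.fib n) ≃ ZMod (Nat.fib n), ∀ k,
      ‖((k.val * goldenRatio : ℝ) : UnitAddCircle) - (q + ZMod.toAddCircle (e k))‖
        ≤ 5 * |goldenConj| ^ n := by
  obtain ⟨w, rfl⟩ := QuotientAddGroup.mk_surjective q
  set N := Nat.fib n with hN
  have hN0 : 0 < N := Nat.pos_of_ne_zero (NeZero.ne _)
  have hNr : (0 : ℝ) < N := by exact_mod_cast hN0
  let u : (ZMod N)ˣ := ZMod.unitOfCoprime (Nat.fib (n + 1)) (Nat.fib_coprime_fib_succ n).symm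
  -- `k * φ` is close to `k * fib (n + 1) / fib n`, where `fib (n + 1)` is a unit modulo `fib n`; the shift
  -- by `q` is rounded to a multiple of `1 / fib n`.
  refine ⟨(Units.mulLeft u).trans (Equiv.subRight ((⌊w * N⌋ : ℤ) : ZMod N)), fun k => ?_⟩
  have h1 : ZMod.toAddCircle ((u : ZMod N) * k) =
      ((Nat.fib (n + 1) * k.val / N : ℝ) : UnitAddCircle) := by
    have : (u : ZMod N) * k = ((Nat.fib (n + 1) * k.val : ℕ) : ZMod N) := by
      rw [ZMod.coe_unitOfCoprime, Nat.cast_mul, ZMod.natCast_zmod_val]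
    rw [this, ZMod.toAddCircle_natCast]
    push_cast; rfl
  have h2 : ((Units.mulLeft u).trans (Equiv.subRight ((⌊w * N⌋ : ℤ) : ZMod N))) k =
      (u : ZMod N) * k - ((⌊w * N⌋ : ℤ) : ZMod N) := rfl
  rw [h2, map_sub, h1, ZMod.toAddCircle_intCast]
  change ‖((k.val * goldenRatio : ℝ) : UnitAddCircle) - ((w : UnitAddCircle) +
    (((Nat.fib (n + 1) * k.val / N : ℝ) : UnitAddCircle) -
      ((⌊w * N⌋ / N : ℝ) : UnitAddCircle)))‖ ≤ _
  rw [← AddCircle.coe_sub, ← AddCircle.coe_add, ← AddCircle.coe_sub]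
  refine (norm_coe_le_abs _).trans ?_
  have h3 := fib_succ_sub_goldenRatio_mul_fib n
  have h4 : k.val * goldenRatio - (w + (Nat.fib (n + 1) * k.val / N - ⌊w * N⌋ / N))
      = -(k.val / N * goldenConj ^ n) - (w * N - ⌊w * N⌋) / N := by
    rw [← h3]; field_simp; ring
  rw [h4]
  have h5 : |(k.val / N * goldenConj ^ n : ℝ)| ≤ |goldenConj| ^ n := by
    rw [abs_mul, abs_pow, abs_of_nonneg (by positivity)]
    refine mul_le_of_le_one_left (by positivity) ?_
    rw [div_le_one hNr]
    exact_mod_cast (ZMod.val_lt k).le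
  have h6 : |(w * N - ⌊w * N⌋) / N| ≤ 4 * |goldenConj| ^ n := by
    rw [abs_div, abs_of_pos hNr, abs_of_nonneg (by linarith [Int.floor_le (w * N)]),
      div_le_iff₀ hNr, abs_goldenConj_pow]
    have h7 : goldenRatio ^ n ≤ 4 * (N : ℝ) := by
      obtain ⟨m, rfl⟩ : ∃ m, n = m + 1 := Nat.exists_eq_succ_of_ne_zero (by
        rintro rfl; simp [hN] at hN0)
      exact (goldenRatio_pow_le_fib m).1
    have h8 : 0 < goldenRatio ^ n := pow_pos goldenRatio_pos _
    have h9 : 1 ≤ 4 * (goldenRatio ^ n)⁻¹ * N := by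
      rw [mul_right_comm, ← div_eq_mul_inv, le_div_iff₀ h8]; linarith
    linarith [Int.lt_floor_add_one (w * N)]
  refine (abs_sub _ _).trans ?_
  rw [abs_neg]
  linarith

open Real in
/-- The multiples of the stable vector that are used for averaging: modulo 1 they are
`(k φ, -l φ)`. -/
noncomputable def stabCoeff {N : ℕ} (i : ZMod N × ZMod N) : ℝ :=
  i.2.val - i.1.val + i.1.val * goldenRatio

open Real in
theorem stab_stabCoeff {N : ℕ} (i : ZMod N × ZMod N) :
    stab (stabCoeff i) = (((i.1.val * goldenRatio : ℝ) : UnitAddCircle),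
      -((i.2.val * goldenRatio : ℝ) : UnitAddCircle)) := by
  have hz : ∀ m : ℤ, ((m : ℝ) : UnitAddCircle) = 0 := fun m => by
    simp
  unfold stab stabCoeff
  ext
  · have : ((i.2.val : ℝ) - i.1.val + i.1.val * goldenRatio) =
        ((i.2.val - i.1.val : ℤ) : ℝ) + i.1.val * goldenRatio := by push_cast; ring
    dsimp only
    rw [this, AddCircle.coe_add, hz, zero_add]
  · have : -(((i.2.val : ℝ) - i.1.val + i.1.val * goldenRatio) * goldenRatio) =
        ((-i.1.val : ℤ) : ℝ) + -(i.2.val * goldenRatio) := by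
      push_cast; linear_combination (-i.1.val : ℝ) * goldenRatio_sq
    dsimp only
    rw [this, AddCircle.coe_add, hz, zero_add, AddCircle.coe_neg]

open Real in
theorem abs_stabCoeff_le {N : ℕ} [NeZero N] (i : ZMod N × ZMod N) : |stabCoeff i| ≤ 3 * N := by
  have h1 : (i.1.val : ℝ) ≤ N := by exact_mod_cast (ZMod.val_lt i.1).le
  have h2 : (i.2.val : ℝ) ≤ N := by exact_mod_cast (ZMod.val_lt i.2).le
  have h3 : (0 : ℝ) ≤ i.1.val := by positivity
  have h4 : (0 : ℝ) ≤ i.2.val := by positivity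
  have := one_lt_goldenRatio
  have := goldenRatio_lt_two
  unfold stabCoeff
  rw [abs_le]
  constructor <;> nlinarith

theorem exists_equiv_norm_stab_le {n : ℕ} [NeZero (Nat.fib n)] (q : Torus) :
    ∃ e : (ZMod (Nat.fib n) × ZMod (Nat.fib n)) ≃ (ZMod (Nat.fib n) × ZMod (Nat.fib n)), ∀ i,
      ‖stab (stabCoeff i) - (q + (ZMod.toAddCircle (e i).1, ZMod.toAddCircle (e i).2))‖
        ≤ 5 * |Real.goldenConj| ^ n := by
  obtain ⟨e₁, h₁⟩ := exists_equiv_norm_le (n := n) q.1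
  obtain ⟨e₂, h₂⟩ := exists_equiv_norm_le (n := n) (-q.2)
  refine ⟨e₁.prodCongr (e₂.trans (Equiv.neg _)), fun i => ?_⟩
  rw [stab_stabCoeff]
  refine max_le (h₁ i.1) ?_
  refine le_of_eq_of_le ?_ (h₂ i.2)
  rw [← norm_neg]
  congr 1
  change -(-((i.2.val * Real.goldenRatio : ℝ) : UnitAddCircle) -
    (q.2 + ZMod.toAddCircle (-e₂ i.2))) = _
  rw [map_neg]
  abel

/-- The average of the indicator function of a set with thin boundary over the stable translations
`stab (stabCoeff i)` is uniformly close to the measure of the set. -/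
theorem abs_average_sub_le {E : Set Torus} (hE : MeasurableSet E) {K : ℝ} (h : ThinBoundary E K)
    {n : ℕ} [NeZero (Nat.fib n)] (p : Torus) :
    |∑ i : ZMod (Nat.fib n) × ZMod (Nat.fib n), E.indicator 1 (p + stab (stabCoeff i))
        - (Nat.fib n : ℝ) ^ 2 * volume.real E|
      ≤ (Nat.fib n : ℝ) ^ 2 * (5 * K * |Real.goldenConj| ^ n) := by
  obtain ⟨S, hSm, hS, hSE⟩ := h (5 * |Real.goldenConj| ^ n) (by positivity)
  set N := Nat.fib n
  let g : ZMod N × ZMod N → Torus := fun i => (ZMod.toAddCircle i.1, ZMod.toAddCircle i.2)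
  set c : ℝ := ∑ i : ZMod N × ZMod N, E.indicator 1 (p + stab (stabCoeff i)) with hc
  -- Compare with the regular grid `g` shifted by `q`, then integrate over `q`: the mean over all shifted
  -- grids is exact.
  have key : ∀ q : Torus, |c - ∑ i, E.indicator (1 : Torus → ℝ) (q + (p + g i))|
      ≤ ∑ i, S.indicator (1 : Torus → ℝ) (q + (p + g i)) := by
    intro q
    obtain ⟨e, he⟩ := exists_equiv_norm_stab_le (n := n) q
    rw [← Equiv.sum_comp e, ← Equiv.sum_comp e (fun i => S.indicator (1 : Torus → ℝ) _), hc,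
      ← Finset.sum_sub_distrib]
    refine (Finset.abs_sum_le_sum_abs _ _).trans (Finset.sum_le_sum fun i _ => ?_)
    by_cases hi : q + (p + g (e i)) ∈ S
    · rw [indicator_of_mem hi]
      simp only [indicator, Pi.one_apply]
      split_ifs <;> norm_num
    · have : p + stab (stabCoeff i) ∈ E ↔ q + (p + g (e i)) ∈ E := by
        refine hSE _ _ ?_ hi
        rw [show p + stab (stabCoeff i) - (q + (p + g (e i))) =
          stab (stabCoeff i) - (q + g (e i)) by abel]
        exact he i
      rw [indicator_of_notMem hi, abs_nonpos_iff, sub_eq_zero]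
      by_cases hp : p + stab (stabCoeff i) ∈ E
      · rw [indicator_of_mem hp, indicator_of_mem (this.1 hp)]; rfl
      · rw [indicator_of_notMem hp, indicator_of_notMem (fun hq => hp (this.2 hq))]
  have hint : ∀ B : Set Torus, MeasurableSet B → ∀ v : Torus,
      Integrable (fun q => B.indicator (1 : Torus → ℝ) (q + v)) := fun B hB v =>
    (measurePreserving_translate v).integrable_comp_of_integrable
      ((integrable_const (1 : ℝ)).indicator hB)
  have hval : ∀ B : Set Torus, MeasurableSet B → ∀ v : Torus,
      ∫ q, B.indicator (1 : Torus → ℝ) (q + v) = volume.real B := fun B hB v => by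
    rw [integral_add_right_eq_self (μ := (volume : Measure Torus)) (B.indicator (1 : Torus → ℝ)) v,
      integral_indicator_one hB]
  have hsum : ∀ B : Set Torus, MeasurableSet B →
      ∫ q, ∑ i, B.indicator (1 : Torus → ℝ) (q + (p + g i)) = (N : ℝ) ^ 2 * volume.real B := by
    intro B hB
    rw [integral_finsetSum _ fun i _ => hint B hB _]
    simp only [hval B hB, Finset.sum_const, Finset.card_univ, Fintype.card_prod, ZMod.card,
      nsmul_eq_mul]
    push_cast; ring
  calc |c - (N : ℝ) ^ 2 * volume.real E|
      = |∫ q : Torus, (c - ∑ i, E.indicator (1 : Torus → ℝ) (q + (p + g i)))| := by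
        rw [integral_sub (integrable_const _) (integrable_finsetSum _ fun i _ => hint E hE _),
          hsum E hE]
        simp
    _ ≤ ∫ q : Torus, |c - ∑ i, E.indicator (1 : Torus → ℝ) (q + (p + g i))| :=
        abs_integral_le_integral_abs
    _ ≤ ∫ q : Torus, ∑ i, S.indicator (1 : Torus → ℝ) (q + (p + g i)) := by
        refine integral_mono ?_ (integrable_finsetSum _ fun i _ => hint S hSm _) key
        exact ((integrable_const _).sub (integrable_finsetSum _ fun i _ => hint E hE _)).abs
    _ = (N : ℝ) ^ 2 * volume.real S := hsum S hSm
    _ ≤ _ := by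
        gcongr; linarith

/-! ### Decorrelation -/

theorem abs_measureReal_sub_le {X : Type*} [MeasurableSpace X] {μ : Measure X} [IsFiniteMeasure μ]
    {A B S : Set X} (h : ∀ x, x ∉ S → (x ∈ A ↔ x ∈ B)) : |μ.real A - μ.real B| ≤ μ.real S := by
  have h1 : A ⊆ B ∪ S := fun x hx => by
    by_cases hS : x ∈ S
    · exact Or.inr hS
    · exact Or.inl ((h x hS).1 hx)
  have h2 : B ⊆ A ∪ S := fun x hx => by
    by_cases hS : x ∈ S
    · exact Or.inr hS
    · exact Or.inl ((h x hS).2 hx)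
  have h3 := (measureReal_mono (μ := μ) h1).trans (measureReal_union_le _ _)
  have h4 := (measureReal_mono (μ := μ) h2).trans (measureReal_union_le _ _)
  rw [abs_le]
  constructor <;> linarith

open Real in
/-- Exponential decorrelation between a set with thin boundary at time `0` and its avoidance over
an arbitrarily long window that starts at time `t`. Translating by stable vectors changes the
future event little, and the averages of the indicator function of `E` over these translations are
almost constant. -/
theorem abs_decorrelation_le {E : Set Torus} (hE : MeasurableSet E) {K : ℝ}
    (h : ThinBoundary E K) (m : ℕ) {t : ℕ} (ht : t ≠ 0) :
    |volume.real (E ∩ cat^[t] ⁻¹' avoid E m) - volume.real E * volume.real (avoid E m)|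
      ≤ 17 * K * |goldenConj| ^ t := by
  have hK := h.nonneg
  set W := avoid E m with hW
  have hWm : MeasurableSet W := measurableSet_avoid hE m
  have hWt : MeasurableSet (cat^[t] ⁻¹' W) := (measurePreserving_cat_iterate t).measurable hWm
  have hN0 : 0 < Nat.fib t := Nat.fib_pos.2 (Nat.pos_of_ne_zero ht)
  have : NeZero (Nat.fib t) := ⟨hN0.ne'⟩
  set N := Nat.fib t with hN
  have hNr : (0 : ℝ) < N := by exact_mod_cast hN0
  have hEv : ∀ v : Torus, MeasurableSet ((· + v) ⁻¹' E) := fun v =>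
    (measurePreserving_translate v).measurable hE
  -- Under `cat^[t]` the stable translations contract by `goldenConj ^ (2 * t)`, of order `1 / N ^ 2`, while
  -- their length is only of order `N`.
  have h1 : ∀ i : ZMod N × ZMod N,
      |volume.real (E ∩ cat^[t] ⁻¹' W) -
        volume.real ((· + stab (stabCoeff i)) ⁻¹' E ∩ cat^[t] ⁻¹' W)|
        ≤ 12 * K * |goldenConj| ^ t := by
    intro i
    obtain ⟨S, hSm, hS, hSW⟩ :=
      exists_avoid_translate h m ((goldenConj ^ 2) ^ t * stabCoeff i)
    rw [← (measurePreserving_translate (stab (stabCoeff i))).measureReal_preimage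
      (hE.inter hWt).nullMeasurableSet]
    refine (abs_measureReal_sub_le (S := cat^[t] ⁻¹' S) fun x hx => ?_).trans ?_
    · have := hSW _ hx
      rw [← cat_iterate_stab, ← cat_iterate_add] at this
      simp only [mem_inter_iff, mem_preimage, hW, this]
    · rw [(measurePreserving_cat_iterate t).measureReal_preimage hSm.nullMeasurableSet]
      refine hS.trans ?_
      rw [abs_mul, abs_of_nonneg (by positivity)]
      have h2 : (N : ℝ) * |goldenConj| ^ t ≤ 1 := by
        rw [abs_goldenConj_pow, ← div_eq_mul_inv, div_le_one (pow_pos goldenRatio_pos _)]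
        exact (fib_le_goldenRatio_pow t).1
      have h3 : (goldenConj ^ 2) ^ t = |goldenConj| ^ t * |goldenConj| ^ t := by
        rw [← mul_pow, ← sq_abs, sq]
      calc 4 * K * ((goldenConj ^ 2) ^ t * |stabCoeff i|)
          ≤ 4 * K * ((goldenConj ^ 2) ^ t * (3 * N)) := by
            gcongr; exact abs_stabCoeff_le i
        _ = 12 * K * |goldenConj| ^ t * (N * |goldenConj| ^ t) := by rw [h3]; ring
        _ ≤ 12 * K * |goldenConj| ^ t * 1 := by gcongr
        _ = _ := mul_one _
  have h2 : |∑ i : ZMod N × ZMod N,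
        volume.real ((· + stab (stabCoeff i)) ⁻¹' E ∩ cat^[t] ⁻¹' W)
        - (N : ℝ) ^ 2 * (volume.real E * volume.real W)|
      ≤ (N : ℝ) ^ 2 * (5 * K * |goldenConj| ^ t) := by
    have hint : ∀ i : ZMod N × ZMod N, IntegrableOn
        (fun p => E.indicator (1 : Torus → ℝ) (p + stab (stabCoeff i))) (cat^[t] ⁻¹' W) :=
      fun i => ((measurePreserving_translate _).integrable_comp_of_integrable
        ((integrable_const (1 : ℝ)).indicator hE)).integrableOn
    have h3 : ∀ i : ZMod N × ZMod N,
        volume.real ((· + stab (stabCoeff i)) ⁻¹' E ∩ cat^[t] ⁻¹' W) =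
        ∫ p in cat^[t] ⁻¹' W, E.indicator (1 : Torus → ℝ) (p + stab (stabCoeff i)) := by
      intro i
      change _ = ∫ p in cat^[t] ⁻¹' W,
        ((· + stab (stabCoeff i)) ⁻¹' E).indicator (1 : Torus → ℝ) p
      rw [integral_indicator_one (hEv _), measureReal_restrict_apply (hEv _)]
    have h4 : ∫ _ in cat^[t] ⁻¹' W, (N : ℝ) ^ 2 * volume.real E =
        (N : ℝ) ^ 2 * (volume.real E * volume.real W) := by
      rw [setIntegral_const,
        (measurePreserving_cat_iterate t).measureReal_preimage hWm.nullMeasurableSet, smul_eq_mul]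
      ring
    rw [Finset.sum_congr rfl fun i _ => h3 i, ← integral_finsetSum _ fun i _ => hint i, ← h4,
      ← integral_sub (integrable_finsetSum _ fun i _ => hint i) (integrable_const _)]
    refine (norm_setIntegral_le_of_norm_le_const
      (f := fun p => ∑ i : ZMod N × ZMod N, E.indicator (1 : Torus → ℝ) (p + stab (stabCoeff i))
        - (N : ℝ) ^ 2 * volume.real E)
      (C := (N : ℝ) ^ 2 * (5 * K * |goldenConj| ^ t)) (measure_lt_top _ _)
      fun p _ => abs_average_sub_le hE h p).trans ?_
    refine mul_le_of_le_one_right (by positivity) measureReal_le_one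
  have h5 : |∑ i : ZMod N × ZMod N, (volume.real (E ∩ cat^[t] ⁻¹' W) -
        volume.real ((· + stab (stabCoeff i)) ⁻¹' E ∩ cat^[t] ⁻¹' W))|
      ≤ (N : ℝ) ^ 2 * (12 * K * |goldenConj| ^ t) := by
    refine (Finset.abs_sum_le_sum_abs _ _).trans ((Finset.sum_le_sum fun i _ => h1 i).trans ?_)
    simp only [Finset.sum_const, Finset.card_univ, Fintype.card_prod, ZMod.card, nsmul_eq_mul]
    push_cast
    rw [sq]
  rw [Finset.sum_sub_distrib] at h5
  simp only [Finset.sum_const, Finset.card_univ, Fintype.card_prod, ZMod.card, nsmul_eq_mul] at h5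
  push_cast at h5
  rw [← sq] at h5
  have h6 := (abs_add_le _ _).trans (add_le_add h5 h2)
  rw [sub_add_sub_cancel, ← mul_sub, abs_mul, abs_of_nonneg (by positivity), ← mul_add] at h6
  have h7 := le_of_mul_le_mul_left h6 (by positivity)
  linarith

/-! ### Poisson limit for avoidance probabilities -/

theorem measureReal_avoid_succ {E : Set Torus} (hE : MeasurableSet E) (m : ℕ) :
    volume.real (avoid E (m + 1)) =
      volume.real (avoid E m) - volume.real (E ∩ cat ⁻¹' avoid E m) := by
  have hW := measurableSet_avoid hE m
  have h1 : avoid E (m + 1) = cat ⁻¹' avoid E m \ E := by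
    ext t
    constructor
    · intro ht
      exact ⟨fun i hi => ht (i + 1) (by omega), ht 0 (by omega)⟩
    · rintro ⟨h1, h2⟩ i hi
      cases i with
      | zero => exact h2
      | succ i => exact h1 i (by omega)
  have h2 := measureReal_sdiff_add_inter (μ := volume) (s := cat ⁻¹' avoid E m) hE
  rw [measurePreserving_cat.measureReal_preimage hW.nullMeasurableSet] at h2
  rw [h1, inter_comm E]
  linarith

theorem avoid_subset_union {E : Set Torus} (m t : ℕ) :
    cat^[t] ⁻¹' avoid E (m + 1 - t) ⊆
      cat ⁻¹' avoid E m ∪ ⋃ j ∈ Finset.Ico 1 t, cat^[j] ⁻¹' E := by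
  intro x hx
  by_cases h : x ∈ cat ⁻¹' avoid E m
  · exact Or.inl h
  · right
    simp only [avoid, mem_preimage, mem_ofPred_eq, not_forall, not_not] at h
    obtain ⟨i, hi, hxi⟩ := h
    simp only [mem_iUnion, Finset.mem_Ico, mem_preimage]
    refine ⟨i + 1, ⟨by omega, ?_⟩, hxi⟩
    by_contra hcon
    refine hx (i + 1 - t) (by omega) ?_
    rw [← Function.iterate_add_apply, show i + 1 - t + t = i + 1 by omega]
    exact hxi

theorem preimage_avoid_subset {E : Set Torus} (m : ℕ) {t : ℕ} (ht : t ≠ 0) :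
    cat ⁻¹' avoid E m ⊆ cat^[t] ⁻¹' avoid E (m + 1 - t) := by
  intro x hx i hi
  rw [← Function.iterate_add_apply]
  have := hx (i + t - 1) (by omega)
  rwa [← Function.iterate_succ_apply, show (i + t - 1).succ = i + t by omega] at this

open Real in
/-- One more time step multiplies the avoidance probability by `1 - vol E`, up to the probability of
a return to `E` before time `t` and the decorrelation error at time `t`. -/
theorem abs_avoid_succ_sub_le {E : Set Torus} (hE : MeasurableSet E) {K : ℝ}
    (h : ThinBoundary E K) (m : ℕ) {t : ℕ} (ht : t ≠ 0) :
    |volume.real (avoid E (m + 1)) - (1 - volume.real E) * volume.real (avoid E m)| ≤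
      ∑ j ∈ Finset.Ico 1 t, volume.real (E ∩ cat^[j] ⁻¹' E) + 17 * K * |goldenConj| ^ t
        + t * volume.real E ^ 2 := by
  set e := volume.real E
  have he : 0 ≤ e := measureReal_nonneg
  -- The future event is relaxed to avoidance from time `t` on, which decorrelates from `E`.
  set m' := m + 1 - t with hm'
  have hW := measurableSet_avoid hE m
  have hW' := measurableSet_avoid hE m'
  have hsub := preimage_avoid_subset (E := E) m ht
  have hsub' := avoid_subset_union (E := E) m t
  rw [← hm'] at hsub hsub'
  have h1 := abs_le.1 (abs_decorrelation_le hE h m' ht)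
  have h2 : volume.real (E ∩ cat ⁻¹' avoid E m) ≤ volume.real (E ∩ cat^[t] ⁻¹' avoid E m') :=
    measureReal_mono (inter_subset_inter_right _ hsub)
  have h3 : volume.real (E ∩ cat^[t] ⁻¹' avoid E m') ≤ volume.real (E ∩ cat ⁻¹' avoid E m) +
      ∑ j ∈ Finset.Ico 1 t, volume.real (E ∩ cat^[j] ⁻¹' E) := by
    have : E ∩ cat^[t] ⁻¹' avoid E m' ⊆
        (E ∩ cat ⁻¹' avoid E m) ∪ ⋃ j ∈ Finset.Ico 1 t, (E ∩ cat^[j] ⁻¹' E) := by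
      rw [← inter_iUnion₂, ← inter_union_distrib_left]
      exact inter_subset_inter_right _ hsub'
    refine (measureReal_mono this).trans ((measureReal_union_le _ _).trans ?_)
    gcongr
    exact measureReal_biUnion_finset_le _ _
  have h4 : volume.real (avoid E m) ≤ volume.real (avoid E m') := by
    rw [← measurePreserving_cat.measureReal_preimage hW.nullMeasurableSet,
      ← (measurePreserving_cat_iterate t).measureReal_preimage hW'.nullMeasurableSet]
    exact measureReal_mono hsub
  have h5 : volume.real (avoid E m') ≤ volume.real (avoid E m) + t * e := by
    rw [← measurePreserving_cat.measureReal_preimage hW.nullMeasurableSet,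
      ← (measurePreserving_cat_iterate t).measureReal_preimage hW'.nullMeasurableSet]
    refine (measureReal_mono hsub').trans ((measureReal_union_le _ _).trans ?_)
    gcongr
    refine (measureReal_biUnion_finset_le _ _).trans ?_
    rw [Finset.sum_congr rfl fun j _ =>
      (measurePreserving_cat_iterate j).measureReal_preimage hE.nullMeasurableSet]
    rw [Finset.sum_const, Nat.card_Ico, nsmul_eq_mul]
    gcongr
    omega
  rw [measureReal_avoid_succ hE]
  have h6 : 0 ≤ 17 * K * |goldenConj| ^ t := by have := h.nonneg; positivity
  have h7 : 0 ≤ ∑ j ∈ Finset.Ico 1 t, volume.real (E ∩ cat^[j] ⁻¹' E) :=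
    Finset.sum_nonneg fun _ _ => measureReal_nonneg
  have h8 := mul_le_mul_of_nonneg_left h4 he
  have h9 := mul_le_mul_of_nonneg_left h5 he
  rw [abs_le]
  constructor <;> nlinarith

open Real in
/-- The one-step errors add up, since the factors `1 - vol E` are at most `1`. -/
theorem abs_avoid_sub_pow_le {E : Set Torus} (hE : MeasurableSet E) {K : ℝ}
    (h : ThinBoundary E K) (n : ℕ) {t : ℕ} (ht : t ≠ 0) :
    |volume.real (avoid E n) - (1 - volume.real E) ^ n| ≤
      n * (∑ j ∈ Finset.Ico 1 t, volume.real (E ∩ cat^[j] ⁻¹' E) + 17 * K * |goldenConj| ^ t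
        + t * volume.real E ^ 2) := by
  have he0 : 0 ≤ volume.real E := measureReal_nonneg
  have he1 : volume.real E ≤ 1 := measureReal_le_one
  induction n with
  | zero =>
    have : avoid E 0 = univ := eq_univ_of_forall fun t i hi => absurd hi (Nat.not_lt_zero i)
    simp [this]
  | succ n ih =>
    have h1 := abs_avoid_succ_sub_le hE h n ht
    have h2 : |(1 - volume.real E) * volume.real (avoid E n) - (1 - volume.real E) ^ (n + 1)| ≤
        |volume.real (avoid E n) - (1 - volume.real E) ^ n| := by
      rw [pow_succ', ← mul_sub, abs_mul]
      refine mul_le_of_le_one_left (abs_nonneg _) ?_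
      rw [abs_le]; constructor <;> linarith
    have h3 := abs_sub_le (volume.real (avoid E (n + 1)))
      ((1 - volume.real E) * volume.real (avoid E n)) ((1 - volume.real E) ^ (n + 1))
    push_cast
    linarith

/-- Length of the time gap, of logarithmic order, after which decorrelation errors are summable. -/
def gap (n : ℕ) : ℕ := 4 * (Nat.log 2 n + 1)

theorem tendsto_natLog_atTop : Tendsto (fun n => Nat.log 2 n) atTop atTop := by
  refine tendsto_atTop.2 fun b => ?_
  filter_upwards [eventually_ge_atTop (2 ^ b)] with n hn
  exact Nat.le_log_of_pow_le (by norm_num) hn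

theorem tendsto_gap_div : Tendsto (fun n : ℕ => (gap n : ℝ) / n) atTop (𝓝 0) := by
  have h1 : Tendsto (fun l : ℕ => 4 * ((l : ℝ) * (1 / 2) ^ l) + 4 * (1 / 2 : ℝ) ^ l) atTop (𝓝 0) := by
    have h2 := tendsto_self_mul_const_pow_of_lt_one (r := (1 / 2 : ℝ)) (by norm_num) (by norm_num)
    have h3 := tendsto_pow_atTop_nhds_zero_of_lt_one (r := (1 / 2 : ℝ)) (by norm_num) (by norm_num)
    simpa using (h2.const_mul 4).add (h3.const_mul 4)
  refine squeeze_zero' (Eventually.of_forall fun n => by positivity) ?_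
    (h1.comp tendsto_natLog_atTop)
  filter_upwards [eventually_gt_atTop 0] with n hn
  have h4 : ((2 ^ Nat.log 2 n : ℕ) : ℝ) ≤ n := by
    exact_mod_cast Nat.pow_log_le_self 2 hn.ne'
  push_cast at h4
  simp only [Function.comp, gap]
  push_cast
  calc 4 * ((Nat.log 2 n : ℝ) + 1) / n ≤ 4 * ((Nat.log 2 n : ℝ) + 1) / 2 ^ Nat.log 2 n := by
        gcongr
    _ = _ := by rw [one_div, inv_pow]; ring

open Real in
/-- The constant in `gap` makes the decorrelation error `O(n⁻²)`, which can be summed over `n` steps. -/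
theorem goldenConj_pow_gap_le {n : ℕ} (hn : 0 < n) : |goldenConj| ^ gap n ≤ 1 / (n : ℝ) ^ 2 := by
  have h1 : (|goldenConj| ^ 2) ^ 2 ≤ (1 / 2) ^ 2 := by
    rw [sq_abs]
    exact pow_le_pow_left₀ (sq_nonneg _) goldenConj_sq_lt_half.le _
  have h2 : ((n : ℕ) : ℝ) ≤ ((2 ^ (Nat.log 2 n + 1) : ℕ) : ℝ) := by
    exact_mod_cast (Nat.lt_pow_succ_log_self (by norm_num) n).le
  push_cast at h2
  have hn' : (0 : ℝ) < n := by exact_mod_cast hn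
  calc |goldenConj| ^ gap n = ((|goldenConj| ^ 2) ^ 2) ^ (Nat.log 2 n + 1) := by
        rw [gap, ← pow_mul, ← pow_mul, ← mul_assoc]; norm_num
    _ ≤ ((1 / 2) ^ 2) ^ (Nat.log 2 n + 1) := pow_le_pow_left₀ (by positivity) h1 _
    _ = 1 / (2 ^ (Nat.log 2 n + 1)) ^ 2 := by
        rw [← pow_mul, mul_comm, pow_mul, one_div_pow, one_div_pow]
    _ ≤ _ := by gcongr

open Real in
/-- Poisson limit for sets without short returns. -/
theorem tendsto_avoid {E : ℕ → Set Torus} (hE : ∀ n, MeasurableSet (E n)) {K : ℝ}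
    (h : ∀ n, ThinBoundary (E n) K) {τ : ℝ}
    (hτ : Tendsto (fun n : ℕ => n * volume.real (E n)) atTop (𝓝 τ))
    (hret : Tendsto (fun n : ℕ => n * ∑ j ∈ Finset.Ico 1 (gap n),
      volume.real (E n ∩ cat^[j] ⁻¹' E n)) atTop (𝓝 0)) :
    Tendsto (fun n => volume.real (avoid (E n) n)) atTop (𝓝 (exp (-τ))) := by
  have h1 : Tendsto (fun n : ℕ => (1 - volume.real (E n)) ^ n) atTop (𝓝 (exp (-τ))) := by
    simp only [sub_eq_add_neg]
    refine tendsto_one_add_pow_exp_of_tendsto ?_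
    simpa using hτ.neg
  have h2 : Tendsto (fun n : ℕ => n * (∑ j ∈ Finset.Ico 1 (gap n),
      volume.real (E n ∩ cat^[j] ⁻¹' E n) + 17 * K * |goldenConj| ^ gap n
        + gap n * volume.real (E n) ^ 2)) atTop (𝓝 0) := by
    have h3 : Tendsto (fun n : ℕ => n * (17 * K * |goldenConj| ^ gap n)) atTop (𝓝 0) := by
      have h5 : Tendsto (fun n : ℕ => 17 * K * (1 / (n : ℝ))) atTop (𝓝 0) := by
        simpa using tendsto_one_div_atTop_nhds_zero_nat.const_mul (17 * K)
      have hK := (h 0).nonneg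
      refine squeeze_zero' (Eventually.of_forall fun n => by positivity) ?_ h5
      filter_upwards [eventually_gt_atTop 0] with n hn
      have hn' : (0 : ℝ) < n := by exact_mod_cast hn
      calc n * (17 * K * |goldenConj| ^ gap n) ≤ n * (17 * K * (1 / (n : ℝ) ^ 2)) := by
            gcongr; exact goldenConj_pow_gap_le hn
        _ = _ := by field_simp
    have h4 : Tendsto (fun n : ℕ => n * (gap n * volume.real (E n) ^ 2)) atTop (𝓝 0) := by
      have h5 := (hτ.mul hτ).mul tendsto_gap_div
      rw [mul_zero] at h5
      refine h5.congr' ?_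
      filter_upwards [eventually_gt_atTop 0] with n hn
      have hn' : (n : ℝ) ≠ 0 := by exact_mod_cast hn.ne'
      field_simp
    have h5 := (hret.add h3).add h4
    simp only [add_zero] at h5
    exact h5.congr fun n => by ring
  have h3 := squeeze_zero_norm
    (f := fun n => volume.real (avoid (E n) n) - (1 - volume.real (E n)) ^ n)
    (fun n => abs_avoid_sub_pow_le (hE n) (h n) n (t := gap n) (by simp [gap])) h2
  simpa using h3.add h1

/-- If an orbit avoids the exit set `A \ cat ⁻¹' A` but not `A`, it is still in `A` at the end of
the time window. -/
theorem avoid_diff_subset (A : Set Torus) (n : ℕ) :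
    avoid (A \ cat ⁻¹' A) n ⊆ avoid A n ∪ cat^[n - 1] ⁻¹' A := by
  intro x hx
  by_cases h : x ∈ avoid A n
  · exact Or.inl h
  · right
    simp only [avoid, mem_ofPred_eq, not_forall, not_not] at h
    obtain ⟨i, hi, hxi⟩ := h
    have key : ∀ k, i + k < n → cat^[i + k] x ∈ A := by
      intro k
      induction k with
      | zero => exact fun _ => hxi
      | succ k ih =>
        intro hk
        by_contra hcon
        refine hx (i + k) (by omega) ⟨ih (by omega), ?_⟩
        rw [← add_assoc, Function.iterate_succ_apply'] at hcon
        exact hcon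
    have := key (n - 1 - i) (by omega)
    rwa [show i + (n - 1 - i) = n - 1 by omega] at this

open Real in
/-- Poisson limit in the presence of clustering: it suffices to control the exit sets
`A n \ cat ⁻¹' A n`, whose measure takes the extremal index into account. -/
theorem tendsto_avoid_of_exit {A : ℕ → Set Torus} (hA : ∀ n, MeasurableSet (A n)) {K : ℝ}
    (h : ∀ n, ThinBoundary (A n) K) {τ : ℝ}
    (h0 : Tendsto (fun n : ℕ => volume.real (A n)) atTop (𝓝 0))
    (hτ : Tendsto (fun n : ℕ => n * volume.real (A n \ cat ⁻¹' A n)) atTop (𝓝 τ))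
    (hret : Tendsto (fun n : ℕ => n * ∑ j ∈ Finset.Ico 1 (gap n),
      volume.real ((A n \ cat ⁻¹' A n) ∩ cat^[j] ⁻¹' (A n \ cat ⁻¹' A n))) atTop (𝓝 0)) :
    Tendsto (fun n => volume.real (avoid (A n) n)) atTop (𝓝 (exp (-τ))) := by
  have h1 := tendsto_avoid (fun n => (hA n).diff (measurePreserving_cat.measurable (hA n)))
    (fun n => (h n).diff_preimage_cat) hτ hret
  have h2 : ∀ n, |volume.real (avoid (A n) n) - volume.real (avoid (A n \ cat ⁻¹' A n) n)| ≤
      volume.real (A n) := by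
    intro n
    rw [← (measurePreserving_cat_iterate (n - 1)).measureReal_preimage (hA n).nullMeasurableSet]
    refine abs_measureReal_sub_le fun x hx => ⟨fun hxA i hi hxi => hxA i hi hxi.1, fun hxE => ?_⟩
    exact (avoid_diff_subset (A n) n hxE).resolve_right hx
  have h3 := squeeze_zero_norm (f := fun n => volume.real (avoid (A n) n) -
    volume.real (avoid (A n \ cat ⁻¹' A n) n)) h2 h0
  simpa using h3.add h1

/-! ### Generalised extreme value laws -/

/-- The quantile of the generalised extreme value law at the level `exp (-s)`. -/
noncomputable def gevQuantile (ξ μ σ s : ℝ) : ℝ :=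
  if ξ = 0 then μ - σ * Real.log s else μ + σ * ((s ^ (-ξ) - 1) / ξ)

theorem gevCDF_lt_of_lt_gevQuantile {ξ μ σ s x : ℝ} (hσ : 0 < σ) (hs : 0 < s)
    (hx : x < gevQuantile ξ μ σ s) : gevCDF ξ μ σ x < Real.exp (-s) := by
  unfold gevQuantile at hx
  unfold gevCDF
  split_ifs at hx ⊢ with h0 hz hξ
  · rw [Real.exp_lt_exp, neg_lt_neg_iff, ← Real.log_lt_iff_lt_exp hs, lt_neg, div_lt_iff₀ hσ]
    linarith
  · have hu : (x - μ) / σ < (s ^ (-ξ) - 1) / ξ := by rw [div_lt_iff₀ hσ]; linarith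
    have hsp : (s ^ (-ξ)) ^ (-1 / ξ) = s := by
      rw [← Real.rpow_mul hs.le, show -ξ * (-1 / ξ) = 1 by field_simp, Real.rpow_one]
    have hs' : 0 < s ^ (-ξ) := Real.rpow_pos_of_pos hs _
    rw [Real.exp_lt_exp, neg_lt_neg_iff]
    nth_rewrite 1 [← hsp]
    rcases lt_or_gt_of_ne h0 with hneg | hpos
    · rw [lt_div_iff_of_neg hneg] at hu
      exact Real.rpow_lt_rpow hs'.le (by linarith) (div_pos_of_neg_of_neg (by norm_num) hneg)
    · rw [lt_div_iff₀ hpos] at hu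
      exact Real.rpow_lt_rpow_of_neg hz (by linarith) (div_neg_of_neg_of_pos (by norm_num) hpos)
  · exfalso
    have hu : (x - μ) / σ < (s ^ (-ξ) - 1) / ξ := by rw [div_lt_iff₀ hσ]; linarith
    rw [lt_div_iff_of_neg hξ] at hu
    have hs' : 0 < s ^ (-ξ) := Real.rpow_pos_of_pos hs _
    linarith
  · exact Real.exp_pos _

theorem lt_gevCDF_of_gevQuantile_lt {ξ μ σ s x : ℝ} (hσ : 0 < σ) (hs : 0 < s)
    (hx : gevQuantile ξ μ σ s < x) : Real.exp (-s) < gevCDF ξ μ σ x := by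
  unfold gevQuantile at hx
  unfold gevCDF
  split_ifs at hx ⊢ with h0 hz hξ
  · rw [Real.exp_lt_exp, neg_lt_neg_iff, ← Real.lt_log_iff_exp_lt hs, neg_lt, lt_div_iff₀ hσ]
    linarith
  · have hu : (s ^ (-ξ) - 1) / ξ < (x - μ) / σ := by rw [lt_div_iff₀ hσ]; linarith
    have hsp : (s ^ (-ξ)) ^ (-1 / ξ) = s := by
      rw [← Real.rpow_mul hs.le, show -ξ * (-1 / ξ) = 1 by field_simp, Real.rpow_one]
    have hs' : 0 < s ^ (-ξ) := Real.rpow_pos_of_pos hs _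
    rw [Real.exp_lt_exp, neg_lt_neg_iff]
    nth_rewrite 1 [← hsp]
    rcases lt_or_gt_of_ne h0 with hneg | hpos
    · rw [div_lt_iff_of_neg hneg] at hu
      exact Real.rpow_lt_rpow hz.le (by linarith) (div_pos_of_neg_of_neg (by norm_num) hneg)
    · rw [div_lt_iff₀ hpos] at hu
      exact Real.rpow_lt_rpow_of_neg hs' (by linarith) (div_neg_of_neg_of_pos (by norm_num) hpos)
  · exact (Real.exp_lt_exp.2 (by linarith)).trans_eq Real.exp_zero
  · exfalso
    have hpos : 0 < ξ := lt_of_le_of_ne (not_lt.1 hξ) (Ne.symm h0)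
    have hu : (s ^ (-ξ) - 1) / ξ < (x - μ) / σ := by rw [lt_div_iff₀ hσ]; linarith
    rw [div_lt_iff₀ hpos] at hu
    have hs' : 0 < s ^ (-ξ) := Real.rpow_pos_of_pos hs _
    linarith

theorem gevCDF_gevQuantile {ξ μ σ s : ℝ} (hσ : 0 < σ) (hs : 0 < s) :
    gevCDF ξ μ σ (gevQuantile ξ μ σ s) = Real.exp (-s) := by
  unfold gevQuantile gevCDF
  split_ifs with h0 hz hξ
  · rw [show -((μ - σ * Real.log s - μ) / σ) = Real.log s by field_simp; ring, Real.exp_log hs]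
  all_goals
    have hz' : 1 + ξ * ((μ + σ * ((s ^ (-ξ) - 1) / ξ) - μ) / σ) = s ^ (-ξ) := by field_simp; ring
  · rw [hz', ← Real.rpow_mul hs.le, show -ξ * (-1 / ξ) = 1 by field_simp, Real.rpow_one]
  all_goals exact absurd ((Real.rpow_pos_of_pos hs _).trans_eq hz'.symm) hz

/-- The spacings of the quantiles at `s = 1, 2, 4` determine the tail index. -/
theorem gevQuantile_four_sub {ξ μ σ : ℝ} :
    gevQuantile ξ μ σ 4 - gevQuantile ξ μ σ 2 =
      (2 : ℝ) ^ (-ξ) * (gevQuantile ξ μ σ 2 - gevQuantile ξ μ σ 1) := by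
  unfold gevQuantile
  split_ifs with h0
  · rw [h0, show (4 : ℝ) = 2 ^ 2 by norm_num, Real.log_pow]
    simp only [neg_zero, Real.rpow_zero, Real.log_one]
    push_cast; ring
  · rw [show (4 : ℝ) = 2 * 2 by norm_num, Real.mul_rpow (by norm_num) (by norm_num), Real.one_rpow]
    ring

theorem gevQuantile_two_ne {ξ μ σ : ℝ} (hσ : 0 < σ) :
    gevQuantile ξ μ σ 2 - gevQuantile ξ μ σ 1 ≠ 0 := by
  unfold gevQuantile
  split_ifs with h0
  · have := Real.log_pos (show (1 : ℝ) < 2 by norm_num)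
    rw [Real.log_one]
    have := mul_pos hσ this
    intro h; linarith
  · rw [Real.one_rpow]
    intro h
    have h1 : σ * (((2 : ℝ) ^ (-ξ) - 1) / ξ) = 0 := by
      have : (1 - 1 : ℝ) / ξ = 0 := by simp
      rw [this] at h; linarith
    have h2 : (2 : ℝ) ^ (-ξ) = 2 ^ (0 : ℝ) := by
      rw [Real.rpow_zero]
      rcases mul_eq_zero.1 h1 with h | h
      · exact absurd h hσ.ne'
      · rcases div_eq_zero_iff.1 h with h | h
        · linarith
        · exact absurd h h0
    have h3 := Real.rpow_right_inj (by norm_num : (0 : ℝ) < 2) (by norm_num) |>.1 h2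
    exact h0 (by linarith)

/-- Convergence of types: two normalisations of the same maxima with generalised extreme value
limits are asymptotically related by an affine map which matches the quantiles of the limits. -/
theorem tendsto_normalisation {Ω : Type*} [MeasurableSpace Ω] {P : Measure Ω} [IsFiniteMeasure P]
    {M : ℕ → Ω → ℝ} {ξ μ σ ξ' μ' σ' : ℝ} {a b a' b' : ℕ → ℝ} (ha : ∀ n, 0 < a n)
    (ha' : ∀ n, 0 < a' n) (hσ : 0 < σ) (hσ' : 0 < σ')
    (h : ∀ x : ℝ, Tendsto (fun n => P.real {ω | a n * (M n ω - b n) ≤ x}) atTop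
      (𝓝 (gevCDF ξ μ σ x)))
    (h' : ∀ x : ℝ, Tendsto (fun n => P.real {ω | a' n * (M n ω - b' n) ≤ x}) atTop
      (𝓝 (gevCDF ξ' μ' σ' x))) {s : ℝ} (hs : 0 < s) :
    Tendsto (fun n => a n * (b' n - b n + gevQuantile ξ' μ' σ' s / a' n)) atTop
      (𝓝 (gevQuantile ξ μ σ s)) := by
  -- A strict inequality between the distribution functions forces one between the thresholds.
  have key : ∀ (x y : ℝ) (n : ℕ) (a b a' b' : ℕ → ℝ), (∀ n, 0 < a n) → (∀ n, 0 < a' n) →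
      P.real {ω | a n * (M n ω - b n) ≤ x} < P.real {ω | a' n * (M n ω - b' n) ≤ y} →
      b n + x / a n < b' n + y / a' n := by
    intro x y n a b a' b' ha ha' hlt
    by_contra hcon
    push Not at hcon
    refine absurd hlt (not_lt.2 (measureReal_mono fun ω hω => ?_))
    simp only [mem_ofPred_eq] at hω ⊢
    rw [mul_comm, ← le_div_iff₀ (ha' n)] at hω
    rw [mul_comm, ← le_div_iff₀ (ha n)]
    linarith
  have h0 := h' (gevQuantile ξ' μ' σ' s)
  rw [gevCDF_gevQuantile hσ' hs] at h0
  refine tendsto_order.2 ⟨fun x hx => ?_, fun x hx => ?_⟩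
  · filter_upwards [(h x).eventually_lt h0 (gevCDF_lt_of_lt_gevQuantile hσ hs hx)] with n hn
    have := key _ _ n a b a' b' ha ha' hn
    rw [mul_comm, ← div_lt_iff₀ (ha n)]
    linarith
  · filter_upwards [h0.eventually_lt (h x) (lt_gevCDF_of_gevQuantile_lt hσ hs hx)] with n hn
    have := key _ _ n a' b' a b ha' ha hn
    rw [mul_comm, ← lt_div_iff₀ (ha n)]
    linarith

/-- The tail index of the limit is unique. -/
theorem IsGEVTailIndex.unique {Ω : Type*} [MeasurableSpace Ω] {P : Measure Ω} [IsFiniteMeasure P]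
    {M : ℕ → Ω → ℝ} {ξ ξ' : ℝ} (h : IsGEVTailIndex P M ξ) (h' : IsGEVTailIndex P M ξ') :
    ξ = ξ' := by
  obtain ⟨a, b, μ, σ, ha, hσ, h⟩ := h
  obtain ⟨a', b', μ', σ', ha', hσ', h'⟩ := h'
  have key := fun {s : ℝ} (hs : 0 < s) => tendsto_normalisation ha ha' hσ hσ' h h' hs
  have h1 := key (s := 1) (by norm_num)
  have h2 := key (s := 2) (by norm_num)
  have h4 := key (s := 4) (by norm_num)
  have h5 := h4.sub h2
  have h6 := (h2.sub h1).const_mul ((2 : ℝ) ^ (-ξ'))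
  have h7 : gevQuantile ξ μ σ 4 - gevQuantile ξ μ σ 2 =
      (2 : ℝ) ^ (-ξ') * (gevQuantile ξ μ σ 2 - gevQuantile ξ μ σ 1) := by
    refine tendsto_nhds_unique h5 (h6.congr fun n => ?_)
    have := gevQuantile_four_sub (ξ := ξ') (μ := μ') (σ := σ')
    linear_combination (-(a n) / a' n) * this
  rw [gevQuantile_four_sub] at h7
  have h8 := mul_right_cancel₀ (gevQuantile_two_ne hσ) h7
  have h9 := (Real.rpow_right_inj (by norm_num : (0 : ℝ) < 2) (by norm_num)).1 h8
  linarith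

/-- A Weibull limit `exp (-C (-x) ^ κ)` of the maxima determines the tail index. -/
theorem isGEVTailIndex_iff {Ω : Type*} [MeasurableSpace Ω] {P : Measure Ω} [IsFiniteMeasure P]
    {M : ℕ → Ω → ℝ} {a b : ℕ → ℝ} {C κ : ℝ} (ha : ∀ n, 0 < a n) (hC : 0 < C) (hκ : 0 < κ)
    (hneg : ∀ x < 0, Tendsto (fun n => P.real {ω | a n * (M n ω - b n) ≤ x}) atTop
      (𝓝 (Real.exp (-(C * (-x) ^ κ)))))
    (hpos : ∀ x, 0 ≤ x → Tendsto (fun n => P.real {ω | a n * (M n ω - b n) ≤ x}) atTop (𝓝 1))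
    (ξ : ℝ) : IsGEVTailIndex P M ξ ↔ -1 / ξ = κ := by
  have hex : IsGEVTailIndex P M (-1 / κ) := by
    set c := C ^ (1 / κ) with hc
    have hc0 : 0 < c := Real.rpow_pos_of_pos hC _
    refine ⟨a, b, -1 / c, 1 / (κ * c), ha, by positivity, fun x => ?_⟩
    have hne : -1 / κ ≠ 0 := div_ne_zero (by norm_num) hκ.ne'
    have hz : 1 + -1 / κ * ((x - -1 / c) / (1 / (κ * c))) = c * -x := by field_simp; ring
    have he : -1 / (-1 / κ) = κ := by field_simp
    unfold gevCDF
    rw [if_neg hne, hz, he]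
    rcases lt_or_ge x 0 with hx | hx
    · rw [if_pos (mul_pos hc0 (by linarith)), Real.mul_rpow hc0.le (by linarith), hc,
        ← Real.rpow_mul hC.le, one_div_mul_cancel hκ.ne', Real.rpow_one]
      exact hneg x hx
    · rw [if_neg (by nlinarith), if_pos (div_neg_of_neg_of_pos (by norm_num) hκ)]
      exact hpos x hx
  constructor
  · intro h
    rw [h.unique hex]
    field_simp
  · intro h
    have : ξ = -1 / κ := by
      have hξ : ξ ≠ 0 := by
        rintro rfl
        simp at h
        exact hκ.ne h
      rw [← h]; field_simp
    rwa [this]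

/-! ### Coordinates on the torus -/

/-- The representative in `[0, 1)` of a point of the circle. -/
noncomputable def frac (t : UnitAddCircle) : ℝ := AddCircle.equivIco (1 : ℝ) 0 t

theorem frac_coe (x : ℝ) : frac x = Int.fract x := by
  unfold frac
  rw [AddCircle.coe_equivIco_mk_apply]
  simp

theorem coe_frac (t : UnitAddCircle) : ((frac t : ℝ) : UnitAddCircle) = t :=
  (AddCircle.equivIco (1 : ℝ) 0).symm_apply_apply t

theorem frac_mem (t : UnitAddCircle) : frac t ∈ Ico (0 : ℝ) 1 := by
  have h : frac t ∈ Ico (0 : ℝ) (0 + 1) := (AddCircle.equivIco (1 : ℝ) 0 t).2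
  rwa [zero_add] at h

theorem frac_coe_of_mem {x : ℝ} (hx : x ∈ Ico (0 : ℝ) 1) : frac x = x := by
  rw [frac_coe, Int.fract_eq_self]; exact hx

theorem measurable_frac : Measurable frac :=
  measurable_subtype_coe.comp (AddCircle.measurableEquivIco (1 : ℝ) 0).measurable

/-- The covering map of the torus. -/
def proj (p : ℝ × ℝ) : Torus := (p.1, p.2)

theorem measurePreserving_coe_Ico (s : ℝ) : MeasurePreserving ((↑) : ℝ → UnitAddCircle)
    (volume.restrict (Ico s (s + 1))) volume := by
  rw [Measure.restrict_congr_set Ico_ae_eq_Ioc]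
  exact UnitAddCircle.measurePreserving_mk s

theorem measurePreserving_proj (s : ℝ) : MeasurePreserving proj
    (volume.restrict (Ico s (s + 1) ×ˢ Ico s (s + 1))) volume := by
  have := (measurePreserving_coe_Ico s).prod (measurePreserving_coe_Ico s)
  rw [Measure.prod_restrict] at this
  exact this

theorem measurable_proj : Measurable proj := (measurePreserving_proj 0).measurable

/-- Areas on the torus can be computed in any unit square of the plane. -/
theorem measureReal_eq_inter_proj (s : ℝ) {S : Set Torus} (hS : MeasurableSet S) :
    volume.real S = volume.real (proj ⁻¹' S ∩ Ico s (s + 1) ×ˢ Ico s (s + 1)) := by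
  rw [← (measurePreserving_proj s).measureReal_preimage hS.nullMeasurableSet,
    measureReal_restrict_apply (measurable_proj hS)]

theorem measureReal_frac_preimage_le {B : Set (ℝ × ℝ)} (hB : MeasurableSet B)
    (hfin : volume B ≠ ⊤) :
    volume.real {t : Torus | (frac t.1, frac t.2) ∈ B} ≤ volume.real B := by
  have hm : MeasurableSet {t : Torus | (frac t.1, frac t.2) ∈ B} :=
    ((measurable_frac.comp measurable_fst).prodMk (measurable_frac.comp measurable_snd)) hB
  rw [measureReal_eq_inter_proj 0 hm]
  refine measureReal_mono (fun p hp => ?_) hfin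
  obtain ⟨h1, h2, h3⟩ := hp
  simp only [zero_add] at h2 h3
  simpa only [mem_preimage, mem_ofPred_eq, proj, frac_coe_of_mem h2, frac_coe_of_mem h3] using h1

/-- Away from the point where `frac` jumps, it does not increase distances. -/
theorem abs_frac_sub_le {s t : UnitAddCircle} {r : ℝ} (hst : ‖s - t‖ ≤ r)
    (h0 : r ≤ frac t) (h1 : frac t < 1 - r) : |frac s - frac t| ≤ r := by
  obtain ⟨d, hd⟩ := QuotientAddGroup.mk_surjective (s - t)
  set δ := d - round d with hδ
  have hδ' : |δ| ≤ r := by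
    rw [← hd] at hst
    rw [← UnitAddCircle.norm_eq] at *
    exact hst
  have hs : s = ((frac t + δ : ℝ) : UnitAddCircle) := by
    rw [hδ, AddCircle.coe_add, coe_frac, AddCircle.coe_sub,
      show ((round d : ℝ) : UnitAddCircle) = 0 by simp,
      show ((d : ℝ) : UnitAddCircle) = s - t from hd]
    abel
  have hab := abs_le.1 hδ'
  rw [hs, frac_coe_of_mem ⟨by linarith, by linarith⟩, add_sub_cancel_left]
  exact hδ'

/-! ### Exceedance sets -/

/-- The points of the torus whose representative in `[0, 1)²` has distance less than `R` from
`(a, b)`, for `R ≥ 0`. -/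
def disc (a b R : ℝ) : Set Torus := {t | (frac t.1 - a) ^ 2 + (frac t.2 - b) ^ 2 < R ^ 2}

theorem measurableSet_disc (a b R : ℝ) : MeasurableSet (disc a b R) := by
  have h1 : Measurable fun t : Torus => frac t.1 := measurable_frac.comp measurable_fst
  have h2 : Measurable fun t : Torus => frac t.2 := measurable_frac.comp measurable_snd
  exact measurableSet_lt (((h1.sub_const a).pow_const 2).add ((h2.sub_const b).pow_const 2))
    measurable_const

theorem mem_disc_iff_norm {a b R : ℝ} (hR : 0 ≤ R) {t : Torus} :
    t ∈ disc a b R ↔ ‖(⟨frac t.1, frac t.2⟩ : ℂ) - ⟨a, b⟩‖ < R := by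
  rw [← sq_lt_sq₀ (norm_nonneg _) hR, Complex.sq_norm, Complex.normSq_apply]
  simp only [disc, mem_ofPred_eq, Complex.sub_re, Complex.sub_im, sq]

theorem measureReal_annulus_le (w : ℂ) {R r B : ℝ} (hR : 0 ≤ R) (hRB : R ≤ B) (hr : 0 ≤ r)
    (hr' : r < 1 / 2) :
    volume.real (Metric.closedBall w (R + 2 * r) \ Metric.ball w (R - 2 * r)) ≤
      32 * (B + 1) * r := by
  have hc : volume.real (Metric.closedBall w (R + 2 * r)) = (R + 2 * r) ^ 2 * Real.pi := by
    rw [measureReal_def, Complex.volume_closedBall, ENNReal.toReal_mul, ENNReal.toReal_pow,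
      ENNReal.toReal_ofReal (by linarith)]
    rfl
  have hπ := Real.pi_le_four
  have hπ0 := Real.pi_pos
  rcases le_total (R - 2 * r) 0 with h | h
  · refine (measureReal_mono sdiff_subset measure_closedBall_lt_top.ne).trans ?_
    rw [hc]
    have : (R + 2 * r) ^ 2 ≤ 8 * r := by nlinarith
    nlinarith
  · have hb : volume.real (Metric.ball w (R - 2 * r)) = (R - 2 * r) ^ 2 * Real.pi := by
      rw [measureReal_def, Complex.volume_ball, ENNReal.toReal_mul, ENNReal.toReal_pow,
        ENNReal.toReal_ofReal h]
      rfl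
    rw [measureReal_sdiff (Metric.ball_subset_closedBall.trans
      (Metric.closedBall_subset_closedBall (by linarith))) Metric.isOpen_ball.measurableSet
      measure_closedBall_lt_top.ne, hc, hb]
    have : (R + 2 * r) ^ 2 * Real.pi - (R - 2 * r) ^ 2 * Real.pi = 8 * (R * r) * Real.pi := by ring
    rw [this]
    have h1 : R * r ≤ (B + 1) * r := by nlinarith
    have h2 : 0 ≤ (B + 1) * r := by nlinarith
    nlinarith

theorem measureReal_frac_margin_le {r : ℝ} (hr : 0 ≤ r) :
    volume.real {t : UnitAddCircle | frac t < r ∨ 1 - r ≤ frac t} ≤ 2 * r := by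
  have hm : MeasurableSet {t : UnitAddCircle | frac t < r ∨ 1 - r ≤ frac t} :=
    (measurableSet_lt measurable_frac measurable_const).union
      (measurableSet_le measurable_const measurable_frac)
  rw [← (measurePreserving_coe_Ico 0).measureReal_preimage hm.nullMeasurableSet,
    measureReal_restrict_apply ((measurePreserving_coe_Ico 0).measurable hm)]
  have hsub : ((↑) : ℝ → UnitAddCircle) ⁻¹' {t | frac t < r ∨ 1 - r ≤ frac t} ∩ Ico 0 (0 + 1) ⊆
      Ico 0 r ∪ Ico (1 - r) 1 := by
    rintro x ⟨hx, hx'⟩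
    rw [zero_add] at hx'
    simp only [mem_preimage, mem_ofPred_eq, frac_coe_of_mem hx'] at hx
    exact hx.imp (fun h => ⟨hx'.1, h⟩) (fun h => ⟨h, hx'.2⟩)
  refine (measureReal_mono hsub (measure_union_lt_top (by simp) (by simp)).ne).trans
    ((measureReal_union_le _ _).trans ?_)
  rw [Real.volume_real_Ico, Real.volume_real_Ico, max_eq_left (by linarith),
    max_eq_left (by linarith)]
  linarith

theorem thinBoundary_disc {a b R B : ℝ} (hR : 0 ≤ R) (hRB : R ≤ B) :
    ThinBoundary (disc a b R) (32 * (B + 1) + 4) := by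
  intro r hr
  rcases le_or_gt (1 / 2) r with h | h
  · refine ⟨univ, MeasurableSet.univ, ?_, fun s t _ ht => absurd (mem_univ t) ht⟩
    rw [probReal_univ]
    nlinarith
  -- The boundary consists of a circular arc and of the sides of the square, across which the
  -- coordinates jump.
  set C : Set UnitAddCircle := {t | frac t < r ∨ 1 - r ≤ frac t} with hC
  have hCm : MeasurableSet C := (measurableSet_lt measurable_frac measurable_const).union
    (measurableSet_le measurable_const measurable_frac)
  set w : ℂ := ⟨a, b⟩
  set N : Set ℂ := Metric.closedBall w (R + 2 * r) \ Metric.ball w (R - 2 * r) with hN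
  have hNm : MeasurableSet N :=
    Metric.isClosed_closedBall.measurableSet.diff Metric.isOpen_ball.measurableSet
  set N' : Set (ℝ × ℝ) := Complex.measurableEquivRealProd.symm ⁻¹' N with hN'
  have hmp := Complex.volume_preserving_equiv_real_prod.symm Complex.measurableEquivRealProd
  have hNm' : MeasurableSet N' := Complex.measurableEquivRealProd.symm.measurable hNm
  have hNfin : volume N' ≠ ⊤ := by
    rw [hN', hmp.measure_preimage hNm.nullMeasurableSet]
    exact (measure_lt_top_of_subset sdiff_subset measure_closedBall_lt_top.ne).ne
  have hNle : volume.real N' ≤ 32 * (B + 1) * r := by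
    rw [hN', hmp.measureReal_preimage hNm.nullMeasurableSet]
    exact measureReal_annulus_le w hR hRB hr h
  refine ⟨(Prod.fst ⁻¹' C ∪ Prod.snd ⁻¹' C) ∪ {t : Torus | (frac t.1, frac t.2) ∈ N'}, ?_, ?_, ?_⟩
  · exact ((measurable_fst hCm).union (measurable_snd hCm)).union
      (((measurable_frac.comp measurable_fst).prodMk (measurable_frac.comp measurable_snd)) hNm')
  · have h1 : volume.real (Prod.fst ⁻¹' C : Set Torus) ≤ 2 * r := by
      exact ((measurePreserving_fst (μ := (volume : Measure UnitAddCircle))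
        (ν := (volume : Measure UnitAddCircle))).measureReal_preimage
          hCm.nullMeasurableSet).trans_le (measureReal_frac_margin_le hr)
    have h2 : volume.real (Prod.snd ⁻¹' C : Set Torus) ≤ 2 * r := by
      exact ((measurePreserving_snd (μ := (volume : Measure UnitAddCircle))
        (ν := (volume : Measure UnitAddCircle))).measureReal_preimage
          hCm.nullMeasurableSet).trans_le (measureReal_frac_margin_le hr)
    have h3 := measureReal_union_le (μ := (volume : Measure Torus))
      (Prod.fst ⁻¹' C ∪ Prod.snd ⁻¹' C) {t : Torus | (frac t.1, frac t.2) ∈ N'}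
    have h4 := measureReal_union_le (μ := (volume : Measure Torus))
      (Prod.fst ⁻¹' C) (Prod.snd ⁻¹' C)
    have h5 := measureReal_frac_preimage_le hNm' hNfin
    linarith
  · intro s t hst ht
    have h1 : t.1 ∉ C := fun h => ht (Or.inl (Or.inl h))
    have h2 : t.2 ∉ C := fun h => ht (Or.inl (Or.inr h))
    have h3 : (⟨frac t.1, frac t.2⟩ : ℂ) ∉ N := fun h => ht (Or.inr h)
    simp only [hC, mem_ofPred_eq, not_or, not_lt, not_le] at h1 h2
    have d1 := abs_frac_sub_le ((norm_fst_le (s - t)).trans hst) h1.1 h1.2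
    have d2 := abs_frac_sub_le ((norm_snd_le (s - t)).trans hst) h2.1 h2.2
    have h4 : ‖(⟨frac s.1, frac s.2⟩ : ℂ) - ⟨frac t.1, frac t.2⟩‖ ≤ 2 * r := by
      refine (Complex.norm_le_abs_re_add_abs_im _).trans ?_
      simp only [Complex.sub_re, Complex.sub_im]
      linarith
    rw [mem_disc_iff_norm hR, mem_disc_iff_norm hR]
    change ‖_ - w‖ < R ↔ ‖_ - w‖ < R
    have h5 := abs_le.1 ((abs_norm_sub_norm_le ((⟨frac s.1, frac s.2⟩ : ℂ) - w)
      ((⟨frac t.1, frac t.2⟩ : ℂ) - w)).trans (by simpa using h4))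
    simp only [hN, Set.mem_sdiff, Metric.mem_closedBall, Metric.mem_ball, dist_eq_norm, not_and,
      not_not] at h3
    constructor
    · intro hs
      have := h3 (by linarith)
      linarith
    · intro h'
      have := h3 (by linarith)
      linarith

/-! ### From the square to the torus -/

theorem measurePreserving_coords :
    MeasurePreserving (fun p : Plane => ((p 0, p 1) : ℝ × ℝ)) :=
  (volume_preserving_finTwoArrow ℝ).comp (PiLp.volume_preserving_ofLp (Fin 2))

theorem measurePreserving_toTorus :
    MeasurePreserving (fun p : Plane => proj (p 0, p 1)) lebesgueSquare volume := by
  have h1 : MeasurableSet (Ico (0 : ℝ) (0 + 1) ×ˢ Ico (0 : ℝ) (0 + 1)) :=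
    measurableSet_Ico.prod measurableSet_Ico
  have h2 := measurePreserving_coords.restrict_preimage h1
  have h3 : (fun p : Plane => ((p 0, p 1) : ℝ × ℝ)) ⁻¹'
      (Ico (0 : ℝ) (0 + 1) ×ˢ Ico (0 : ℝ) (0 + 1)) = unitSquare := by
    simp only [zero_add]; rfl
  rw [h3] at h2
  exact (measurePreserving_proj 0).comp h2

theorem proj_thomMap (p : Plane) :
    proj (thomMap p 0, thomMap p 1) = cat (proj (p 0, p 1)) := by
  simp [proj, thomMap, cat_apply, two_smul, two_mul]

theorem proj_thomMap_iterate (i : ℕ) (p : Plane) :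
    proj (thomMap^[i] p 0, thomMap^[i] p 1) = cat^[i] (proj (p 0, p 1)) := by
  induction i with
  | zero => rfl
  | succ i ih => rw [Function.iterate_succ_apply', proj_thomMap, ih, Function.iterate_succ_apply']

theorem thomMap_mem (p : Plane) : thomMap p ∈ unitSquare := by
  refine ⟨?_, ?_⟩ <;> simp only [thomMap] <;>
    exact ⟨Int.fract_nonneg _, Int.fract_lt_one _⟩

theorem proj_mem_disc_iff {p pM : Plane} (hp : p ∈ unitSquare) {R : ℝ} (hR : 0 ≤ R) :
    proj (p 0, p 1) ∈ disc (pM 0) (pM 1) R ↔ dist p pM < R := by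
  rw [EuclideanSpace.dist_eq, Real.sqrt_lt (by positivity) hR, Fin.sum_univ_two, Real.dist_eq, Real.dist_eq,
    sq_abs, sq_abs]
  simp only [disc, proj, mem_ofPred_eq, frac_coe_of_mem hp.1, frac_coe_of_mem hp.2]

/-- The distribution function of the block maxima is an avoidance probability. -/
theorem measureReal_blockMax_le {α : ℝ} (hα : 0 < α) (pM : Plane) {R : ℝ} (hR : 0 ≤ R) {n : ℕ}
    (hn : 0 < n) :
    lebesgueSquare.real {p | blockMax thomMap (observable α pM) n p ≤ 1 - R ^ α} =
      volume.real (avoid (disc (pM 0) (pM 1) R) n) := by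
  have hW := measurableSet_avoid (measurableSet_disc (pM 0) (pM 1) R) n
  rw [← measurePreserving_cat.measureReal_preimage hW.nullMeasurableSet,
    ← measurePreserving_toTorus.measureReal_preimage
      (measurePreserving_cat.measurable hW).nullMeasurableSet]
  congr 1
  ext p
  have : Nonempty (Fin n) := ⟨⟨0, hn⟩⟩
  simp only [mem_ofPred_eq, blockMax, mem_preimage, avoid]
  rw [ciSup_le_iff (finite_range _).bddAbove]
  have key : ∀ i : ℕ, observable α pM (thomMap^[i + 1] p) ≤ 1 - R ^ α ↔
      cat^[i] (cat (proj (p 0, p 1))) ∉ disc (pM 0) (pM 1) R := by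
    intro i
    rw [← Function.iterate_succ_apply, ← proj_thomMap_iterate, Nat.succ_eq_add_one,
      proj_mem_disc_iff (by rw [Function.iterate_succ_apply']; exact thomMap_mem _) hR, not_lt,
      observable, sub_le_sub_iff_left, Real.rpow_le_rpow_iff hR dist_nonneg hα]
  exact ⟨fun h i hi => (key i).1 (h ⟨i, hi⟩), fun h i => (key i).2 (h i i.2)⟩

/-! ### Short returns -/

theorem measureReal_closedBall_le (z : UnitAddCircle) {h : ℝ} (hh : 0 ≤ h) :
    volume.real (Metric.closedBall z h) ≤ 2 * h := by
  rw [measureReal_def, AddCircle.volume_closedBall]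
  refine ENNReal.toReal_le_of_le_ofReal (by linarith) (ENNReal.ofReal_le_ofReal (min_le_right _ _))

theorem measurableSet_closedBall_prod (z w : UnitAddCircle) (h : ℝ) :
    MeasurableSet (Metric.closedBall z h ×ˢ Metric.closedBall w h) :=
  Metric.isClosed_closedBall.measurableSet.prod Metric.isClosed_closedBall.measurableSet

theorem measureReal_closedBall_prod_le (z w : UnitAddCircle) {h : ℝ} (hh : 0 ≤ h) :
    (volume : Measure Torus).real (Metric.closedBall z h ×ˢ Metric.closedBall w h) ≤ 4 * h ^ 2 := by
  have : (volume : Measure Torus).real (Metric.closedBall z h ×ˢ Metric.closedBall w h) =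
      volume.real (Metric.closedBall z h) * volume.real (Metric.closedBall w h) :=
    measureReal_prod_prod _ _
  rw [this]
  have h1 := measureReal_closedBall_le z hh
  have h2 := measureReal_closedBall_le w hh
  nlinarith [measureReal_nonneg (μ := volume) (s := Metric.closedBall z h),
    measureReal_nonneg (μ := volume) (s := Metric.closedBall w h)]

/-- A vertical strip and its images under the powers of the map cross transversally. -/
theorem measureReal_strip_fst_le {E : Set Torus} {z : UnitAddCircle} {h : ℝ} (hh : 0 ≤ h)
    (hE : ∀ t ∈ E, ‖t.1 - z‖ ≤ h) {j : ℕ} (hj : j ≠ 0) :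
    volume.real (E ∩ cat^[j] ⁻¹' E) ≤ 4 * h ^ 2 := by
  have hb : (Nat.fib (2 * j) : ℤ) ≠ 0 := by
    exact_mod_cast (Nat.fib_pos.2 (by omega)).ne'
  have hmp := measurePreserving_shear (Nat.fib (2 * j + 1)) hb
  refine le_trans ?_ (measureReal_closedBall_prod_le z z hh)
  rw [← hmp.measureReal_preimage (measurableSet_closedBall_prod z z h).nullMeasurableSet]
  refine measureReal_mono fun t ht => ⟨?_, ?_⟩
  · simpa [dist_eq_norm] using hE t ht.1
  · have := hE _ ht.2
    rw [cat_iterate_apply] at this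
    simpa [dist_eq_norm] using this

theorem measureReal_strip_snd_le {E : Set Torus} {z : UnitAddCircle} {h : ℝ} (hh : 0 ≤ h)
    (hE : ∀ t ∈ E, ‖t.2 - z‖ ≤ h) {j : ℕ} (hj : j ≠ 0) :
    volume.real (E ∩ cat^[j] ⁻¹' E) ≤ 4 * h ^ 2 := by
  have hb : (Nat.fib (2 * j) : ℤ) ≠ 0 := by
    exact_mod_cast (Nat.fib_pos.2 (by omega)).ne'
  have hmp : MeasurePreserving (fun t : Torus => (t.2,
      ((Nat.fib (2 * j + 1) : ℤ) - Nat.fib (2 * j)) • t.2 + (Nat.fib (2 * j) : ℤ) • t.1)) :=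
    (measurePreserving_shear ((Nat.fib (2 * j + 1) : ℤ) - Nat.fib (2 * j)) hb).comp
      Measure.measurePreserving_swap
  refine le_trans ?_ (measureReal_closedBall_prod_le z z hh)
  rw [← hmp.measureReal_preimage (measurableSet_closedBall_prod z z h).nullMeasurableSet]
  refine measureReal_mono fun t ht => ⟨?_, ?_⟩
  · simpa [dist_eq_norm] using hE t ht.1
  · have := hE _ ht.2
    rw [cat_iterate_apply] at this
    rw [Metric.mem_closedBall, dist_eq_norm]
    dsimp only at this ⊢
    rwa [add_comm (_ • t.2)]

theorem card_norm_sub_toAddCircle_le {b : ℕ} [NeZero b] (w : UnitAddCircle) {d : ℝ} (hd : 0 ≤ d) :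
    ((Finset.univ.filter fun k : ZMod b => ‖w - ZMod.toAddCircle k‖ ≤ d).card : ℝ) ≤
      2 * d * b + 1 := by
  obtain ⟨x, rfl⟩ := QuotientAddGroup.mk_surjective w
  have hb : (0 : ℝ) < b := by exact_mod_cast Nat.pos_of_ne_zero (NeZero.ne b)
  have hsub : (Finset.univ.filter fun k : ZMod b =>
      ‖(QuotientAddGroup.mk x : UnitAddCircle) - ZMod.toAddCircle k‖ ≤ d) ⊆
      (Finset.Icc ⌈(x - d) * b⌉ ⌊(x + d) * b⌋).image (fun m : ℤ => (m : ZMod b)) := by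
    intro k hk
    rw [Finset.mem_filter] at hk
    have hk := hk.2
    have h1 : ZMod.toAddCircle k = ((k.val / b : ℝ) : UnitAddCircle) := by
      conv_lhs => rw [← ZMod.natCast_zmod_val k]
      exact ZMod.toAddCircle_natCast _
    change ‖(x : UnitAddCircle) - _‖ ≤ d at hk
    rw [h1, ← AddCircle.coe_sub, UnitAddCircle.norm_eq, abs_le] at hk
    set r := round (x - k.val / b)
    have h2 : (k.val / b + r : ℝ) * b = k.val + r * b := by field_simp
    have h3 : (x - d) * b ≤ (k.val / b + r : ℝ) * b :=
      mul_le_mul_of_nonneg_right (by linarith) hb.le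
    have h4 : (k.val / b + r : ℝ) * b ≤ (x + d) * b :=
      mul_le_mul_of_nonneg_right (by linarith) hb.le
    rw [Finset.mem_image]
    refine ⟨k.val + r * b, ?_, by simp⟩
    rw [Finset.mem_Icc, Int.ceil_le, Int.le_floor]
    push_cast
    constructor <;> linarith
  have h1 : (Finset.univ.filter fun k : ZMod b =>
      ‖(QuotientAddGroup.mk x : UnitAddCircle) - ZMod.toAddCircle k‖ ≤ d).card ≤
      (⌊(x + d) * b⌋ + 1 - ⌈(x - d) * b⌉).toNat := by
    refine (Finset.card_le_card hsub).trans (Finset.card_image_le.trans ?_)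
    rw [Int.card_Icc]
  have h2 : (((⌊(x + d) * b⌋ + 1 - ⌈(x - d) * b⌉).toNat : ℤ) : ℝ) ≤ 2 * d * b + 1 := by
    rw [Int.toNat_eq_max, Int.cast_max, Int.cast_zero]
    refine max_le ?_ (by positivity)
    push_cast
    linarith [Int.floor_le ((x + d) * b), Int.le_ceil ((x - d) * b)]
  refine le_trans ?_ h2
  exact_mod_cast h1

/-- The preimage of an arc under multiplication by `b` is spread evenly over the circle: it is
invariant under translation by `b`-torsion points, few of which are close to a given point. -/
theorem measureReal_arc_inter_le (z c : UnitAddCircle) {d : ℝ} (hd : 0 ≤ d) {b : ℕ} (hb : b ≠ 0) :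
    volume.real {y : UnitAddCircle | ‖y - z‖ ≤ d ∧ ‖(b : ℤ) • y - c‖ ≤ d} ≤
      (2 * d + 1 / b) * (2 * d) := by
  have : NeZero b := ⟨hb⟩
  have hb' : (0 : ℝ) < b := by exact_mod_cast Nat.pos_of_ne_zero hb
  set B : Set UnitAddCircle := Metric.closedBall z d with hB
  set G : Set UnitAddCircle := (fun y => (b : ℤ) • y) ⁻¹' Metric.closedBall c d with hG
  have hBm : MeasurableSet B := Metric.isClosed_closedBall.measurableSet
  have hmp := measurePreserving_zsmul (b := (b : ℤ)) (by exact_mod_cast hb)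
  have hGm : MeasurableSet G := hmp.measurable Metric.isClosed_closedBall.measurableSet
  have hGle : volume.real G ≤ 2 * d := by
    rw [hG, hmp.measureReal_preimage Metric.isClosed_closedBall.measurableSet.nullMeasurableSet]
    exact measureReal_closedBall_le c hd
  have hset : {y : UnitAddCircle | ‖y - z‖ ≤ d ∧ ‖(b : ℤ) • y - c‖ ≤ d} = B ∩ G := by
    ext y; simp [hB, hG, dist_eq_norm]
  rw [hset]
  -- `G` is invariant under translation by `b`-torsion points, and each point lies in at most
  -- `2 * d * b + 1` of the corresponding translates of `B`.
  have hinv : ∀ k : ZMod b, volume.real (B ∩ G) =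
      ∫ y in G, B.indicator (1 : UnitAddCircle → ℝ) (y - ZMod.toAddCircle k) := by
    intro k
    have hmp' : MeasurePreserving (fun y : UnitAddCircle => y - ZMod.toAddCircle k) :=
      measurePreserving_sub_right _ _
    have hk : (b : ℤ) • (ZMod.toAddCircle k : UnitAddCircle) = 0 := by
      rw [← map_zsmul]; simp
    have h1 : (fun y : UnitAddCircle => y - ZMod.toAddCircle k) ⁻¹' (B ∩ G) =
        (fun y : UnitAddCircle => y - ZMod.toAddCircle k) ⁻¹' B ∩ G := by
      ext y
      simp only [hG, mem_preimage, mem_inter_iff, smul_sub, hk, sub_zero]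
    rw [← hmp'.measureReal_preimage (hBm.inter hGm).nullMeasurableSet, h1]
    change _ = ∫ y in G,
      ((fun y : UnitAddCircle => y - ZMod.toAddCircle k) ⁻¹' B).indicator (1 : UnitAddCircle → ℝ) y
    rw [integral_indicator_one (hmp'.measurable hBm),
      measureReal_restrict_apply (hmp'.measurable hBm)]
  have hint : ∀ k : ZMod b, IntegrableOn
      (fun y => B.indicator (1 : UnitAddCircle → ℝ) (y - ZMod.toAddCircle k)) G := fun k =>
    ((measurePreserving_sub_right volume (ZMod.toAddCircle k)).integrable_comp_of_integrable
      ((integrable_const (1 : ℝ)).indicator hBm)).integrableOn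
  have hsum : (b : ℝ) * volume.real (B ∩ G) =
      ∫ y in G, ∑ k : ZMod b, B.indicator (1 : UnitAddCircle → ℝ) (y - ZMod.toAddCircle k) := by
    rw [integral_finsetSum _ fun k _ => hint k, ← Finset.sum_congr rfl fun k _ => hinv k]
    simp [ZMod.card]
  have hbound : ∀ y : UnitAddCircle,
      ‖∑ k : ZMod b, B.indicator (1 : UnitAddCircle → ℝ) (y - ZMod.toAddCircle k)‖ ≤
        2 * d * b + 1 := by
    intro y
    rw [Real.norm_of_nonneg (Finset.sum_nonneg fun k _ => indicator_nonneg (by simp) _)]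
    refine le_of_eq_of_le ?_ (card_norm_sub_toAddCircle_le (b := b) (y - z) hd)
    rw [Finset.card_filter]
    push_cast
    refine Finset.sum_congr rfl fun k _ => ?_
    have : y - ZMod.toAddCircle k ∈ B ↔ ‖y - z - ZMod.toAddCircle k‖ ≤ d := by
      rw [hB, Metric.mem_closedBall, dist_eq_norm, sub_right_comm]
    by_cases hk : y - ZMod.toAddCircle k ∈ B
    · rw [indicator_of_mem hk, if_pos (this.1 hk)]; rfl
    · rw [indicator_of_notMem hk, if_neg (fun h => hk (this.2 h))]
  have h1 := norm_setIntegral_le_of_norm_le_const (μ := volume) (s := G) (measure_lt_top _ _)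
    fun y _ => hbound y
  rw [← hsum, Real.norm_of_nonneg (by positivity)] at h1
  have h2 : (b : ℝ) * volume.real (B ∩ G) ≤ b * ((2 * d + 1 / b) * (2 * d)) := by
    refine h1.trans ((mul_le_mul_of_nonneg_left hGle (by positivity)).trans_eq ?_)
    field_simp
  exact le_of_mul_le_mul_left h2 hb'

/-- Returns to a small box: up to the factor `d + 1 / fib (2 * j)`, as unlikely as the box. -/
theorem measureReal_box_le {E : Set Torus} {z : Torus} {d : ℝ} (hd : 0 ≤ d)
    (hE : ∀ t ∈ E, ‖t - z‖ ≤ d) {j : ℕ} (hj : j ≠ 0) :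
    volume.real (E ∩ cat^[j] ⁻¹' E) ≤ 4 * d ^ 2 * (2 * d + 1 / Nat.fib (2 * j)) := by
  have hb : Nat.fib (2 * j) ≠ 0 := (Nat.fib_pos.2 (by omega)).ne'
  set a := Nat.fib (2 * j + 1)
  set b := Nat.fib (2 * j)
  -- Only the first coordinate of the image is used.
  set T : Set Torus := {t | ‖t.1 - z.1‖ ≤ d ∧ ‖t.2 - z.2‖ ≤ d ∧
    ‖(a : ℤ) • t.1 + (b : ℤ) • t.2 - z.1‖ ≤ d} with hT
  have hTm : MeasurableSet T := by
    refine IsClosed.measurableSet ?_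
    exact (isClosed_le (f := fun t : Torus => ‖t.1 - z.1‖) (by fun_prop) continuous_const).inter
      ((isClosed_le (f := fun t : Torus => ‖t.2 - z.2‖) (by fun_prop) continuous_const).inter
        (isClosed_le (f := fun t : Torus => ‖(a : ℤ) • t.1 + (b : ℤ) • t.2 - z.1‖) (by fun_prop)
          continuous_const))
  have hsub : E ∩ cat^[j] ⁻¹' E ⊆ T := by
    intro t ht
    have h1 := hE t ht.1
    have h2 := hE _ ht.2
    rw [cat_iterate_apply] at h2
    exact ⟨(norm_fst_le (t - z)).trans h1, (norm_snd_le (t - z)).trans h1,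
      (norm_fst_le (_ - z)).trans h2⟩
  refine (measureReal_mono hsub).trans ?_
  set q : ℝ := (2 * d + 1 / b) * (2 * d) with hq
  have hq0 : 0 ≤ q := by positivity
  have h1 : volume T ≤ ENNReal.ofReal (2 * d) * ENNReal.ofReal q := by
    change (volume.prod volume) T ≤ _
    rw [Measure.prod_apply hTm]
    have h2 : ∀ x : UnitAddCircle, volume (Prod.mk x ⁻¹' T) ≤
        (Metric.closedBall z.1 d).indicator (fun _ => ENNReal.ofReal q) x := by
      intro x
      by_cases hx : x ∈ Metric.closedBall z.1 d
      · rw [indicator_of_mem hx, ← ENNReal.toReal_le_toReal (measure_ne_top _ _)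
          ENNReal.ofReal_ne_top, ENNReal.toReal_ofReal hq0]
        refine le_trans (measureReal_mono (fun y hy => ?_))
          (measureReal_arc_inter_le z.2 (z.1 - (a : ℤ) • x) hd hb)
        refine ⟨hy.2.1, ?_⟩
        have := hy.2.2
        rwa [show (b : ℤ) • y - (z.1 - (a : ℤ) • x) = (a : ℤ) • x + (b : ℤ) • y - z.1 by abel]
      · rw [indicator_of_notMem hx, nonpos_iff_eq_zero]
        convert measure_empty (μ := (volume : Measure UnitAddCircle))
        ext y
        simp only [mem_preimage, mem_empty_iff_false, iff_false]
        intro hy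
        exact hx (by rw [Metric.mem_closedBall, dist_eq_norm]; exact hy.1)
    refine (lintegral_mono h2).trans ?_
    rw [lintegral_indicator_const Metric.isClosed_closedBall.measurableSet, mul_comm,
      AddCircle.volume_closedBall]
    gcongr
    exact min_le_right _ _
  have h3 : volume.real T ≤ 2 * d * q := by
    rw [measureReal_def]
    refine ENNReal.toReal_le_of_le_ofReal (by positivity) ?_
    rwa [ENNReal.ofReal_mul (by positivity)]
  rw [hq] at h3
  linarith

/-- Length of the initial stretch, of small logarithmic order, on which returns are excluded by
geometry. -/
def lag (n : ℕ) : ℕ := Nat.log 2 n / 16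

theorem tendsto_lag_atTop : Tendsto lag atTop atTop :=
  (Nat.tendsto_div_const_atTop (by norm_num)).comp tendsto_natLog_atTop

theorem gap_le_lag (n : ℕ) : (gap n : ℝ) ≤ 64 * (lag n + 1) := by
  have : gap n ≤ 64 * (lag n + 1) := by unfold gap lag; omega
  exact_mod_cast this

theorem two_pow_lag_pow_le {n : ℕ} (hn : 0 < n) : ((2 : ℝ) ^ lag n) ^ 16 ≤ n := by
  have h1 : (2 ^ lag n) ^ 16 ≤ n := by
    rw [← pow_mul]
    refine (Nat.pow_le_pow_right (by norm_num) ?_).trans (Nat.pow_log_le_self 2 hn.ne')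
    unfold lag; omega
  exact_mod_cast h1

theorem tendsto_lag_div_two_pow :
    Tendsto (fun n => ((lag n : ℝ) + 1) / 2 ^ lag n) atTop (𝓝 0) := by
  have h1 := tendsto_self_mul_const_pow_of_lt_one (r := (1 / 2 : ℝ)) (by norm_num) (by norm_num)
  have h2 := tendsto_pow_atTop_nhds_zero_of_lt_one (r := (1 / 2 : ℝ)) (by norm_num) (by norm_num)
  have h3 := (h1.add h2).comp tendsto_lag_atTop
  rw [add_zero] at h3
  refine h3.congr fun n => ?_
  simp only [Function.comp, one_div, inv_pow]
  field_simp

theorem two_pow_le_fib (j : ℕ) : 2 ^ j ≤ Nat.fib (2 * (j + 1)) := by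
  induction j with
  | zero => simp
  | succ j ih =>
    rw [fib_two_mul_add_two (j + 1), pow_succ]
    have := Nat.fib_mono (show 2 * (j + 1) ≤ 2 * (j + 1) + 1 by omega)
    omega

/-- Short returns are negligible for sets in boxes of area of order `1 / n`, if the returns before
time `lag n` are excluded. -/
theorem tendsto_returns_of_box {E : ℕ → Set Torus} {z : Torus} {d : ℕ → ℝ} {D : ℝ}
    (hd : ∀ n, 0 ≤ d n) (hD : ∀ᶠ n : ℕ in atTop, √n * d n ≤ D)
    (hE : ∀ᶠ n in atTop, ∀ t ∈ E n, ‖t - z‖ ≤ d n)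
    (hno : ∀ᶠ n in atTop, ∀ j, 1 ≤ j → j < lag n → ∀ t ∈ E n, cat^[j] t ∉ E n) :
    Tendsto (fun n : ℕ => n * ∑ j ∈ Finset.Ico 1 (gap n),
      volume.real (E n ∩ cat^[j] ⁻¹' E n)) atTop (𝓝 0) := by
  have h0 : Tendsto (fun n => 256 * D ^ 2 * (2 * D + 2) * (((lag n : ℝ) + 1) / 2 ^ lag n)) atTop
      (𝓝 0) := by
    simpa using tendsto_lag_div_two_pow.const_mul (256 * D ^ 2 * (2 * D + 2))
  refine squeeze_zero' (Eventually.of_forall fun n => by positivity) ?_ h0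
  filter_upwards [hD, hE, hno, eventually_gt_atTop 0, tendsto_lag_atTop.eventually_ge_atTop 1]
    with n hD hE hno hn hlag
  have hn' : (0 : ℝ) < n := by exact_mod_cast hn
  have hsq : (0 : ℝ) < √n := Real.sqrt_pos.2 hn'
  have hpow : (1 : ℝ) ≤ 2 ^ lag n := one_le_pow₀ (by norm_num)
  have hsqrt : (2 : ℝ) ^ lag n ≤ √n := by
    refine Real.le_sqrt_of_sq_le (le_trans ?_ (two_pow_lag_pow_le hn))
    exact pow_le_pow_right₀ hpow (by norm_num)
  have hD0 : 0 ≤ D := le_trans (mul_nonneg hsq.le (hd n)) hD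
  have hdn : d n ≤ D / 2 ^ lag n := by
    rw [le_div_iff₀ (by positivity)]
    calc d n * 2 ^ lag n ≤ d n * √n := mul_le_mul_of_nonneg_left hsqrt (hd n)
      _ ≤ D := by rw [mul_comm]; exact hD
  have hnd : n * d n ^ 2 ≤ D ^ 2 := by
    calc n * d n ^ 2 = (√n * d n) ^ 2 := by rw [mul_pow, Real.sq_sqrt hn'.le]
      _ ≤ D ^ 2 := pow_le_pow_left₀ (mul_nonneg hsq.le (hd n)) hD 2
  have hterm : ∀ j ∈ Finset.Ico 1 (gap n), volume.real (E n ∩ cat^[j] ⁻¹' E n) ≤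
      4 * d n ^ 2 * ((2 * D + 2) / 2 ^ lag n) := by
    intro j hj
    rw [Finset.mem_Ico] at hj
    rcases lt_or_ge j (lag n) with hjl | hjl
    · have : E n ∩ cat^[j] ⁻¹' E n = ∅ :=
        eq_empty_of_forall_notMem fun t ht => hno j hj.1 hjl t ht.1 ht.2
      rw [this, measureReal_empty]
      positivity
    · refine (measureReal_box_le (hd n) hE (by omega)).trans ?_
      gcongr
      have h1 : (2 : ℝ) ^ lag n / 2 ≤ Nat.fib (2 * j) := by
        have h2 := two_pow_le_fib (lag n - 1)
        have h3 : Nat.fib (2 * (lag n - 1 + 1)) ≤ Nat.fib (2 * j) := Nat.fib_mono (by omega)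
        have h4 : 2 ^ lag n ≤ 2 * Nat.fib (2 * j) := by
          rw [show lag n = lag n - 1 + 1 by omega, pow_succ]
          omega
        have h5 : ((2 : ℝ) ^ lag n) ≤ 2 * Nat.fib (2 * j) := by exact_mod_cast h4
        linarith
      have h2 : (1 : ℝ) / Nat.fib (2 * j) ≤ 2 / 2 ^ lag n := by
        refine (one_div_le_one_div_of_le (by positivity) h1).trans_eq ?_
        field_simp
      rw [add_div, mul_div_assoc]
      linarith
  calc n * ∑ j ∈ Finset.Ico 1 (gap n), volume.real (E n ∩ cat^[j] ⁻¹' E n)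
      ≤ n * ∑ j ∈ Finset.Ico 1 (gap n), 4 * d n ^ 2 * ((2 * D + 2) / 2 ^ lag n) := by
        gcongr with j hj
        exact hterm j hj
    _ ≤ n * (gap n * (4 * d n ^ 2 * ((2 * D + 2) / 2 ^ lag n))) := by
        rw [Finset.sum_const, Nat.card_Ico, nsmul_eq_mul]
        gcongr
        exact Nat.sub_le _ _
    _ = 4 * (n * d n ^ 2) * gap n * ((2 * D + 2) / 2 ^ lag n) := by ring
    _ ≤ 4 * D ^ 2 * (64 * (lag n + 1)) * ((2 * D + 2) / 2 ^ lag n) := by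
        gcongr; exact gap_le_lag n
    _ = _ := by ring

theorem tendsto_gap_mul_sq {h : ℕ → ℝ} {D : ℝ} (hh : ∀ n, 0 ≤ h n)
    (hD : ∀ᶠ n : ℕ in atTop, (n : ℝ) ^ (2 / 3 : ℝ) * h n ≤ D) :
    Tendsto (fun n : ℕ => n * (gap n * (4 * h n ^ 2))) atTop (𝓝 0) := by
  have h0 : Tendsto (fun n => 256 * D ^ 2 * (((lag n : ℝ) + 1) / 2 ^ lag n)) atTop (𝓝 0) := by
    simpa using tendsto_lag_div_two_pow.const_mul (256 * D ^ 2)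
  refine squeeze_zero' (Eventually.of_forall fun n => by positivity) ?_ h0
  filter_upwards [hD, eventually_gt_atTop 0] with n hD hn
  have hn' : (0 : ℝ) < n := by exact_mod_cast hn
  have hpow : (1 : ℝ) ≤ 2 ^ lag n := one_le_pow₀ (by norm_num)
  have h1 : (2 : ℝ) ^ lag n ≤ (n : ℝ) ^ (1 / 3 : ℝ) := by
    have h2 : (2 : ℝ) ^ lag n = (((2 : ℝ) ^ lag n) ^ 3) ^ (1 / 3 : ℝ) := by
      rw [← Real.rpow_natCast _ 3, ← Real.rpow_mul (by positivity)]; norm_num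
    rw [h2]
    exact Real.rpow_le_rpow (by positivity)
      ((pow_le_pow_right₀ hpow (by norm_num)).trans (two_pow_lag_pow_le hn)) (by norm_num)
  have h2 : n * h n ^ 2 * (n : ℝ) ^ (1 / 3 : ℝ) = ((n : ℝ) ^ (2 / 3 : ℝ) * h n) ^ 2 := by
    rw [mul_pow, ← Real.rpow_natCast ((n : ℝ) ^ (2 / 3 : ℝ)) 2, ← Real.rpow_mul hn'.le, mul_right_comm]
    congr 1
    nth_rewrite 1 [← Real.rpow_one (n : ℝ)]
    rw [← Real.rpow_add hn']
    norm_num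
  have h3 : n * h n ^ 2 * 2 ^ lag n ≤ D ^ 2 := by
    calc n * h n ^ 2 * 2 ^ lag n ≤ n * h n ^ 2 * (n : ℝ) ^ (1 / 3 : ℝ) := by gcongr
      _ = _ := h2
      _ ≤ D ^ 2 := by
        have := hh n
        exact pow_le_pow_left₀ (by positivity) hD 2
  have h4 : n * h n ^ 2 ≤ D ^ 2 / 2 ^ lag n := by rwa [le_div_iff₀ (by positivity)]
  calc n * (gap n * (4 * h n ^ 2)) = 4 * gap n * (n * h n ^ 2) := by ring
    _ ≤ 4 * (64 * (lag n + 1)) * (D ^ 2 / 2 ^ lag n) := by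
        gcongr; exact gap_le_lag n
    _ = _ := by ring

/-- Short returns are negligible for sets whose transversal returns are. -/
theorem tendsto_returns_of_strip {E : ℕ → Set Torus} {h : ℕ → ℝ} {D : ℝ}
    (hh : ∀ n, 0 ≤ h n) (hD : ∀ᶠ n : ℕ in atTop, (n : ℝ) ^ (2 / 3 : ℝ) * h n ≤ D)
    (hE : ∀ᶠ n in atTop, ∀ j ≠ 0, volume.real (E n ∩ cat^[j] ⁻¹' E n) ≤ 4 * h n ^ 2) :
    Tendsto (fun n : ℕ => n * ∑ j ∈ Finset.Ico 1 (gap n),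
      volume.real (E n ∩ cat^[j] ⁻¹' E n)) atTop (𝓝 0) := by
  refine squeeze_zero' (Eventually.of_forall fun n => by positivity) ?_ (tendsto_gap_mul_sq hh hD)
  filter_upwards [hE] with n hE
  gcongr
  refine (Finset.sum_le_sum fun j hj => hE j (by rw [Finset.mem_Ico] at hj; omega)).trans ?_
  rw [Finset.sum_const, Nat.card_Ico, nsmul_eq_mul]
  gcongr
  exact Nat.sub_le _ _

/-! ### Slow recurrence -/

/-- The orbit of `z` returns to `z` at most polynomially fast. -/
def SlowlyRecurrent (z : Torus) : Prop :=
  ∃ c > 0, ∀ j : ℕ, 1 ≤ j → c ≤ (j : ℝ) ^ 2 * ‖cat^[j] z - z‖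

theorem measure_norm_return_le {j : ℕ} (hj : j ≠ 0) (r : ℝ) :
    volume {z : Torus | ‖cat^[j] z - z‖ ≤ r} ≤ ENNReal.ofReal (2 * r) := by
  have hb : (Nat.fib (2 * j) : ℤ) ≠ 0 := by
    exact_mod_cast (Nat.fib_pos.2 (by omega)).ne'
  have hmp := measurePreserving_zsmul_add ((Nat.fib (2 * j + 1) : ℤ) - 1) hb
  have h1 : {z : Torus | ‖cat^[j] z - z‖ ≤ r} ⊆ (fun t : Torus =>
      ((Nat.fib (2 * j + 1) : ℤ) - 1) • t.1 + (Nat.fib (2 * j) : ℤ) • t.2) ⁻¹'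
        Metric.closedBall 0 r := by
    intro z hz
    have h2 := (norm_fst_le (cat^[j] z - z)).trans hz
    rw [cat_iterate_apply] at h2
    rw [mem_preimage, mem_closedBall_zero_iff]
    refine le_of_eq_of_le (congrArg norm ?_) h2
    rw [sub_smul, one_smul, Prod.fst_sub]
    exact sub_add_eq_add_sub _ _ _
  refine (measure_mono h1).trans ?_
  rw [hmp.measure_preimage Metric.isClosed_closedBall.measurableSet.nullMeasurableSet,
    AddCircle.volume_closedBall]
  exact ENNReal.ofReal_le_ofReal (min_le_right _ _)

theorem ae_slowlyRecurrent : ∀ᵐ z : Torus, SlowlyRecurrent z := by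
  have h1 : ∀ᵐ z : Torus, ∀ᶠ j : ℕ in atTop, z ∉
      {z : Torus | ‖cat^[j + 1] z - z‖ ≤ 1 / ((j + 1 : ℕ) : ℝ) ^ 2} := by
    refine ae_eventually_notMem (ne_top_of_le_ne_top ?_
      (ENNReal.tsum_le_tsum fun j => measure_norm_return_le (Nat.succ_ne_zero j) _))
    have hs : Summable fun j : ℕ => 2 * (1 / ((j + 1 : ℕ) : ℝ) ^ 2) :=
      ((summable_nat_add_iff 1).2 (Real.summable_one_div_nat_pow.2 one_lt_two)).mul_left 2
    exact hs.tsum_ofReal_ne_top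
  -- The finitely many times that the Borel–Cantelli lemma misses only require `z` not to be periodic.
  have h2 : ∀ᵐ z : Torus, ∀ j : ℕ, j ≠ 0 → ‖cat^[j] z - z‖ ≠ 0 := by
    rw [ae_all_iff]
    intro j
    by_cases hj : j = 0
    · simp [hj]
    · have := measure_norm_return_le hj 0
      rw [mul_zero, ENNReal.ofReal_zero, nonpos_iff_eq_zero] at this
      filter_upwards [measure_eq_zero_iff_ae_notMem.1 this] with z hz _ h0
      exact hz h0.le
  filter_upwards [h1, h2] with z h1 h2
  obtain ⟨N, hN⟩ := eventually_atTop.1 h1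
  have h3 : ∀ M : ℕ, ∃ c > 0, ∀ j : ℕ, 1 ≤ j → j ≤ M → c ≤ (j : ℝ) ^ 2 * ‖cat^[j] z - z‖ := by
    intro M
    induction M with
    | zero => exact ⟨1, one_pos, fun j h h' => by omega⟩
    | succ M ih =>
      obtain ⟨c, hc, hcM⟩ := ih
      have hpos : 0 < ((M + 1 : ℕ) : ℝ) ^ 2 * ‖cat^[M + 1] z - z‖ :=
        mul_pos (by positivity) (lt_of_le_of_ne (norm_nonneg _) (h2 _ (Nat.succ_ne_zero M)).symm)
      refine ⟨min c _, lt_min hc hpos, fun j hj hjM => ?_⟩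
      rcases Nat.lt_or_ge M j with h | h
      · obtain rfl : j = M + 1 := by omega
        exact min_le_right _ _
      · exact (min_le_left _ _).trans (hcM j hj h)
  obtain ⟨c, hc, hcN⟩ := h3 N
  refine ⟨min c 1, lt_min hc one_pos, fun j hj => ?_⟩
  rcases Nat.lt_or_ge N j with h | h
  · refine (min_le_right _ _).trans ?_
    have := hN (j - 1) (by omega)
    rw [not_le, Nat.sub_add_cancel hj, div_lt_iff₀ (by positivity)] at this
    linarith
  · exact (min_le_left _ _).trans (hcN j hj h)

/-- Small boxes around slowly recurrent points have no returns before time `lag n`. -/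
theorem SlowlyRecurrent.eventually_no_return {z : Torus} (hz : SlowlyRecurrent z)
    {E : ℕ → Set Torus} {d : ℕ → ℝ} {D : ℝ}
    (hd : ∀ n, 0 ≤ d n) (hD : ∀ᶠ n : ℕ in atTop, √n * d n ≤ D)
    (hE : ∀ᶠ n in atTop, ∀ t ∈ E n, ‖t - z‖ ≤ d n) :
    ∀ᶠ n in atTop, ∀ j, 1 ≤ j → j < lag n → ∀ t ∈ E n, cat^[j] t ∉ E n := by
  obtain ⟨c, hc, hcz⟩ := hz
  have h0 : Tendsto (fun n => 2 * D * (((lag n : ℝ) + 1) / 2 ^ lag n)) atTop (𝓝 0) := by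
    simpa using tendsto_lag_div_two_pow.const_mul (2 * D)
  filter_upwards [hD, hE, eventually_gt_atTop 0, h0.eventually (gt_mem_nhds hc)]
    with n hD hE hn hlt j hj1 hj t ht htj
  have hn' : (0 : ℝ) < n := by exact_mod_cast hn
  have hsq : (0 : ℝ) < √n := Real.sqrt_pos.2 hn'
  set p : ℝ := 2 ^ lag n with hp
  have hp1 : 1 ≤ p := one_le_pow₀ (by norm_num)
  have hsqrt : p ^ 8 ≤ √n := by
    refine Real.le_sqrt_of_sq_le (le_trans (le_of_eq ?_) (two_pow_lag_pow_le hn))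
    rw [← pow_mul]
  have hD0 : 0 ≤ D := le_trans (mul_nonneg hsq.le (hd n)) hD
  have hdn : d n * p ^ 8 ≤ D := by
    calc d n * p ^ 8 ≤ d n * √n := mul_le_mul_of_nonneg_left hsqrt (hd n)
      _ ≤ D := by rw [mul_comm]; exact hD
  -- A return at time `j < lag n` would bring `z` itself back to within `(3 ^ j + 1) * d n`, which is smaller
  -- than `c / j ^ 2` since `3 ^ j` is at most `n ^ (1 / 8)`.
  have h1 : ‖cat^[j] z - z‖ ≤ 3 ^ j * d n + d n := by
    have h2 : cat^[j] z - z = cat^[j] (z - t) + (cat^[j] t - z) := by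
      rw [cat_iterate_sub]; abel
    rw [h2]
    refine (norm_add_le _ _).trans (add_le_add ((norm_cat_iterate_le j _).trans ?_) (hE _ htj))
    rw [norm_sub_rev]
    gcongr
    exact hE t ht
  have h3 : (3 : ℝ) ^ j ≤ p ^ 2 := by
    calc (3 : ℝ) ^ j ≤ 4 ^ j := pow_le_pow_left₀ (by norm_num) (by norm_num) _
      _ ≤ 4 ^ lag n := pow_le_pow_right₀ (by norm_num) hj.le
      _ = p ^ 2 := by rw [hp, ← pow_mul, mul_comm, pow_mul]; norm_num
  have h4 : (j : ℝ) ≤ p := by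
    have : j < 2 ^ lag n := hj.trans Nat.lt_two_pow_self
    rw [hp]; exact_mod_cast this.le
  have h5 := hcz j hj1
  have hj0 : (0 : ℝ) ≤ j := by positivity
  have h6 : c ≤ p ^ 2 * (p ^ 2 * d n + d n) := by
    refine h5.trans (mul_le_mul (pow_le_pow_left₀ hj0 h4 2) (h1.trans ?_) (norm_nonneg _)
      (by positivity))
    have := hd n
    gcongr
  have h7 : p ^ 2 * (p ^ 2 * d n + d n) * p ≤ 2 * D := by
    have h8 : p ^ 2 * (p ^ 2 * d n + d n) * p ≤ 2 * (d n * p ^ 8) := by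
      have h9 : p ^ 5 ≤ p ^ 8 := pow_le_pow_right₀ hp1 (by norm_num)
      have h10 : p ^ 3 ≤ p ^ 8 := pow_le_pow_right₀ hp1 (by norm_num)
      have := hd n
      nlinarith
    linarith
  have h8 : 2 * D / p ≤ 2 * D * (((lag n : ℝ) + 1) / p) := by
    rw [div_eq_mul_one_div]
    gcongr
    linarith [Nat.cast_nonneg (α := ℝ) (lag n)]
  have h9 : p ^ 2 * (p ^ 2 * d n + d n) ≤ 2 * D / p := by
    rwa [le_div_iff₀ (by linarith)]
  linarith

/-! ### Areas of exceedance sets -/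

theorem measureReal_diag_preimage {P Q : ℝ} (hP : P ≠ 0) (hQ : Q ≠ 0) (c d : ℝ)
    (S : Set (ℝ × ℝ)) :
    volume.real ((fun p : ℝ × ℝ => (c + P * p.1, d + Q * p.2)) ⁻¹' S) =
      |P * Q|⁻¹ * volume.real S := by
  let f : ℝ × ℝ →ₗ[ℝ] ℝ × ℝ := (LinearMap.lsmul ℝ ℝ P).prodMap (LinearMap.lsmul ℝ ℝ Q)
  have hdet : LinearMap.det f = P * Q := by
    rw [LinearMap.det_prodMap]
    simp
  have h1 : (fun p : ℝ × ℝ => (c + P * p.1, d + Q * p.2)) ⁻¹' S =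
      f ⁻¹' ((fun p => (c, d) + p) ⁻¹' S) := rfl
  rw [h1, measureReal_def, Measure.addHaar_preimage_linearMap _ (by rw [hdet]; positivity),
    measure_preimage_add, hdet, ENNReal.toReal_mul, ENNReal.toReal_ofReal (abs_nonneg _), abs_inv]
  rfl

/-- The matrix `(2 1; 1 1)` acting on the plane. -/
def catLinear : (ℝ × ℝ) ≃ₗ[ℝ] (ℝ × ℝ) where
  toFun p := (2 * p.1 + p.2, p.1 + p.2)
  invFun p := (p.1 - p.2, 2 * p.2 - p.1)
  map_add' p q := by ext <;> simp <;> ring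
  map_smul' r p := by ext <;> simp <;> ring
  left_inv p := by ext <;> simp <;> ring
  right_inv p := by ext <;> simp <;> ring

theorem catLinear_apply (p : ℝ × ℝ) : catLinear p = (2 * p.1 + p.2, p.1 + p.2) := rfl

theorem proj_catLinear (p : ℝ × ℝ) : proj (catLinear p) = cat (proj p) := by
  simp [proj, catLinear_apply, cat_apply, two_smul, two_mul]

theorem proj_catLinear_iterate (j : ℕ) (p : ℝ × ℝ) :
    proj (catLinear^[j] p) = cat^[j] (proj p) := by
  induction j with
  | zero => rfl
  | succ j ih => rw [Function.iterate_succ_apply', proj_catLinear, ih, Function.iterate_succ_apply']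

theorem continuous_catLinear : Continuous catLinear := by
  change Continuous fun p : ℝ × ℝ => (2 * p.1 + p.2, p.1 + p.2)
  fun_prop

theorem measure_catLinear_preimage_eq_zero {S : Set (ℝ × ℝ)} (hS : volume S = 0) :
    volume (catLinear ⁻¹' S) = 0 := by
  have := Measure.addHaar_preimage_linearMap (volume : Measure (ℝ × ℝ))
    (f := (catLinear : (ℝ × ℝ) →ₗ[ℝ] (ℝ × ℝ))) (LinearEquiv.isUnit_det' catLinear).ne_zero S
  rw [hS, mul_zero] at this
  exact this

theorem norm_catLinear_le (p : ℝ × ℝ) : ‖catLinear p‖ ≤ 3 * ‖p‖ := by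
  have h1 := norm_fst_le p
  have h2 := norm_snd_le p
  rw [Real.norm_eq_abs] at h1 h2
  rw [abs_le] at h1 h2
  refine max_le ?_ ?_ <;> rw [Real.norm_eq_abs, catLinear_apply, abs_le] <;>
    constructor <;> dsimp only <;> linarith [norm_nonneg p]

theorem norm_catLinear_iterate_le (j : ℕ) (p : ℝ × ℝ) : ‖catLinear^[j] p‖ ≤ 3 ^ j * ‖p‖ := by
  induction j with
  | zero => simp
  | succ j ih =>
    rw [Function.iterate_succ_apply', pow_succ]
    linarith [norm_catLinear_le (catLinear^[j] p)]

/-- A set of the plane with finite vertical sections, except over a null set, is null. -/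
theorem measure_eq_zero_of_finite_sections {S : Set (ℝ × ℝ)} (hS : MeasurableSet S)
    (h : ∀ᵐ x : ℝ, (Prod.mk x ⁻¹' S).Finite) : volume S = 0 := by
  change (volume.prod volume) S = 0
  rw [Measure.measure_prod_null hS]
  filter_upwards [h] with x hx
  exact hx.measure_zero _

theorem finite_sq_eq (c : ℝ) : {y : ℝ | y ^ 2 = c}.Finite := by
  refine (Set.toFinite {√c, -√c}).subset fun y hy => ?_
  have hy : y ^ 2 = c := hy
  simp only [mem_insert_iff, mem_singleton_iff]
  have h1 : √c = |y| := by rw [← hy, Real.sqrt_sq_eq_abs]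
  rcases abs_choice y with h | h <;> rw [h1, h] <;> simp

/-- If the rescaled sets `S ε` converge, then the areas have the corresponding power asymptotics. -/
theorem tendsto_measureReal_of_rescaled {S : ℝ → Set (ℝ × ℝ)} {S₀ B : Set (ℝ × ℝ)}
    (hS : ∀ ε, MeasurableSet (S ε)) (hS₀ : MeasurableSet S₀) (hB : MeasurableSet B)
    (hBfin : volume B ≠ ⊤) (hsub : ∀ᶠ ε in 𝓝[>] (0 : ℝ), S ε ⊆ B)
    (hlim : ∀ᵐ p, ∀ᶠ ε in 𝓝[>] (0 : ℝ), p ∈ S ε ↔ p ∈ S₀) :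
    Tendsto (fun ε => volume.real (S ε)) (𝓝[>] 0) (𝓝 (volume.real S₀)) := by
  have h1 := tendsto_measure_of_ae_tendsto_indicator (𝓝[>] (0 : ℝ)) hS₀ hS hB hBfin hsub hlim
  have h2 : volume S₀ ≠ ⊤ := by
    refine ne_top_of_le_ne_top hBfin (le_of_tendsto h1 ?_)
    filter_upwards [hsub] with ε hε using measure_mono hε
  exact (ENNReal.tendsto_toReal h2).comp h1

theorem eventually_add_mul_lt_iff {l R m : ℝ} (h : l ≠ R) :
    ∀ᶠ ε in 𝓝[>] (0 : ℝ), (2 * l + ε * m < 2 * R + ε ↔ l < R) := by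
  have h1 : Tendsto (fun ε : ℝ => 2 * R + ε - (2 * l + ε * m)) (𝓝[>] 0) (𝓝 (2 * R - 2 * l)) := by
    have : Continuous fun ε : ℝ => 2 * R + ε - (2 * l + ε * m) := by fun_prop
    have := this.tendsto 0
    simp only [add_zero, zero_mul] at this
    exact this.mono_left nhdsWithin_le_nhds
  rcases lt_or_gt_of_ne h with h | h
  · filter_upwards [h1.eventually (lt_mem_nhds (show 0 < 2 * R - 2 * l by linarith))] with ε hε
    exact ⟨fun _ => h, fun _ => by linarith⟩
  · filter_upwards [h1.eventually (gt_mem_nhds (show 2 * R - 2 * l < 0 by linarith))] with ε hε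
    exact ⟨fun h' => by linarith, fun h' => by linarith⟩

theorem frac_proj_mem {p : ℝ × ℝ} (hp : p ∈ Ico (0 : ℝ) 1 ×ˢ Ico (0 : ℝ) 1) (a b R : ℝ) :
    proj p ∈ disc a b R ↔ (p.1 - a) ^ 2 + (p.2 - b) ^ 2 < R ^ 2 := by
  simp only [disc, proj, mem_ofPred_eq, frac_coe_of_mem hp.1, frac_coe_of_mem hp.2]

theorem norm_coe_sub_le (t : UnitAddCircle) (a : ℝ) :
    ‖t - (a : UnitAddCircle)‖ ≤ |frac t - a| := by
  conv_lhs => rw [← coe_frac t, ← AddCircle.coe_sub]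
  exact norm_coe_le_abs _

/-- Around an interior point of the square, small discs have the Euclidean area. -/
theorem eventually_measureReal_disc {a b : ℝ} (ha : a ∈ Ioo (0 : ℝ) 1) (hb : b ∈ Ioo (0 : ℝ) 1) :
    ∀ᶠ ε in 𝓝[>] (0 : ℝ), volume.real (disc a b ε) = Real.pi * ε ^ 2 := by
  have hpos : 0 < min (min a (1 - a)) (min b (1 - b)) := by
    simp only [lt_min_iff, sub_pos]
    exact ⟨⟨ha.1, ha.2⟩, hb.1, hb.2⟩
  filter_upwards [Ioo_mem_nhdsGT hpos] with ε hε
  have hlt := hε.2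
  simp only [lt_min_iff] at hlt
  rw [measureReal_eq_inter_proj 0 (measurableSet_disc a b ε), zero_add]
  have hset : proj ⁻¹' disc a b ε ∩ Ico (0 : ℝ) 1 ×ˢ Ico (0 : ℝ) 1 =
      Complex.measurableEquivRealProd.symm ⁻¹' Metric.ball ⟨a, b⟩ ε := by
    ext p
    have hnorm : p ∈ Complex.measurableEquivRealProd.symm ⁻¹' Metric.ball (⟨a, b⟩ : ℂ) ε ↔
        (p.1 - a) ^ 2 + (p.2 - b) ^ 2 < ε ^ 2 := by
      rw [mem_preimage, Metric.mem_ball, dist_eq_norm, ← sq_lt_sq₀ (norm_nonneg _) hε.1.le,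
        Complex.sq_norm, Complex.normSq_apply]
      simp only [Complex.sub_re, Complex.sub_im, sq]
      rfl
    rw [hnorm]
    constructor
    · rintro ⟨h1, h2⟩
      exact (frac_proj_mem h2 a b ε).1 h1
    · intro h
      have h1 := abs_lt.1 (abs_lt_of_sq_lt_sq (by nlinarith [sq_nonneg (p.2 - b)] :
        (p.1 - a) ^ 2 < ε ^ 2) hε.1.le)
      have h2 := abs_lt.1 (abs_lt_of_sq_lt_sq (by nlinarith [sq_nonneg (p.1 - a)] :
        (p.2 - b) ^ 2 < ε ^ 2) hε.1.le)
      have hp : p ∈ Ico (0 : ℝ) 1 ×ˢ Ico (0 : ℝ) 1 :=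
        ⟨⟨by linarith, by linarith⟩, by linarith, by linarith⟩
      exact ⟨(frac_proj_mem hp a b ε).2 h, hp⟩
  have hmp := Complex.volume_preserving_equiv_real_prod.symm Complex.measurableEquivRealProd
  rw [hset, hmp.measureReal_preimage Metric.isOpen_ball.measurableSet.nullMeasurableSet,
    measureReal_def, Complex.volume_ball, ENNReal.toReal_mul, ENNReal.toReal_pow,
    ENNReal.toReal_ofReal hε.1.le, mul_comm]
  rfl

theorem mem_disc_swap {a b R : ℝ} {t : Torus} : t.swap ∈ disc b a R ↔ t ∈ disc a b R := by
  simp only [disc, mem_ofPred_eq, Prod.fst_swap, Prod.snd_swap, add_comm]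

theorem measureReal_disc_swap (a b R : ℝ) :
    volume.real (disc b a R) = volume.real (disc a b R) := by
  have hmp : MeasurePreserving (Prod.swap : Torus → Torus) := Measure.measurePreserving_swap
  rw [← hmp.measureReal_preimage (measurableSet_disc b a R).nullMeasurableSet]
  congr 1
  ext t
  exact mem_disc_swap

/-- Distance from `a` to the interval `[0, 1]`, for `a` to the left of it (`s = true`) or to the
right of it (`s = false`). -/
def margin (s : Bool) (a : ℝ) : ℝ := if s then -a else a - 1

/-- Coordinate of a point of the interval `[0, 1)` measured inwards from the end point nearest
to the exterior point on the side `s`. -/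
def inward (s : Bool) (u : ℝ) : ℝ := if s then u else 1 - u

theorem sq_inward_sub (s : Bool) (a u : ℝ) : (inward s u - a) ^ 2 = (margin s a + u) ^ 2 := by
  cases s <;> simp [inward, margin] <;> ring

theorem abs_frac_lt_of_mem_disc {s : Bool} {a b ε : ℝ} (ha : 0 < margin s a) (hε : 0 < ε)
    {t : Torus} (ht : t ∈ disc a b (margin s a + ε)) : ‖t.1‖ ≤ ε := by
  have h1 := frac_mem t.1
  have h2 : (frac t.1 - a) ^ 2 < (margin s a + ε) ^ 2 := by
    have h3 : (frac t.1 - a) ^ 2 + (frac t.2 - b) ^ 2 < (margin s a + ε) ^ 2 := ht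
    nlinarith [sq_nonneg (frac t.2 - b)]
  have h3 := abs_lt_of_sq_lt_sq h2 (by linarith)
  rw [abs_lt] at h3
  cases s
  · have h4 := norm_coe_sub_le t.1 1
    rw [show ((1 : ℝ) : UnitAddCircle) = 0 from AddCircle.coe_period 1, sub_zero] at h4
    refine h4.trans ?_
    simp only [margin, Bool.false_eq_true, if_false] at h3 ha
    rw [abs_le]; constructor <;> linarith [h1.1, h1.2]
  · have h4 := norm_coe_sub_le t.1 0
    rw [AddCircle.coe_zero, sub_zero] at h4
    refine h4.trans ?_
    simp only [margin, if_true] at h3 ha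
    rw [abs_le]; constructor <;> linarith [h1.1, h1.2]

/-- Caps cut off by large circles from a side of the square have area of order `ε ^ (3 / 2)`. -/
theorem exists_tendsto_cap {s : Bool} {a b : ℝ} (ha : 0 < margin s a) (hb : b ∈ Ioo (0 : ℝ) 1) :
    ∃ C > 0, Tendsto (fun ε => volume.real (disc a b (margin s a + ε)) / ε ^ (3 / 2 : ℝ))
      (𝓝[>] 0) (𝓝 C) := by
  set R := margin s a with hR
  -- The scaling by `ε` across the side and by `√ε` along it turns the caps into sets which converge to
  -- a region bounded by a parabola.
  let S : ℝ → Set (ℝ × ℝ) := fun ε => {q | inward s (ε * q.1) ∈ Ico (0 : ℝ) 1 ∧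
    b + √ε * q.2 ∈ Ico (0 : ℝ) 1 ∧ (R + ε * q.1) ^ 2 + (√ε * q.2) ^ 2 < (R + ε) ^ 2}
  let S₀ : Set (ℝ × ℝ) := {q | 0 < q.1 ∧ 2 * R * q.1 + q.2 ^ 2 < 2 * R}
  have hin : Measurable (inward s) := by
    unfold inward
    split_ifs <;> fun_prop
  have hSm : ∀ ε, MeasurableSet (S ε) := fun ε =>
    ((hin.comp (measurable_fst.const_mul ε)) measurableSet_Ico).inter
      (((measurable_snd.const_mul √ε).const_add b measurableSet_Ico).inter
        (measurableSet_lt (f := fun q : ℝ × ℝ => (R + ε * q.1) ^ 2 + (√ε * q.2) ^ 2) (by fun_prop)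
          measurable_const))
  have hS₀o : IsOpen S₀ := by
    have h1 : IsOpen {q : ℝ × ℝ | 2 * R * q.1 + q.2 ^ 2 < 2 * R} :=
      isOpen_lt (by fun_prop) continuous_const
    exact (isOpen_lt continuous_const continuous_fst).inter h1
  have hlim : Tendsto (fun ε => volume.real (S ε)) (𝓝[>] 0) (𝓝 (volume.real S₀)) := by
    refine tendsto_measureReal_of_rescaled (B := Icc 0 1 ×ˢ Icc (-(R + 1)) (R + 1)) hSm
      hS₀o.measurableSet (measurableSet_Icc.prod measurableSet_Icc) ?_ ?_ ?_
    · exact (isCompact_Icc.prod isCompact_Icc).measure_lt_top.ne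
    · filter_upwards [Ioo_mem_nhdsGT (zero_lt_one (α := ℝ))] with ε hε q hq
      obtain ⟨h1, -, h3⟩ := hq
      have hu : 0 ≤ q.1 := by
        have : 0 ≤ ε * q.1 := by
          cases s <;> simp only [inward, Bool.false_eq_true, if_true, if_false] at h1 <;>
            linarith [h1.1, h1.2]
        exact nonneg_of_mul_nonneg_right this hε.1
      rw [mul_pow, Real.sq_sqrt hε.1.le] at h3
      have hε0 := hε.1
      have h4 : 2 * R * q.1 + ε * q.1 ^ 2 + q.2 ^ 2 < 2 * R + ε := by
        have : ε * (2 * R * q.1 + ε * q.1 ^ 2 + q.2 ^ 2) < ε * (2 * R + ε) := by nlinarith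
        exact lt_of_mul_lt_mul_left this hε0.le
      refine ⟨⟨hu, ?_⟩, abs_le.1 (abs_le_of_sq_le_sq ?_ (by linarith))⟩
      · by_contra hcon
        push Not at hcon
        have h5 := mul_pos ha (sub_pos.2 hcon)
        have h6 := mul_pos hε0 (sub_pos.2 (one_lt_pow₀ hcon two_ne_zero))
        linarith [sq_nonneg q.2]
      · nlinarith [hε.2, mul_nonneg ha.le hu, mul_nonneg hε0.le (sq_nonneg q.1)]
    · have hnull : volume {q : ℝ × ℝ | q.1 = 0 ∨ 2 * R * q.1 + q.2 ^ 2 = 2 * R} = 0 := by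
        refine measure_eq_zero_of_finite_sections ?_ ?_
        · exact ((isClosed_eq continuous_fst continuous_const).union
            (isClosed_eq (f := fun q : ℝ × ℝ => 2 * R * q.1 + q.2 ^ 2) (by fun_prop)
              continuous_const)).measurableSet
        · filter_upwards [measure_eq_zero_iff_ae_notMem.1 (Real.volume_singleton (a := 0))]
            with x hx
          refine (finite_sq_eq (2 * R - 2 * R * x)).subset fun y hy => ?_
          rcases hy with h | h
          · exact absurd h hx
          · change y ^ 2 = _
            dsimp only at h
            linarith
      filter_upwards [measure_eq_zero_iff_ae_notMem.1 hnull] with q hq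
      rw [not_or] at hq
      have hl : R * q.1 + q.2 ^ 2 / 2 ≠ R := fun h => hq.2 (by linarith)
      have hc1 : Tendsto (fun ε : ℝ => ε * q.1) (𝓝[>] 0) (𝓝 0) := by
        have : Continuous fun ε : ℝ => ε * q.1 := by fun_prop
        simpa using (this.tendsto 0).mono_left nhdsWithin_le_nhds
      have hc2 : Tendsto (fun ε : ℝ => b + √ε * q.2) (𝓝[>] 0) (𝓝 b) := by
        have : Continuous fun ε : ℝ => b + √ε * q.2 := by fun_prop
        simpa using (this.tendsto 0).mono_left nhdsWithin_le_nhds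
      filter_upwards [eventually_add_mul_lt_iff (m := q.1 ^ 2) hl, self_mem_nhdsWithin,
        hc1.eventually (gt_mem_nhds (zero_lt_one (α := ℝ))),
        hc2.eventually (Ico_mem_nhds hb.1 hb.2)] with ε h1 hε h3 h4
      have hε : 0 < ε := hε
      have h5 : (R + ε * q.1) ^ 2 + (√ε * q.2) ^ 2 < (R + ε) ^ 2 ↔ R * q.1 + q.2 ^ 2 / 2 < R := by
        have h6 : (R + ε) ^ 2 - ((R + ε * q.1) ^ 2 + ε * q.2 ^ 2) =
            ε * (2 * R + ε - (2 * (R * q.1 + q.2 ^ 2 / 2) + ε * q.1 ^ 2)) := by ring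
        rw [← h1, mul_pow, Real.sq_sqrt hε.le, ← sub_pos, h6, mul_pos_iff_of_pos_left hε, sub_pos]
      have h6 : inward s (ε * q.1) ∈ Ico (0 : ℝ) 1 ↔ 0 < q.1 := by
        have hne : q.1 ≠ 0 := hq.1
        have hiff : 0 < ε * q.1 ↔ 0 < q.1 := mul_pos_iff_of_pos_left hε
        have hiff' : 0 ≤ ε * q.1 ↔ 0 ≤ q.1 := mul_nonneg_iff_of_pos_left hε
        cases s <;> simp only [inward, Bool.false_eq_true, if_true, if_false, mem_Ico]
        · rw [← hiff]; constructor
          · intro h; linarith [h.2]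
          · intro h; exact ⟨by linarith, by linarith⟩
        · rw [hiff']
          exact ⟨fun h => lt_of_le_of_ne h.1 hne.symm, fun h => ⟨h.le, h3⟩⟩
      change _ ∧ _ ∧ _ ↔ _ ∧ _
      rw [h6, h5]
      constructor
      · rintro ⟨h7, -, h8⟩; exact ⟨h7, by linarith⟩
      · rintro ⟨h7, h8⟩; exact ⟨h7, h4, by linarith⟩
  refine ⟨volume.real S₀, ?_, hlim.congr' ?_⟩
  · have hne : S₀.Nonempty := ⟨(1 / 2, 0), by norm_num, by
      change 2 * R * (1 / 2) + 0 ^ 2 < 2 * R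
      linarith⟩
    have hfin : volume S₀ ≠ ⊤ := by
      refine (measure_lt_top_of_subset (μ := volume) (s := Icc (0 : ℝ) 1 ×ˢ Icc (-(2 * R + 1)) (2 * R + 1)) ?_
        (isCompact_Icc.prod isCompact_Icc).measure_lt_top.ne).ne
      intro q hq
      obtain ⟨h1, h2⟩ := hq
      refine ⟨⟨h1.le, ?_⟩, abs_le.1 (abs_le_of_sq_le_sq ?_ (by linarith))⟩
      · nlinarith [sq_nonneg q.2]
      · nlinarith [mul_pos ha h1]
    exact ENNReal.toReal_pos (hS₀o.measure_pos volume hne).ne' hfin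
  · filter_upwards [self_mem_nhdsWithin] with ε hε
    have hε : 0 < ε := hε
    have hsq : 0 < √ε := Real.sqrt_pos.2 hε
    set σ : ℝ := if s then 1 else -1 with hσ
    have hσ0 : |σ| = 1 := by cases s <;> simp [hσ]
    have hinw : ∀ u, inward s u = (if s then 0 else 1) + σ * u := by
      intro u; cases s <;> simp [inward, hσ]; ring
    have h1 : S ε = (fun q : ℝ × ℝ => ((if s then 0 else 1) + (σ * ε) * q.1, b + √ε * q.2)) ⁻¹'
        (proj ⁻¹' disc a b (R + ε) ∩ Ico (0 : ℝ) 1 ×ˢ Ico (0 : ℝ) 1) := by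
      ext q
      have h2 : (((if s then 0 else 1) + (σ * ε) * q.1 : ℝ), b + √ε * q.2) =
          (inward s (ε * q.1), b + √ε * q.2) := by
        rw [hinw, mul_assoc]
      rw [mem_preimage, h2]
      have h4 : ∀ hp : (inward s (ε * q.1), b + √ε * q.2) ∈ Ico (0 : ℝ) 1 ×ˢ Ico (0 : ℝ) 1,
          proj (inward s (ε * q.1), b + √ε * q.2) ∈ disc a b (R + ε) ↔
          (R + ε * q.1) ^ 2 + (√ε * q.2) ^ 2 < (R + ε) ^ 2 := by
        intro hp
        rw [frac_proj_mem hp, sq_inward_sub, add_sub_cancel_left]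
      constructor
      · rintro ⟨h5, h6, h7⟩
        exact ⟨(h4 ⟨h5, h6⟩).2 h7, h5, h6⟩
      · rintro ⟨h5, h6⟩
        exact ⟨h6.1, h6.2, (h4 h6).1 h5⟩
    have h2 : |σ * ε * √ε| = ε ^ (3 / 2 : ℝ) := by
      rw [abs_mul, abs_mul, hσ0, one_mul, abs_of_pos hε, abs_of_pos hsq, Real.sqrt_eq_rpow]
      nth_rewrite 1 [← Real.rpow_one ε]
      rw [← Real.rpow_add hε]
      norm_num
    have hne : σ * ε ≠ 0 := by
      have : σ ≠ 0 := by intro h; rw [h] at hσ0; simp at hσ0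
      exact mul_ne_zero this hε.ne'
    have h3 := measureReal_eq_inter_proj 0 (measurableSet_disc a b (R + ε))
    rw [zero_add] at h3
    rw [h1, measureReal_diag_preimage hne hsq.ne', h2, ← h3]
    exact (div_eq_inv_mul _ _).symm

/-! ### The corners of the square -/

/-- The half-line of coordinates, relative to the end point of `[0, 1]` nearest to an exterior point
on the side `s`, which belong to `[0, 1)`. -/
def side (s : Bool) (x : ℝ) : Prop := if s then 0 ≤ x else x < 0

/-- The quadrant, seen from a corner of the unit square, which contains the square. -/
def quadrant (s₁ s₂ : Bool) : Set (ℝ × ℝ) := {p | side s₁ p.1 ∧ side s₂ p.2}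

theorem measurableSet_quadrant (s₁ s₂ : Bool) : MeasurableSet (quadrant s₁ s₂) := by
  have h : ∀ s, MeasurableSet {x : ℝ | side s x} := by
    intro s
    cases s
    · exact measurableSet_Iio
    · exact measurableSet_Ici
  exact (measurable_fst (h s₁)).inter (measurable_snd (h s₂))

theorem mul_mem_quadrant_iff {s₁ s₂ : Bool} {ε : ℝ} (hε : 0 < ε) (q : ℝ × ℝ) :
    (ε * q.1, ε * q.2) ∈ quadrant s₁ s₂ ↔ q ∈ quadrant s₁ s₂ := by
  have h : ∀ s (x : ℝ), side s (ε * x) ↔ side s x := by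
    intro s x
    cases s
    · change ε * x < 0 ↔ x < 0
      rw [← neg_pos, ← mul_neg, mul_pos_iff_of_pos_left hε, neg_pos]
    · change 0 ≤ ε * x ↔ 0 ≤ x
      exact mul_nonneg_iff_of_pos_left hε
  exact and_congr (h _ _) (h _ _)

theorem catLinear_quadrant_same {s : Bool} {p : ℝ × ℝ} (hp : p ∈ quadrant s s) :
    catLinear p ∈ quadrant s s ∧ |p.1| ≤ |(catLinear p).1| ∧ |p.2| ≤ |(catLinear p).2| := by
  obtain ⟨h1, h2⟩ := hp
  rw [catLinear_apply]
  cases s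
  · change p.1 < 0 at h1
    change p.2 < 0 at h2
    have h3 : 2 * p.1 + p.2 < 0 := by linarith
    have h4 : p.1 + p.2 < 0 := by linarith
    refine ⟨⟨h3, h4⟩, ?_, ?_⟩
    · rw [abs_of_neg h1, abs_of_neg h3]; linarith
    · rw [abs_of_neg h2, abs_of_neg h4]; linarith
  · change 0 ≤ p.1 at h1
    change 0 ≤ p.2 at h2
    have h3 : 0 ≤ 2 * p.1 + p.2 := by linarith
    have h4 : 0 ≤ p.1 + p.2 := by linarith
    refine ⟨⟨h3, h4⟩, ?_, ?_⟩
    · rw [abs_of_nonneg h1, abs_of_nonneg h3]; linarith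
    · rw [abs_of_nonneg h2, abs_of_nonneg h4]; linarith

theorem catLinear_quadrant_opposite {s : Bool} {p : ℝ × ℝ} (hp : catLinear p ∈ quadrant s !s) :
    p ∈ quadrant s !s ∧ |(catLinear p).1| ≤ |p.1| ∧ |(catLinear p).2| ≤ |p.2| := by
  obtain ⟨h1, h2⟩ := hp
  rw [catLinear_apply] at h1 h2 ⊢
  cases s
  · change 2 * p.1 + p.2 < 0 at h1
    change 0 ≤ p.1 + p.2 at h2
    have h3 : p.1 < 0 := by linarith
    have h4 : 0 ≤ p.2 := by linarith
    refine ⟨⟨h3, h4⟩, ?_, ?_⟩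
    · rw [abs_of_neg h1, abs_of_neg h3]; linarith
    · rw [abs_of_nonneg h2, abs_of_nonneg h4]; linarith
  · change 0 ≤ 2 * p.1 + p.2 at h1
    change p.1 + p.2 < 0 at h2
    have h3 : 0 ≤ p.1 := by linarith
    have h4 : p.2 < 0 := by linarith
    refine ⟨⟨h3, h4⟩, ?_, ?_⟩
    · rw [abs_of_nonneg h1, abs_of_nonneg h3]; linarith
    · rw [abs_of_neg h2, abs_of_neg h4]; linarith

/-- The matrix `(2 1; 1 1)` preserves the quadrants `s, s` and expands them away from the corner, while
its inverse preserves the quadrants `s, !s` and expands them. Hence a linear orbit that comes back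
to a quadrant has not left it in between, and its distances from the axes are monotone. -/
theorem catLinear_quadrant_return {s₁ s₂ : Bool} {p : ℝ × ℝ} {j : ℕ} (hj : 1 ≤ j)
    (hp : p ∈ quadrant s₁ s₂) (hpj : catLinear^[j] p ∈ quadrant s₁ s₂) :
    catLinear p ∈ quadrant s₁ s₂ ∧
      ((|(catLinear p).1| ≤ |p.1| ∧ |(catLinear p).2| ≤ |p.2|) ∨
        (|(catLinear p).1| ≤ |(catLinear^[j] p).1| ∧
          |(catLinear p).2| ≤ |(catLinear^[j] p).2|)) := by
  obtain ⟨i, rfl⟩ : ∃ i, j = i + 1 := ⟨j - 1, by omega⟩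
  by_cases hs : s₁ = s₂
  · subst hs
    have h1 := catLinear_quadrant_same hp
    refine ⟨h1.1, Or.inr ?_⟩
    have key : ∀ i, catLinear^[i + 1] p ∈ quadrant s₁ s₁ ∧
        |(catLinear p).1| ≤ |(catLinear^[i + 1] p).1| ∧
        |(catLinear p).2| ≤ |(catLinear^[i + 1] p).2| := by
      intro i
      induction i with
      | zero => exact ⟨h1.1, le_rfl, le_rfl⟩
      | succ i ih =>
        have h2 := catLinear_quadrant_same ih.1
        rw [Function.iterate_succ_apply' _ (i + 1)]
        exact ⟨h2.1, ih.2.1.trans h2.2.1, ih.2.2.trans h2.2.2⟩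
    exact (key i).2
  · obtain rfl : s₂ = !s₁ := by cases s₁ <;> cases s₂ <;> simp_all
    have key : ∀ i, catLinear^[i + 1] p ∈ quadrant s₁ !s₁ → catLinear p ∈ quadrant s₁ !s₁ := by
      intro i
      induction i with
      | zero => exact id
      | succ i ih =>
        intro h
        rw [Function.iterate_succ_apply'] at h
        exact ih (catLinear_quadrant_opposite h).1
    have h1 := key i hpj
    exact ⟨h1, Or.inl (catLinear_quadrant_opposite h1).2⟩

/-- The part of a quadrant at distance less than `R` from an exterior point whose distances from the
axes are `m₁` and `m₂`. -/
def cornerSet (s₁ s₂ : Bool) (m₁ m₂ R : ℝ) : Set (ℝ × ℝ) :=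
  {p | p ∈ quadrant s₁ s₂ ∧ (m₁ + |p.1|) ^ 2 + (m₂ + |p.2|) ^ 2 < R ^ 2}

theorem measurableSet_cornerSet (s₁ s₂ : Bool) (m₁ m₂ R : ℝ) :
    MeasurableSet (cornerSet s₁ s₂ m₁ m₂ R) := by
  have h : MeasurableSet {p : ℝ × ℝ | (m₁ + |p.1|) ^ 2 + (m₂ + |p.2|) ^ 2 < R ^ 2} :=
    (isOpen_lt (by fun_prop) continuous_const).measurableSet
  exact (measurableSet_quadrant s₁ s₂).inter h

theorem catLinear_mem_cornerSet {s₁ s₂ : Bool} {m₁ m₂ R : ℝ} (hm₁ : 0 < m₁) (hm₂ : 0 < m₂)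
    {p : ℝ × ℝ} {j : ℕ} (hj : 1 ≤ j) (hp : p ∈ cornerSet s₁ s₂ m₁ m₂ R)
    (hpj : catLinear^[j] p ∈ cornerSet s₁ s₂ m₁ m₂ R) :
    catLinear p ∈ cornerSet s₁ s₂ m₁ m₂ R := by
  obtain ⟨h1, h2⟩ := catLinear_quadrant_return hj hp.1 hpj.1
  refine ⟨h1, ?_⟩
  rcases h2 with ⟨h3, h4⟩ | ⟨h3, h4⟩
  · refine lt_of_le_of_lt ?_ hp.2
    gcongr
  · refine lt_of_le_of_lt ?_ hpj.2
    gcongr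

theorem frac_coe_sub_sq {s : Bool} {a x : ℝ} (ha : 0 < margin s a)
    (hx : x ∈ Ico (-(1 / 2) : ℝ) (1 / 2)) :
    (side s x → (frac x - a) ^ 2 = (margin s a + |x|) ^ 2) ∧
      (¬ side s x → (margin s a + 1 / 2) ^ 2 ≤ (frac x - a) ^ 2) := by
  have hneg : x < 0 → frac x = x + 1 := by
    intro h
    have h1 : ((x + 1 : ℝ) : UnitAddCircle) = x := by
      rw [AddCircle.coe_add, show ((1 : ℝ) : UnitAddCircle) = 0 from AddCircle.coe_period 1,
        add_zero]
    rw [← h1]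
    exact frac_coe_of_mem ⟨by linarith [hx.1], by linarith⟩
  have hpos : 0 ≤ x → frac x = x := fun h => frac_coe_of_mem ⟨h, by linarith [hx.2]⟩
  cases s
  · simp only [margin, side, Bool.false_eq_true, if_false, not_lt] at ha ⊢
    constructor
    · intro h; rw [hneg h, abs_of_neg h]; ring
    · intro h; rw [hpos h]
      have := hx.2
      nlinarith
  · simp only [margin, side, if_true, not_le] at ha ⊢
    constructor
    · intro h; rw [hpos h, abs_of_nonneg h]; ring
    · intro h; rw [hneg h]
      have := hx.1
      nlinarith

/-- Near the corner, which is the point `0` of the torus, the exceedance set is the corner set: points in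
the other quadrants represent points of the square which are close to other corners. -/
theorem proj_mem_disc_iff_cornerSet {s₁ s₂ : Bool} {a b R : ℝ} (ha : 0 < margin s₁ a)
    (hb : 0 < margin s₂ b)
    (hR : R ^ 2 ≤ margin s₁ a ^ 2 + margin s₂ b ^ 2 + min (margin s₁ a) (margin s₂ b))
    {p : ℝ × ℝ} (hp : p ∈ Ico (-(1 / 2) : ℝ) (1 / 2) ×ˢ Ico (-(1 / 2) : ℝ) (1 / 2)) :
    proj p ∈ disc a b R ↔ p ∈ cornerSet s₁ s₂ (margin s₁ a) (margin s₂ b) R := by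
  obtain ⟨h1, h1'⟩ := frac_coe_sub_sq ha hp.1
  obtain ⟨h2, h2'⟩ := frac_coe_sub_sq hb hp.2
  have hmin₁ := min_le_left (margin s₁ a) (margin s₂ b)
  have hmin₂ := min_le_right (margin s₁ a) (margin s₂ b)
  have h4 : margin s₁ a ^ 2 ≤ (frac p.1 - a) ^ 2 := by
    by_cases h : side s₁ p.1
    · rw [h1 h]; nlinarith [abs_nonneg p.1]
    · nlinarith [h1' h]
  have h5 : margin s₂ b ^ 2 ≤ (frac p.2 - b) ^ 2 := by
    by_cases h : side s₂ p.2
    · rw [h2 h]; nlinarith [abs_nonneg p.2]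
    · nlinarith [h2' h]
  change (frac p.1 - a) ^ 2 + (frac p.2 - b) ^ 2 < R ^ 2 ↔ _
  constructor
  · intro h
    have h6 : side s₁ p.1 := by
      by_contra hcon
      nlinarith [h1' hcon]
    have h7 : side s₂ p.2 := by
      by_contra hcon
      nlinarith [h2' hcon]
    rw [h1 h6, h2 h7] at h
    exact ⟨⟨h6, h7⟩, h⟩
  · rintro ⟨⟨h6, h7⟩, h⟩
    rwa [h1 h6, h2 h7]

theorem norm_le_of_mem_cornerSet {s₁ s₂ : Bool} {m₁ m₂ R ε : ℝ} (hm₁ : 0 < m₁) (hm₂ : 0 < m₂)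
    (hR : R ^ 2 = m₁ ^ 2 + m₂ ^ 2) (hε : 0 < ε) (hε1 : ε ≤ 1) {p : ℝ × ℝ}
    (hp : p ∈ cornerSet s₁ s₂ m₁ m₂ (R + ε)) : ‖p‖ ≤ (R + 1) / min m₁ m₂ * ε := by
  have h1 := hp.2
  have h2 : m₁ * |p.1| + m₂ * |p.2| ≤ (R + 1) * ε := by
    nlinarith [sq_nonneg |p.1|, sq_nonneg |p.2|]
  have h3 := mul_nonneg hm₁.le (abs_nonneg p.1)
  have h4 := mul_nonneg hm₂.le (abs_nonneg p.2)
  rw [div_mul_eq_mul_div, le_div_iff₀ (lt_min hm₁ hm₂)]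
  have h5 : |p.1| * min m₁ m₂ ≤ (R + 1) * ε := by
    nlinarith [min_le_left m₁ m₂, abs_nonneg p.1]
  have h6 : |p.2| * min m₁ m₂ ≤ (R + 1) * ε := by
    nlinarith [min_le_right m₁ m₂, abs_nonneg p.2]
  rw [Prod.norm_def, max_mul_of_nonneg _ _ (lt_min hm₁ hm₂).le]
  exact max_le h5 h6

theorem mem_Ico_prod_of_norm_lt {p : ℝ × ℝ} {r : ℝ} (h : ‖p‖ < r) :
    p ∈ Ico (-r) r ×ˢ Ico (-r) r := by
  have h1 := abs_lt.1 ((norm_fst_le p).trans_lt h)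
  have h2 := abs_lt.1 ((norm_snd_le p).trans_lt h)
  exact ⟨⟨h1.1.le, h1.2⟩, h2.1.le, h2.2⟩

theorem exists_proj_eq (t : Torus) :
    ∃ p ∈ Ico (-(1 / 2) : ℝ) (1 / 2) ×ˢ Ico (-(1 / 2) : ℝ) (1 / 2), proj p = t := by
  have h : ∀ t : UnitAddCircle, ∃ x ∈ Ico (-(1 / 2) : ℝ) (1 / 2), (x : UnitAddCircle) = t := by
    intro t
    have h1 := frac_mem t
    rcases lt_or_ge (frac t) (1 / 2) with h | h
    · exact ⟨frac t, ⟨by linarith [h1.1], h⟩, coe_frac t⟩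
    · refine ⟨frac t - 1, ⟨by linarith, by linarith [h1.2]⟩, ?_⟩
      rw [AddCircle.coe_sub, coe_frac, show ((1 : ℝ) : UnitAddCircle) = 0 from
        AddCircle.coe_period 1, sub_zero]
  obtain ⟨x, hx, hx'⟩ := h t.1
  obtain ⟨y, hy, hy'⟩ := h t.2
  exact ⟨(x, y), ⟨hx, hy⟩, Prod.ext hx' hy'⟩

theorem norm_proj_le (p : ℝ × ℝ) : ‖proj p‖ ≤ ‖p‖ :=
  max_le ((norm_coe_le_abs _).trans (norm_fst_le p)) ((norm_coe_le_abs _).trans (norm_snd_le p))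

/-- The exit set of a limiting triangle has interior points. -/
theorem exists_eventually_exit (s₁ s₂ : Bool) {m₁ m₂ R : ℝ} (hm₁ : 0 < m₁) (hm₂ : 0 < m₂)
    (hR : 0 < R) : ∃ q : ℝ × ℝ, ∀ᶠ p in 𝓝 q, p ∈ quadrant s₁ s₂ ∧ m₁ * |p.1| + m₂ * |p.2| < R ∧
      ¬ (catLinear p ∈ quadrant s₁ s₂ ∧ m₁ * |(catLinear p).1| + m₂ * |(catLinear p).2| < R) := by
  have hℓ : Continuous fun p : ℝ × ℝ => m₁ * |p.1| + m₂ * |p.2| := by fun_prop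
  have hB := continuous_catLinear
  have hℓB : Continuous fun p : ℝ × ℝ => m₁ * |(catLinear p).1| + m₂ * |(catLinear p).2| := by
    fun_prop
  have hlt : ∀ {f : ℝ × ℝ → ℝ} (q : ℝ × ℝ) (c : ℝ), Continuous f → f q < c →
      ∀ᶠ p in 𝓝 q, f p < c := fun q c hf h => hf.continuousAt.eventually (gt_mem_nhds h)
  have hgt : ∀ {f : ℝ × ℝ → ℝ} (q : ℝ × ℝ) (c : ℝ), Continuous f → c < f q →
      ∀ᶠ p in 𝓝 q, c < f p := fun q c hf h => hf.continuousAt.eventually (lt_mem_nhds h)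
  -- On the diagonal of an expanded quadrant the size at least doubles, so `3 / 4` of the threshold is
  -- brought beyond it; in the other quadrants a point of slope `-3` leaves the quadrant.
  set σ : ℝ := 3 * R / (4 * (m₁ + m₂)) with hσ
  have hσ0 : 0 < σ := by positivity
  have hσ1 : σ * (m₁ + m₂) = 3 * R / 4 := by rw [hσ]; field_simp
  set τ : ℝ := R / (2 * (m₁ + 3 * m₂)) with hτ
  have hτ0 : 0 < τ := by positivity
  have hτ1 : τ * (m₁ + 3 * m₂) = R / 2 := by rw [hτ]; field_simp
  have h3τ : 0 < 3 * τ := by positivity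
  cases s₁ <;> cases s₂
  · refine ⟨(-σ, -σ), ?_⟩
    filter_upwards [hlt (-σ, -σ) 0 continuous_fst (by simpa using hσ0),
      hlt (-σ, -σ) 0 continuous_snd (by simpa using hσ0),
      hlt (-σ, -σ) R hℓ (by simp only [abs_neg, abs_of_pos hσ0]; linarith),
      hgt (-σ, -σ) R hℓB (by
        rw [catLinear_apply]
        dsimp only
        rw [abs_of_neg (by linarith), abs_of_neg (by linarith)]
        nlinarith)] with p h1 h2 h3 h4
    exact ⟨⟨h1, h2⟩, h3, fun h => by linarith [h.2]⟩
  · refine ⟨(-τ, 3 * τ), ?_⟩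
    filter_upwards [hlt (-τ, 3 * τ) 0 continuous_fst (by simpa using hτ0),
      hgt (-τ, 3 * τ) 0 continuous_snd h3τ,
      hlt (-τ, 3 * τ) R hℓ (by simp only [abs_neg, abs_of_pos hτ0, abs_of_pos h3τ]; linarith),
      hgt (f := fun p => (catLinear p).1) (-τ, 3 * τ) 0 (by fun_prop) (by
        rw [catLinear_apply]
        dsimp only
        linarith)] with p h1 h2 h3 h4
    exact ⟨⟨h1, h2.le⟩, h3, fun h => absurd h.1.1 (not_lt.2 h4.le)⟩
  · refine ⟨(τ, -(3 * τ)), ?_⟩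
    filter_upwards [hgt (τ, -(3 * τ)) 0 continuous_fst hτ0,
      hlt (τ, -(3 * τ)) 0 continuous_snd (by simpa using hτ0),
      hlt (τ, -(3 * τ)) R hℓ (by simp only [abs_neg, abs_of_pos hτ0, abs_of_pos h3τ]; linarith),
      hlt (f := fun p => (catLinear p).1) (τ, -(3 * τ)) 0 (by fun_prop) (by
        rw [catLinear_apply]
        dsimp only
        linarith)] with p h1 h2 h3 h4
    exact ⟨⟨h1.le, h2⟩, h3, fun h => absurd h.1.1 (not_le.2 h4)⟩
  · refine ⟨(σ, σ), ?_⟩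
    filter_upwards [hgt (σ, σ) 0 continuous_fst hσ0, hgt (σ, σ) 0 continuous_snd hσ0,
      hlt (σ, σ) R hℓ (by simp only [abs_of_pos hσ0]; linarith),
      hgt (σ, σ) R hℓB (by
        rw [catLinear_apply]
        dsimp only
        rw [abs_of_pos (by linarith), abs_of_pos (by linarith)]
        nlinarith)] with p h1 h2 h3 h4
    exact ⟨⟨h1.le, h2.le⟩, h3, fun h => by linarith [h.2]⟩

theorem measure_level_eq_zero {m₁ m₂ : ℝ} (hm₂ : 0 < m₂) (R : ℝ) :
    volume {p : ℝ × ℝ | m₁ * |p.1| + m₂ * |p.2| = R} = 0 := by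
  refine measure_eq_zero_of_finite_sections
    (isClosed_eq (by fun_prop) continuous_const).measurableSet (Eventually.of_forall fun x => ?_)
  refine (finite_sq_eq (((R - m₁ * |x|) / m₂) ^ 2)).subset fun y hy => ?_
  have h1 : m₁ * |x| + m₂ * |y| = R := hy
  have h2 : |y| = (R - m₁ * |x|) / m₂ := by
    rw [eq_div_iff hm₂.ne']; linarith
  change y ^ 2 = _
  rw [← h2, sq_abs]

/-- Near a corner of the square, the exit sets of the exceedance sets have area of order `ε ^ 2`. -/
theorem exists_tendsto_corner {s₁ s₂ : Bool} {a b R : ℝ} (ha : 0 < margin s₁ a)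
    (hb : 0 < margin s₂ b) (hR0 : 0 < R) (hR : R ^ 2 = margin s₁ a ^ 2 + margin s₂ b ^ 2) :
    ∃ C > 0, Tendsto (fun ε => volume.real (disc a b (R + ε) \ cat ⁻¹' disc a b (R + ε)) /
      ε ^ (2 : ℝ)) (𝓝[>] 0) (𝓝 C) := by
  set m₁ := margin s₁ a
  set m₂ := margin s₂ b
  set D : ℝ := (R + 1) / min m₁ m₂ with hD
  have hmin : 0 < min m₁ m₂ := lt_min ha hb
  have hD0 : 0 < D := by positivity
  -- Scaled by `ε`, the exceedance sets converge to the triangle `T₀`, and scaling commutes with the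
  -- linear map.
  let G : ℝ → Set (ℝ × ℝ) := fun ε => cornerSet s₁ s₂ m₁ m₂ (R + ε)
  let S : ℝ → Set (ℝ × ℝ) := fun ε => (fun q : ℝ × ℝ => (0 + ε * q.1, 0 + ε * q.2)) ⁻¹'
    (G ε \ catLinear ⁻¹' G ε)
  let T₀ : Set (ℝ × ℝ) := {q | q ∈ quadrant s₁ s₂ ∧ m₁ * |q.1| + m₂ * |q.2| < R}
  let S₀ : Set (ℝ × ℝ) := T₀ \ catLinear ⁻¹' T₀
  have hGm : ∀ ε, MeasurableSet (G ε) := fun ε => measurableSet_cornerSet _ _ _ _ _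
  have hSm : ∀ ε, MeasurableSet (S ε) := fun ε => by
    refine ((hGm ε).diff (continuous_catLinear.measurable (hGm ε))).preimage ?_
    fun_prop
  have hT₀m : MeasurableSet T₀ := by
    have h : MeasurableSet {q : ℝ × ℝ | m₁ * |q.1| + m₂ * |q.2| < R} :=
      (isOpen_lt (by fun_prop) continuous_const).measurableSet
    exact (measurableSet_quadrant s₁ s₂).inter h
  have hS₀m : MeasurableSet S₀ := hT₀m.diff (continuous_catLinear.measurable hT₀m)
  have hmul : ∀ ε (q : ℝ × ℝ), ‖((0 + ε * q.1, 0 + ε * q.2) : ℝ × ℝ)‖ = |ε| * ‖q‖ := by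
    intro ε q
    have : ((0 + ε * q.1, 0 + ε * q.2) : ℝ × ℝ) = ε • q := by ext <;> simp
    rw [this, norm_smul, Real.norm_eq_abs]
  have hGlim : ∀ q : ℝ × ℝ, m₁ * |q.1| + m₂ * |q.2| ≠ R →
      ∀ᶠ ε in 𝓝[>] (0 : ℝ), ((0 + ε * q.1, 0 + ε * q.2) : ℝ × ℝ) ∈ G ε ↔ q ∈ T₀ := by
    intro q hq
    filter_upwards [eventually_add_mul_lt_iff (m := q.1 ^ 2 + q.2 ^ 2) hq, self_mem_nhdsWithin]
      with ε h1 hε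
    have hε : 0 < ε := hε
    simp only [zero_add]
    refine and_congr (mul_mem_quadrant_iff hε q) ?_
    dsimp only
    rw [← h1, abs_mul, abs_mul, abs_of_pos hε, ← sub_pos]
    have h2 : (R + ε) ^ 2 - ((m₁ + ε * |q.1|) ^ 2 + (m₂ + ε * |q.2|) ^ 2) =
        ε * (2 * R + ε - (2 * (m₁ * |q.1| + m₂ * |q.2|) + ε * (q.1 ^ 2 + q.2 ^ 2))) := by
      rw [← sq_abs q.1, ← sq_abs q.2]
      linear_combination hR
    rw [h2, mul_pos_iff_of_pos_left hε, sub_pos]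
  have hlim : Tendsto (fun ε => volume.real (S ε)) (𝓝[>] 0) (𝓝 (volume.real S₀)) := by
    refine tendsto_measureReal_of_rescaled (B := Metric.closedBall 0 D) hSm hS₀m
      Metric.isClosed_closedBall.measurableSet measure_closedBall_lt_top.ne ?_ ?_
    · filter_upwards [Ioo_mem_nhdsGT (zero_lt_one (α := ℝ))] with ε hε q hq
      have h1 := norm_le_of_mem_cornerSet ha hb hR hε.1 hε.2.le hq.1
      rw [hmul, abs_of_pos hε.1, mul_comm] at h1
      rw [mem_closedBall_zero_iff]
      exact le_of_mul_le_mul_right h1 hε.1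
    · have hnull := measure_level_eq_zero (m₁ := m₁) hb R
      have hnull' := measure_catLinear_preimage_eq_zero hnull
      filter_upwards [measure_eq_zero_iff_ae_notMem.1 hnull,
        measure_eq_zero_iff_ae_notMem.1 hnull'] with q h1 h2
      filter_upwards [hGlim q h1, hGlim (catLinear q) h2] with ε h3 h4
      refine and_congr h3 (not_congr ?_)
      rw [mem_preimage, mem_preimage, ← h4]
      have : catLinear (0 + ε * q.1, 0 + ε * q.2) =
          (0 + ε * (catLinear q).1, 0 + ε * (catLinear q).2) := by
        ext <;> simp only [catLinear_apply] <;> ring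
      rw [this]
  refine ⟨volume.real S₀, ?_, hlim.congr' ?_⟩
  · obtain ⟨q, hq⟩ := exists_eventually_exit s₁ s₂ ha hb hR0
    have hfin : volume S₀ ≠ ⊤ := by
      refine (measure_lt_top_of_subset (μ := volume) (s := Metric.closedBall 0 (R / min m₁ m₂)) ?_
        measure_closedBall_lt_top.ne).ne
      intro p hp
      have h1 : m₁ * |p.1| + m₂ * |p.2| < R := hp.1.2
      have h3 := mul_nonneg ha.le (abs_nonneg p.1)
      have h4 := mul_nonneg hb.le (abs_nonneg p.2)
      rw [mem_closedBall_zero_iff]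
      refine max_le ?_ ?_ <;> rw [Real.norm_eq_abs, le_div_iff₀ hmin]
      · nlinarith [min_le_left m₁ m₂, abs_nonneg p.1]
      · nlinarith [min_le_right m₁ m₂, abs_nonneg p.2]
    refine ENNReal.toReal_pos (Measure.measure_pos_of_mem_nhds volume (x := q) ?_).ne' hfin
    filter_upwards [hq] with p hp
    exact ⟨⟨hp.1, hp.2.1⟩, hp.2.2⟩
  · have hc : Tendsto (fun ε : ℝ => 3 * (D * ε)) (𝓝[>] 0) (𝓝 0) := by
      have : Continuous fun ε : ℝ => 3 * (D * ε) := by fun_prop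
      simpa using (this.tendsto 0).mono_left nhdsWithin_le_nhds
    have hc' : Tendsto (fun ε : ℝ => (R + ε) ^ 2) (𝓝[>] 0) (𝓝 (R ^ 2)) := by
      have : Continuous fun ε : ℝ => (R + ε) ^ 2 := by fun_prop
      simpa using (this.tendsto 0).mono_left nhdsWithin_le_nhds
    filter_upwards [Ioo_mem_nhdsGT (zero_lt_one (α := ℝ)),
      hc.eventually (gt_mem_nhds (show (0 : ℝ) < 1 / 2 by norm_num)),
      hc'.eventually (gt_mem_nhds (show R ^ 2 < m₁ ^ 2 + m₂ ^ 2 + min m₁ m₂ by linarith))]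
      with ε hε h1 h2
    have hε0 := hε.1
    have hdm := measurableSet_disc a b (R + ε)
    have hset : proj ⁻¹' (disc a b (R + ε) \ cat ⁻¹' disc a b (R + ε)) ∩
        Ico (-(1 / 2) : ℝ) (1 / 2) ×ˢ Ico (-(1 / 2) : ℝ) (1 / 2) = G ε \ catLinear ⁻¹' G ε := by
      have key : ∀ p ∈ G ε, p ∈ Ico (-(1 / 2) : ℝ) (1 / 2) ×ˢ Ico (-(1 / 2) : ℝ) (1 / 2) ∧
          (cat (proj p) ∈ disc a b (R + ε) ↔ catLinear p ∈ G ε) := by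
        intro p hp
        have h3 := norm_le_of_mem_cornerSet ha hb hR hε.1 hε.2.le hp
        have h4 := norm_catLinear_le p
        refine ⟨mem_Ico_prod_of_norm_lt ?_, ?_⟩
        · linarith [norm_nonneg p]
        · rw [← proj_catLinear]
          exact proj_mem_disc_iff_cornerSet ha hb h2.le (mem_Ico_prod_of_norm_lt (by linarith))
      ext p
      constructor
      · rintro ⟨⟨h3, h4⟩, h5⟩
        have h6 := (proj_mem_disc_iff_cornerSet ha hb h2.le h5).1 h3
        exact ⟨h6, fun h => h4 ((key p h6).2.2 h)⟩
      · rintro ⟨h3, h4⟩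
        obtain ⟨h5, h6⟩ := key p h3
        exact ⟨⟨(proj_mem_disc_iff_cornerSet ha hb h2.le h5).2 h3, fun h => h4 (h6.1 h)⟩, h5⟩
    have h3 := measureReal_eq_inter_proj (-(1 / 2))
      (hdm.diff (measurePreserving_cat.measurable hdm))
    rw [show (-(1 / 2) + 1 : ℝ) = 1 / 2 by norm_num, hset] at h3
    rw [measureReal_diag_preimage hε.1.ne' hε.1.ne', ← h3, abs_of_pos (by positivity), ← sq,
      Real.rpow_two]
    exact (div_eq_inv_mul _ _).symm

/-- In a neighbourhood of a corner where no wrap-around occurs, orbits do not come back to the exit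
set. -/
theorem no_return_corner {s₁ s₂ : Bool} {a b R ε : ℝ} (ha : 0 < margin s₁ a)
    (hb : 0 < margin s₂ b) (hR : R ^ 2 = margin s₁ a ^ 2 + margin s₂ b ^ 2)
    (hε : 0 < ε) (hε1 : ε ≤ 1)
    (hmin : (R + ε) ^ 2 ≤ R ^ 2 + min (margin s₁ a) (margin s₂ b)) :
    ∀ t ∈ disc a b (R + ε), ‖t‖ ≤ (R + 1) / min (margin s₁ a) (margin s₂ b) * ε ∧
      ∀ j, 1 ≤ j → 3 ^ j * ((R + 1) / min (margin s₁ a) (margin s₂ b) * ε) < 1 / 2 →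
        cat^[j] t ∈ disc a b (R + ε) → cat t ∈ disc a b (R + ε) := by
  intro t ht
  rw [hR] at hmin
  obtain ⟨p, hp, rfl⟩ := exists_proj_eq t
  have h1 := (proj_mem_disc_iff_cornerSet ha hb hmin hp).1 ht
  have h2 := norm_le_of_mem_cornerSet ha hb hR hε hε1 h1
  refine ⟨(norm_proj_le p).trans h2, fun j hj hlt hret => ?_⟩
  have h3 : ∀ i ≤ j, ‖catLinear^[i] p‖ < 1 / 2 := by
    intro i hi
    refine lt_of_le_of_lt ((norm_catLinear_iterate_le i p).trans ?_) hlt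
    have : (3 : ℝ) ^ i ≤ 3 ^ j := pow_le_pow_right₀ (by norm_num) hi
    exact mul_le_mul this h2 (norm_nonneg _) (by positivity)
  rw [← proj_catLinear_iterate, proj_mem_disc_iff_cornerSet ha hb hmin
    (mem_Ico_prod_of_norm_lt (h3 j le_rfl))] at hret
  rw [← proj_catLinear, proj_mem_disc_iff_cornerSet ha hb hmin
    (p := catLinear p) (mem_Ico_prod_of_norm_lt (h3 1 hj))]
  exact catLinear_mem_cornerSet ha hb hj h1 hret

/-! ### Tail indices from areas and returns -/

theorem lt_rpow_add_rpow {α R t : ℝ} (hα : 0 < α) (hR : 0 ≤ R) (ht : 0 < t) :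
    R < (R ^ α + t) ^ (1 / α) := by
  have h1 : (R ^ α) ^ (1 / α) = R := by
    rw [← Real.rpow_mul hR, mul_one_div_cancel hα.ne', Real.rpow_one]
  calc R = (R ^ α) ^ (1 / α) := h1.symm
    _ < _ := Real.rpow_lt_rpow (Real.rpow_nonneg hR _) (by linarith) (by positivity)

/-- If `R₀` is the distance from `pM` to the square, the thresholds that are admitted by a linear
normalisation of the maxima are powers of radii slightly larger than `R₀`. It suffices to know the
avoidance probabilities of the corresponding discs. -/
theorem tailIndex_of_avoid {α κ C R₀ : ℝ} (hα : 0 < α) (hκ : 0 < κ) (hC : 0 < C) (pM : Plane)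
    (hR₀ : 0 ≤ R₀) (hempty : disc (pM 0) (pM 1) R₀ = ∅) {c : ℕ → ℝ} (hc : ∀ n, 0 < c n)
    (h : ∀ y > 0, Tendsto (fun n : ℕ => volume.real
      (avoid (disc (pM 0) (pM 1) ((R₀ ^ α + y / c n) ^ (1 / α))) n)) atTop
      (𝓝 (Real.exp (-(C * y ^ κ))))) (ξ : ℝ) :
    IsGEVTailIndex lebesgueSquare (blockMax thomMap (observable α pM)) ξ ↔ -1 / ξ = κ := by
  have hprob : IsProbabilityMeasure lebesgueSquare := by
    have h1 : lebesgueSquare ((fun p : Plane => proj (p 0, p 1)) ⁻¹' univ) = 1 := by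
      rw [measurePreserving_toTorus.measure_preimage MeasurableSet.univ.nullMeasurableSet,
        measure_univ]
    exact ⟨h1⟩
  refine isGEVTailIndex_iff (a := c) (b := fun _ => 1 - R₀ ^ α) hc hC hκ (fun x hx => ?_)
    (fun x hx => ?_) ξ
  · refine (h (-x) (by linarith)).congr' ?_
    filter_upwards [eventually_gt_atTop 0] with n hn
    have hcn := hc n
    have h1 : 0 < -x / c n := div_pos (by linarith) hcn
    have h2 : 0 ≤ R₀ ^ α := Real.rpow_nonneg hR₀ α
    rw [← measureReal_blockMax_le hα pM (by positivity) hn, ← Real.rpow_mul (by positivity),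
      one_div_mul_cancel hα.ne', Real.rpow_one]
    congr 1
    ext p
    simp only [mem_ofPred_eq]
    rw [mul_comm, ← le_div_iff₀ hcn, neg_div]
    constructor <;> intro h3 <;> linarith
  · refine tendsto_const_nhds.congr' ?_
    filter_upwards [eventually_gt_atTop 0] with n hn
    have h1 := measureReal_blockMax_le hα pM hR₀ hn
    have h2 : avoid (disc (pM 0) (pM 1) R₀) n = univ := by
      rw [hempty]; exact eq_univ_of_forall fun t i _ => notMem_empty _
    rw [h2, probReal_univ] at h1
    refine le_antisymm ?_ measureReal_le_one
    rw [← h1]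
    refine measureReal_mono fun p hp => ?_
    simp only [mem_ofPred_eq] at hp ⊢
    exact (mul_nonpos_of_nonneg_of_nonpos (hc n).le (by linarith)).trans hx

/-- The tail index when the exit sets of the discs of radius `R₀ + ε` have area of order `ε ^ κ` and
negligible short returns, and the normalisation `c` translates the threshold `-y` into an
increment of the radius of order `n ^ (-1 / κ) * y ^ β`. -/
theorem tailIndex_of_area {α κ β B C R₀ : ℝ} (hα : 0 < α) (hκ : 0 < κ) (hβ : 0 < β) (hB : 0 < B)
    (hC : 0 < C) (pM : Plane) (hR₀ : 0 ≤ R₀) (hempty : disc (pM 0) (pM 1) R₀ = ∅) {c : ℕ → ℝ}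
    (hc : ∀ n, 0 < c n)
    (hrad : ∀ y > 0, Tendsto (fun n : ℕ => (n : ℝ) ^ (1 / κ) *
      ((R₀ ^ α + y / c n) ^ (1 / α) - R₀)) atTop (𝓝 (B * y ^ β)))
    (hdisc : Tendsto (fun ε => volume.real (disc (pM 0) (pM 1) (R₀ + ε))) (𝓝[>] 0) (𝓝 0))
    (hexit : Tendsto (fun ε => volume.real (disc (pM 0) (pM 1) (R₀ + ε) \
      cat ⁻¹' disc (pM 0) (pM 1) (R₀ + ε)) / ε ^ κ) (𝓝[>] 0) (𝓝 C))
    (hret : ∀ (ε : ℕ → ℝ) (D : ℝ), (∀ n, 0 < ε n) → Tendsto ε atTop (𝓝[>] 0) →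
      (∀ᶠ n : ℕ in atTop, (n : ℝ) ^ (1 / κ) * ε n ≤ D) →
      Tendsto (fun n : ℕ => n * ∑ j ∈ Finset.Ico 1 (gap n),
        volume.real ((disc (pM 0) (pM 1) (R₀ + ε n) \ cat ⁻¹' disc (pM 0) (pM 1) (R₀ + ε n)) ∩
          cat^[j] ⁻¹' (disc (pM 0) (pM 1) (R₀ + ε n) \
            cat ⁻¹' disc (pM 0) (pM 1) (R₀ + ε n)))) atTop (𝓝 0)) (ξ : ℝ) :
    IsGEVTailIndex lebesgueSquare (blockMax thomMap (observable α pM)) ξ ↔ -1 / ξ = β * κ := by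
  refine tailIndex_of_avoid (C := C * B ^ κ) hα (by positivity)
    (mul_pos hC (Real.rpow_pos_of_pos hB κ)) pM hR₀ hempty hc (fun y hy => ?_) ξ
  set ε : ℕ → ℝ := fun n => (R₀ ^ α + y / c n) ^ (1 / α) - R₀ with hε
  have hε0 : ∀ n, 0 < ε n := fun n =>
    sub_pos.2 (lt_rpow_add_rpow hα hR₀ (div_pos hy (hc n)))
  have hRε : ∀ n, (R₀ ^ α + y / c n) ^ (1 / α) = R₀ + ε n := fun n => by rw [hε]; ring
  have hL := hrad y hy
  change Tendsto (fun n : ℕ => (n : ℝ) ^ (1 / κ) * ε n) atTop _ at hL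
  have hL0 : 0 < B * y ^ β := mul_pos hB (Real.rpow_pos_of_pos hy β)
  have hεlim : Tendsto ε atTop (𝓝 0) := by
    have h1 : Tendsto (fun n : ℕ => ((n : ℝ) ^ (1 / κ))⁻¹) atTop (𝓝 0) :=
      tendsto_inv_atTop_zero.comp
        ((tendsto_rpow_atTop (by positivity)).comp tendsto_natCast_atTop_atTop)
    have h2 := h1.mul hL
    rw [zero_mul] at h2
    refine h2.congr' ?_
    filter_upwards [eventually_gt_atTop 0] with n hn
    have hn' : (0 : ℝ) < n := by exact_mod_cast hn
    rw [← mul_assoc, inv_mul_cancel₀ (Real.rpow_pos_of_pos hn' _).ne', one_mul]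
  have hεlim' : Tendsto ε atTop (𝓝[>] 0) :=
    tendsto_nhdsWithin_iff.2 ⟨hεlim, Eventually.of_forall hε0⟩
  have hpow : Tendsto (fun n : ℕ => (n : ℝ) * ε n ^ κ) atTop (𝓝 (B ^ κ * y ^ (β * κ))) := by
    have h1 := hL.rpow_const (p := κ) (Or.inr hκ.le)
    rw [Real.mul_rpow hB.le (Real.rpow_nonneg hy.le _), ← Real.rpow_mul hy.le] at h1
    refine h1.congr fun n => ?_
    rw [Real.mul_rpow (by positivity) (hε0 n).le, ← Real.rpow_mul (by positivity),
      one_div_mul_cancel hκ.ne', Real.rpow_one]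
  obtain ⟨M, hM⟩ := hεlim.bddAbove_range
  simp only [hRε]
  refine tendsto_avoid_of_exit (fun n => measurableSet_disc _ _ _)
    (fun n => thinBoundary_disc (B := R₀ + M) (by linarith [hε0 n])
      (by linarith [hM (mem_range_self n)])) (hdisc.comp hεlim') ?_
    (hret ε (B * y ^ β + 1) hε0 hεlim' ?_)
  · have h1 := (hexit.comp hεlim').mul hpow
    rw [← mul_assoc] at h1
    refine h1.congr fun n => ?_
    simp only [Function.comp]
    have := (Real.rpow_pos_of_pos (hε0 n) κ).ne'
    field_simp
  · filter_upwards [hL.eventually (gt_mem_nhds (lt_add_one _))] with n hn using hn.le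

/-- For `R > 0` the radius depends differentiably on the threshold. The maximum with `1` keeps the
normalisation positive at `n = 0`. -/
theorem tendsto_radius {α R : ℝ} (hα : 0 < α) (hR : 0 < R) {κ : ℝ} (hκ : 0 < κ) {y : ℝ}
    (hy : 0 < y) :
    Tendsto (fun n : ℕ => (n : ℝ) ^ (1 / κ) *
      ((R ^ α + y / max (n : ℝ) 1 ^ (1 / κ)) ^ (1 / α) - R)) atTop
      (𝓝 (1 / α * (R ^ α) ^ (1 / α - 1) * y ^ (1 : ℝ))) := by
  have hRα : 0 < R ^ α := Real.rpow_pos_of_pos hR α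
  have h1 : (R ^ α) ^ (1 / α) = R := by
    rw [← Real.rpow_mul hR.le, mul_one_div_cancel hα.ne', Real.rpow_one]
  have hd : HasDerivAt (fun t : ℝ => (R ^ α + t) ^ (1 / α))
      (1 / α * (R ^ α) ^ (1 / α - 1)) 0 := by
    have h2 : HasDerivAt (fun t : ℝ => R ^ α + t) 1 0 := (hasDerivAt_id 0).const_add _
    have h3 := h2.rpow_const (p := 1 / α) (Or.inl (by rw [add_zero]; exact hRα.ne'))
    rwa [one_mul, add_zero] at h3
  have hn : Tendsto (fun n : ℕ => (n : ℝ) ^ (1 / κ)) atTop atTop :=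
    (tendsto_rpow_atTop (by positivity)).comp tendsto_natCast_atTop_atTop
  have hy0 : Tendsto (fun n : ℕ => y / (n : ℝ) ^ (1 / κ)) atTop (𝓝[≠] 0) := by
    refine tendsto_nhdsWithin_iff.2 ⟨tendsto_const_nhds.div_atTop hn, ?_⟩
    filter_upwards [eventually_gt_atTop 0] with n hn
    have hn' : (0 : ℝ) < n := by exact_mod_cast hn
    exact (div_pos hy (Real.rpow_pos_of_pos hn' _)).ne'
  have h4 := ((hasDerivAt_iff_tendsto_slope_zero.1 hd).comp hy0).mul_const y
  rw [Real.rpow_one]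
  refine h4.congr' ?_
  filter_upwards [eventually_gt_atTop 0] with n hn
  have hn' : (0 : ℝ) < n := by exact_mod_cast hn
  have hn1 : (1 : ℝ) ≤ n := by exact_mod_cast hn
  have hpos := Real.rpow_pos_of_pos hn' (1 / κ)
  simp only [Function.comp, zero_add, add_zero, smul_eq_mul, h1, max_eq_left hn1]
  field_simp

theorem measureReal_disc_le_of_box {a b R d : ℝ} (hd : 0 ≤ d) {z : Torus}
    (h : ∀ t ∈ disc a b R, ‖t - z‖ ≤ d) : volume.real (disc a b R) ≤ 4 * d ^ 2 := by
  refine (measureReal_mono fun t ht => ?_).trans (measureReal_closedBall_prod_le z.1 z.2 hd)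
  have h1 := h t ht
  exact ⟨by rw [Metric.mem_closedBall, dist_eq_norm]; exact (norm_fst_le (t - z)).trans h1,
    by rw [Metric.mem_closedBall, dist_eq_norm]; exact (norm_snd_le (t - z)).trans h1⟩

theorem tendsto_const_mul_sq (c : ℝ) :
    Tendsto (fun ε : ℝ => c * ε ^ 2) (𝓝[>] 0) (𝓝 0) := by
  have : Continuous fun ε : ℝ => c * ε ^ 2 := by fun_prop
  simpa using (this.tendsto 0).mono_left nhdsWithin_le_nhds

/-- A centre in the open square whose orbit is slowly recurrent: balls of area `π ε ^ 2`. -/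
theorem tailIndex_interior {α : ℝ} (hα : 0 < α) {pM : Plane} (h0 : pM 0 ∈ Ioo (0 : ℝ) 1)
    (h1 : pM 1 ∈ Ioo (0 : ℝ) 1) (hz : SlowlyRecurrent (proj (pM 0, pM 1))) (ξ : ℝ) :
    IsGEVTailIndex lebesgueSquare (blockMax thomMap (observable α pM)) ξ ↔ -1 / ξ = 2 / α := by
  have hbox : ∀ ε > 0, ∀ t ∈ disc (pM 0) (pM 1) (0 + ε), ‖t - proj (pM 0, pM 1)‖ ≤ ε := by
    intro ε hε t ht
    rw [zero_add] at ht
    have h2 : (frac t.1 - pM 0) ^ 2 + (frac t.2 - pM 1) ^ 2 < ε ^ 2 := ht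
    refine max_le ((norm_coe_sub_le t.1 (pM 0)).trans ?_)
      ((norm_coe_sub_le t.2 (pM 1)).trans ?_)
    · exact abs_le_of_sq_le_sq (by nlinarith [sq_nonneg (frac t.2 - pM 1)]) hε.le
    · exact abs_le_of_sq_le_sq (by nlinarith [sq_nonneg (frac t.1 - pM 0)]) hε.le
  have hempty : disc (pM 0) (pM 1) 0 = ∅ := by
    refine eq_empty_of_forall_notMem fun t ht => ?_
    have h2 : (frac t.1 - pM 0) ^ 2 + (frac t.2 - pM 1) ^ 2 < 0 ^ 2 := ht
    nlinarith [sq_nonneg (frac t.1 - pM 0), sq_nonneg (frac t.2 - pM 1)]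
  -- The centre is not fixed, so small balls are disjoint from their preimages.
  have hexit : ∀ᶠ ε in 𝓝[>] (0 : ℝ), volume.real (disc (pM 0) (pM 1) (0 + ε) \
      cat ⁻¹' disc (pM 0) (pM 1) (0 + ε)) = Real.pi * ε ^ 2 := by
    have hz1 : 0 < ‖cat (proj (pM 0, pM 1)) - proj (pM 0, pM 1)‖ := by
      obtain ⟨c, hc, hcz⟩ := hz
      have := hcz 1 le_rfl
      simp only [Nat.cast_one, one_pow, one_mul, Function.iterate_one] at this
      linarith
    filter_upwards [eventually_measureReal_disc h0 h1, self_mem_nhdsWithin,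
      Ioo_mem_nhdsGT (div_pos hz1 (show (0 : ℝ) < 4 by norm_num))] with ε h2 hε h3
    rw [← h2, zero_add]
    congr 1
    refine sdiff_eq_left.2 (disjoint_left.2 fun t ht ht' => ?_)
    have h4 := hbox ε hε t (by rwa [zero_add])
    have h5 := hbox ε hε (cat t) (by rwa [zero_add])
    have h6 : cat (proj (pM 0, pM 1)) - proj (pM 0, pM 1) =
        -cat (t - proj (pM 0, pM 1)) + (cat t - proj (pM 0, pM 1)) := by
      rw [map_sub]; abel
    have h7 := norm_add_le (-cat (t - proj (pM 0, pM 1))) (cat t - proj (pM 0, pM 1))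
    rw [← h6, norm_neg] at h7
    have h8 := norm_cat_le (t - proj (pM 0, pM 1))
    have h9 := h3.2
    linarith
  have := tailIndex_of_area (κ := 2) (β := 1 / α) (B := 1) (C := Real.pi) (R₀ := 0)
    (c := fun n : ℕ => max (n : ℝ) 1 ^ (α / 2)) hα two_pos (by positivity) one_pos Real.pi_pos pM
    le_rfl hempty (fun n => Real.rpow_pos_of_pos (lt_max_of_lt_right one_pos) _) ?_ ?_ ?_ ?_ ξ
  · rw [this]; ring_nf
  · intro y hy
    refine tendsto_const_nhds.congr' ?_
    filter_upwards [eventually_gt_atTop 0] with n hn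
    have hn' : (0 : ℝ) < n := by exact_mod_cast hn
    have hn1 : (1 : ℝ) ≤ n := by exact_mod_cast hn
    rw [Real.zero_rpow hα.ne', zero_add, sub_zero, max_eq_left hn1,
      Real.div_rpow hy.le (by positivity), ← Real.rpow_mul hn'.le,
      show α / 2 * (1 / α) = 1 / 2 by field_simp, mul_div_cancel₀ _
        (Real.rpow_pos_of_pos hn' _).ne', one_mul]
  · refine squeeze_zero' (Eventually.of_forall fun ε => measureReal_nonneg) ?_
      (tendsto_const_mul_sq 4)
    filter_upwards [self_mem_nhdsWithin] with ε hε
    exact measureReal_disc_le_of_box (le_of_lt hε) (hbox ε hε)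
  · refine tendsto_const_nhds.congr' ?_
    filter_upwards [hexit, self_mem_nhdsWithin] with ε h2 hε
    have hε : 0 < ε := hε
    rw [h2, Real.rpow_two]
    field_simp
  · intro ε D hε hlim hD
    simp only [← Real.sqrt_eq_rpow] at hD
    have hE : ∀ᶠ n in atTop, ∀ t ∈ disc (pM 0) (pM 1) (0 + ε n) \
        cat ⁻¹' disc (pM 0) (pM 1) (0 + ε n), ‖t - proj (pM 0, pM 1)‖ ≤ ε n :=
      Eventually.of_forall fun n t ht => hbox (ε n) (hε n) t ht.1
    exact tendsto_returns_of_box (fun n => (hε n).le) hD hE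
      (hz.eventually_no_return (fun n => (hε n).le) hD hE)

/-- A centre beyond a side of the square: caps of area of order `ε ^ (3 / 2)` in strips of
width `ε`. -/
theorem tailIndex_of_cap {α R C : ℝ} (hα : 0 < α) (hR : 0 < R) (hC : 0 < C) {pM : Plane}
    (hempty : disc (pM 0) (pM 1) R = ∅)
    (harea : Tendsto (fun ε => volume.real (disc (pM 0) (pM 1) (R + ε)) / ε ^ (3 / 2 : ℝ))
      (𝓝[>] 0) (𝓝 C))
    (hstrip : ∀ ε > 0, (∀ t ∈ disc (pM 0) (pM 1) (R + ε), ‖t.1‖ ≤ ε) ∨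
      ∀ t ∈ disc (pM 0) (pM 1) (R + ε), ‖t.2‖ ≤ ε) (ξ : ℝ) :
    IsGEVTailIndex lebesgueSquare (blockMax thomMap (observable α pM)) ξ ↔ -1 / ξ = 3 / 2 := by
  have hret : ∀ ε > 0, ∀ E ⊆ disc (pM 0) (pM 1) (R + ε), ∀ j ≠ 0,
      volume.real (E ∩ cat^[j] ⁻¹' E) ≤ 4 * ε ^ 2 := by
    intro ε hε E hE j hj
    rcases hstrip ε hε with h | h
    · exact measureReal_strip_fst_le (z := 0) hε.le
        (fun t ht => by rw [sub_zero]; exact h t (hE ht)) hj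
    · exact measureReal_strip_snd_le (z := 0) hε.le
        (fun t ht => by rw [sub_zero]; exact h t (hE ht)) hj
  have hpow : Tendsto (fun ε : ℝ => ε ^ (3 / 2 : ℝ)) (𝓝[>] 0) (𝓝 0) := by
    have h1 := (Real.continuousAt_rpow_const 0 (3 / 2) (Or.inr (by norm_num))).tendsto
    rw [Real.zero_rpow (by norm_num)] at h1
    exact h1.mono_left nhdsWithin_le_nhds
  have hpow' : Tendsto (fun ε : ℝ => 4 * ε ^ (1 / 2 : ℝ)) (𝓝[>] 0) (𝓝 0) := by
    have h1 := (Real.continuousAt_rpow_const 0 (1 / 2) (Or.inr (by norm_num))).tendsto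
    rw [Real.zero_rpow (by norm_num)] at h1
    simpa using (h1.mono_left nhdsWithin_le_nhds).const_mul 4
  have hRα : 0 < R ^ α := Real.rpow_pos_of_pos hR α
  have := tailIndex_of_area (κ := 3 / 2) (β := 1) (B := 1 / α * (R ^ α) ^ (1 / α - 1)) (R₀ := R)
    (c := fun n : ℕ => max (n : ℝ) 1 ^ (1 / (3 / 2 : ℝ))) hα (by norm_num) one_pos
    (by positivity) hC pM hR.le hempty
    (fun n => Real.rpow_pos_of_pos (lt_max_of_lt_right one_pos) _)
    (fun y hy => tendsto_radius hα hR (by norm_num) hy) ?_ ?_ ?_ ξ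
  · rw [this, one_mul]
  · have h1 := harea.mul hpow
    rw [mul_zero] at h1
    refine h1.congr' ?_
    filter_upwards [self_mem_nhdsWithin] with ε hε
    exact div_mul_cancel₀ _ (Real.rpow_pos_of_pos hε _).ne'
  -- By transversality, the part of the cap that is mapped into it has area `O(ε ^ 2)`.
  · have h1 : Tendsto (fun ε => volume.real (disc (pM 0) (pM 1) (R + ε) ∩
        cat ⁻¹' disc (pM 0) (pM 1) (R + ε)) / ε ^ (3 / 2 : ℝ)) (𝓝[>] 0) (𝓝 0) := by
      refine squeeze_zero' ?_ ?_ hpow'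
      · filter_upwards [self_mem_nhdsWithin] with ε hε
        have hε : 0 < ε := hε
        positivity
      · filter_upwards [self_mem_nhdsWithin] with ε hε
        have hε : 0 < ε := hε
        rw [div_le_iff₀ (Real.rpow_pos_of_pos hε _), mul_assoc, ← Real.rpow_add hε]
        norm_num
        exact hret ε hε _ subset_rfl 1 one_ne_zero
    have h2 := harea.sub h1
    rw [sub_zero] at h2
    refine h2.congr fun ε => ?_
    rw [← sub_div]
    congr 1
    have hm := measurableSet_disc (pM 0) (pM 1) (R + ε)
    have := measureReal_sdiff_add_inter (μ := volume) (s := disc (pM 0) (pM 1) (R + ε))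
      (measurePreserving_cat.measurable hm)
    linarith
  · intro ε D hε hlim hD
    rw [show (1 / (3 / 2) : ℝ) = 2 / 3 by norm_num] at hD
    exact tendsto_returns_of_strip (fun n => (hε n).le) hD
      (Eventually.of_forall fun n j hj => hret (ε n) (hε n) _ sdiff_subset j hj)

theorem sq_margin_le {s : Bool} {a : ℝ} (ha : 0 < margin s a) (t : UnitAddCircle) :
    margin s a ^ 2 ≤ (frac t - a) ^ 2 := by
  have h := frac_mem t
  cases s <;> simp only [margin, Bool.false_eq_true, if_true, if_false] at ha ⊢ <;>
    nlinarith [h.1, h.2]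

theorem tailIndex_side_fst {α : ℝ} (hα : 0 < α) {pM : Plane} {s : Bool} (h0 : 0 < margin s (pM 0))
    (h1 : pM 1 ∈ Ioo (0 : ℝ) 1) (ξ : ℝ) :
    IsGEVTailIndex lebesgueSquare (blockMax thomMap (observable α pM)) ξ ↔ -1 / ξ = 3 / 2 := by
  obtain ⟨C, hC, harea⟩ := exists_tendsto_cap h0 h1
  refine tailIndex_of_cap hα h0 hC ?_ harea
    (fun ε hε => Or.inl fun t ht => abs_frac_lt_of_mem_disc h0 hε ht) ξ
  refine eq_empty_of_forall_notMem fun t ht => ?_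
  have h2 : (frac t.1 - pM 0) ^ 2 + (frac t.2 - pM 1) ^ 2 < margin s (pM 0) ^ 2 := ht
  linarith [sq_margin_le h0 t.1, sq_nonneg (frac t.2 - pM 1)]

theorem tailIndex_side_snd {α : ℝ} (hα : 0 < α) {pM : Plane} {s : Bool} (h0 : 0 < margin s (pM 1))
    (h1 : pM 0 ∈ Ioo (0 : ℝ) 1) (ξ : ℝ) :
    IsGEVTailIndex lebesgueSquare (blockMax thomMap (observable α pM)) ξ ↔ -1 / ξ = 3 / 2 := by
  obtain ⟨C, hC, harea⟩ := exists_tendsto_cap h0 h1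
  simp only [measureReal_disc_swap (pM 0) (pM 1)] at harea
  refine tailIndex_of_cap hα h0 hC ?_ harea
    (fun ε hε => Or.inr fun t ht =>
      abs_frac_lt_of_mem_disc (t := t.swap) h0 hε (mem_disc_swap.2 ht)) ξ
  refine eq_empty_of_forall_notMem fun t ht => ?_
  have h2 : (frac t.1 - pM 0) ^ 2 + (frac t.2 - pM 1) ^ 2 < margin s (pM 1) ^ 2 := ht
  linarith [sq_margin_le h0 t.2, sq_nonneg (frac t.1 - pM 0)]

/-- A centre diagonally beyond a corner of the square. All corners are the fixed point of the
automorphism of the torus, so that visits to the exceedance sets come in clusters. -/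
theorem tailIndex_corner {α : ℝ} (hα : 0 < α) {pM : Plane} {s₁ s₂ : Bool}
    (h0 : 0 < margin s₁ (pM 0)) (h1 : 0 < margin s₂ (pM 1)) (ξ : ℝ) :
    IsGEVTailIndex lebesgueSquare (blockMax thomMap (observable α pM)) ξ ↔ -1 / ξ = 2 := by
  set R : ℝ := √(margin s₁ (pM 0) ^ 2 + margin s₂ (pM 1) ^ 2) with hRdef
  have hR0 : 0 < R := Real.sqrt_pos.2 (by positivity)
  have hR : R ^ 2 = margin s₁ (pM 0) ^ 2 + margin s₂ (pM 1) ^ 2 := Real.sq_sqrt (by positivity)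
  have hRα : 0 < R ^ α := Real.rpow_pos_of_pos hR0 α
  have hmin : 0 < min (margin s₁ (pM 0)) (margin s₂ (pM 1)) := lt_min h0 h1
  set K : ℝ := (R + 1) / min (margin s₁ (pM 0)) (margin s₂ (pM 1)) with hK
  have hK0 : 0 < K := by positivity
  have hempty : disc (pM 0) (pM 1) R = ∅ := by
    refine eq_empty_of_forall_notMem fun t ht => ?_
    have h2 : (frac t.1 - pM 0) ^ 2 + (frac t.2 - pM 1) ^ 2 < R ^ 2 := ht
    linarith [sq_margin_le h0 t.1, sq_margin_le h1 t.2]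
  obtain ⟨C, hC, hexit⟩ := exists_tendsto_corner h0 h1 hR0 hR
  have hnoret : ∀ᶠ ε in 𝓝[>] (0 : ℝ), ∀ t ∈ disc (pM 0) (pM 1) (R + ε), ‖t‖ ≤ K * ε ∧
      ∀ j, 1 ≤ j → 3 ^ j * (K * ε) < 1 / 2 → cat^[j] t ∈ disc (pM 0) (pM 1) (R + ε) →
        cat t ∈ disc (pM 0) (pM 1) (R + ε) := by
    have hc : Tendsto (fun ε : ℝ => (R + ε) ^ 2) (𝓝[>] 0) (𝓝 (R ^ 2)) := by
      have : Continuous fun ε : ℝ => (R + ε) ^ 2 := by fun_prop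
      simpa using (this.tendsto 0).mono_left nhdsWithin_le_nhds
    filter_upwards [Ioo_mem_nhdsGT (zero_lt_one (α := ℝ)),
      hc.eventually (gt_mem_nhds (lt_add_of_pos_right _ hmin))] with ε hε h2
    exact no_return_corner h0 h1 hR hε.1 hε.2.le h2.le
  have := tailIndex_of_area (κ := 2) (β := 1) (B := 1 / α * (R ^ α) ^ (1 / α - 1)) (R₀ := R)
    (c := fun n : ℕ => max (n : ℝ) 1 ^ (1 / (2 : ℝ))) hα (by norm_num) one_pos
    (by positivity) hC pM hR0.le hempty
    (fun n => Real.rpow_pos_of_pos (lt_max_of_lt_right one_pos) _)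
    (fun y hy => tendsto_radius hα hR0 (by norm_num) hy) ?_ hexit ?_ ξ
  · rw [this, one_mul]
  · refine squeeze_zero' (Eventually.of_forall fun ε => measureReal_nonneg) ?_
      (tendsto_const_mul_sq (4 * K ^ 2))
    filter_upwards [self_mem_nhdsWithin, hnoret] with ε hε h2
    have hε : 0 < ε := hε
    refine (measureReal_disc_le_of_box (z := 0) (d := K * ε) (by positivity)
      fun t ht => ?_).trans_eq (by ring)
    rw [sub_zero]; exact (h2 t ht).1
  · intro ε D hε hlim hD
    simp only [← Real.sqrt_eq_rpow] at hD
    have hD' : ∀ᶠ n : ℕ in atTop, √n * (K * ε n) ≤ K * D := by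
      filter_upwards [hD] with n hn
      calc √n * (K * ε n) = K * (√n * ε n) := by ring
        _ ≤ K * D := by gcongr
    refine tendsto_returns_of_box (z := 0) (d := fun n => K * ε n)
      (fun n => by have := hε n; positivity) hD' ?_ ?_
    · filter_upwards [hlim.eventually hnoret] with n hn t ht
      rw [sub_zero]; exact (hn t ht.1).1
    · have h2 := (tendsto_lag_div_two_pow.const_mul (K * D)).eventually
        (gt_mem_nhds (show K * D * 0 < 1 / 2 by norm_num))
      filter_upwards [hlim.eventually hnoret, hD', h2, eventually_gt_atTop 0]
        with n h3 h4 h5 hn j hj hjlag t ht htj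
      refine ht.2 ((h3 t ht.1).2 j hj ?_ htj.1)
      have hn' : (0 : ℝ) < n := by exact_mod_cast hn
      have hd : 0 < K * ε n := mul_pos hK0 (hε n)
      set p : ℝ := 2 ^ lag n with hp
      have hp1 : 1 ≤ p := one_le_pow₀ (by norm_num)
      have hsqrt : p ^ 8 ≤ √n := by
        refine Real.le_sqrt_of_sq_le (le_trans (le_of_eq ?_) (two_pow_lag_pow_le hn))
        rw [← pow_mul]
      have h6 : (3 : ℝ) ^ j ≤ p ^ 2 := by
        calc (3 : ℝ) ^ j ≤ 4 ^ j := pow_le_pow_left₀ (by norm_num) (by norm_num) _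
          _ ≤ 4 ^ lag n := pow_le_pow_right₀ (by norm_num) hjlag.le
          _ = p ^ 2 := by rw [hp, ← pow_mul, mul_comm, pow_mul]; norm_num
      have h7 : 3 ^ j * (K * ε n) ≤ K * D / p := by
        rw [le_div_iff₀ (by linarith)]
        calc 3 ^ j * (K * ε n) * p ≤ p ^ 2 * (K * ε n) * p := by gcongr
          _ = p ^ 3 * (K * ε n) := by ring
          _ ≤ p ^ 8 * (K * ε n) := by
            gcongr
            norm_num
          _ ≤ √n * (K * ε n) := by gcongr
          _ ≤ K * D := h4
      have hKD : 0 ≤ K * D := le_trans (by positivity) h4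
      have h8 : K * D / p ≤ K * D * (((lag n : ℝ) + 1) / p) := by
        rw [div_eq_mul_one_div]
        gcongr
        linarith [Nat.cast_nonneg (α := ℝ) (lag n)]
      linarith

/-! ### Almost every centre -/

theorem ae_coord_ne (c : ℝ) : ∀ᵐ p : Plane, p 0 ≠ c ∧ p 1 ≠ c := by
  have h : volume ({c} : Set ℝ) = 0 := Real.volume_singleton
  have h1 : ∀ᵐ q : ℝ × ℝ, q.1 ≠ c := by
    filter_upwards [Measure.quasiMeasurePreserving_fst.ae
      (measure_eq_zero_iff_ae_notMem.1 h)] with q hq using hq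
  have h2 : ∀ᵐ q : ℝ × ℝ, q.2 ≠ c := by
    filter_upwards [Measure.quasiMeasurePreserving_snd.ae
      (measure_eq_zero_iff_ae_notMem.1 h)] with q hq using hq
  filter_upwards [measurePreserving_coords.quasiMeasurePreserving.ae h1,
    measurePreserving_coords.quasiMeasurePreserving.ae h2] with p hp hp' using ⟨hp, hp'⟩

theorem measurableSet_unitSquare : MeasurableSet unitSquare :=
  measurePreserving_coords.measurable
    (measurableSet_Ico.prod measurableSet_Ico : MeasurableSet (Ico (0 : ℝ) 1 ×ˢ Ico (0 : ℝ) 1))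

theorem exists_margin_pos {a : ℝ} (h0 : a ≠ 0) (h1 : a ≠ 1) (h : a ∉ Ioo (0 : ℝ) 1) :
    ∃ s, 0 < margin s a := by
  rcases lt_or_gt_of_ne h0 with h2 | h2
  · exact ⟨true, by simpa [margin] using h2⟩
  · have h3 : 1 ≤ a := not_lt.1 fun h3 => h ⟨h2, h3⟩
    exact ⟨false, by simpa [margin] using lt_of_le_of_ne h3 h1.symm⟩

end ThomMap

theorem theorem1 (α : ℝ) (hα : 0 < α) :
    ∀ᵐ pM : ThomMap.Plane ∂volume,
      (pM ∈ ThomMap.unitSquare →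
        ∀ ξ : ℝ, ThomMap.IsGEVTailIndex ThomMap.lebesgueSquare
          (ThomMap.blockMax ThomMap.thomMap (ThomMap.observable α pM)) ξ ↔
            -1 / ξ = 2 / α) ∧
      (pM ∉ ThomMap.unitSquare → (pM 1 ∈ Ioo (0 : ℝ) 1 ∨ pM 0 ∈ Ioo (0 : ℝ) 1) →
        ∀ ξ : ℝ, ThomMap.IsGEVTailIndex ThomMap.lebesgueSquare
          (ThomMap.blockMax ThomMap.thomMap (ThomMap.observable α pM)) ξ ↔
            -1 / ξ = 3 / 2) ∧
      (pM ∉ ThomMap.unitSquare → (pM 0 ∉ Icc (0 : ℝ) 1 ∧ pM 1 ∉ Icc (0 : ℝ) 1) →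
        ∀ ξ : ℝ, ThomMap.IsGEVTailIndex ThomMap.lebesgueSquare
          (ThomMap.blockMax ThomMap.thomMap (ThomMap.observable α pM)) ξ ↔
            -1 / ξ = 2) := by
  have hrec := (ae_restrict_iff' ThomMap.measurableSet_unitSquare).1
    (ThomMap.measurePreserving_toTorus.quasiMeasurePreserving.ae ThomMap.ae_slowlyRecurrent)
  filter_upwards [ThomMap.ae_coord_ne 0, ThomMap.ae_coord_ne 1, hrec] with pM h0 h1 hz
  refine ⟨fun hpM => ?_, fun hpM hside => ?_, fun _ hcorner => ?_⟩
  · exact ThomMap.tailIndex_interior hα ⟨lt_of_le_of_ne hpM.1.1 h0.1.symm, hpM.1.2⟩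
      ⟨lt_of_le_of_ne hpM.2.1 h0.2.symm, hpM.2.2⟩ (hz hpM)
  · rcases hside with h | h
    · obtain ⟨s, hs⟩ := ThomMap.exists_margin_pos h0.1 h1.1
        fun h' => hpM ⟨Ioo_subset_Ico_self h', Ioo_subset_Ico_self h⟩
      exact ThomMap.tailIndex_side_fst hα hs h
    · obtain ⟨s, hs⟩ := ThomMap.exists_margin_pos h0.2 h1.2
        fun h' => hpM ⟨Ioo_subset_Ico_self h, Ioo_subset_Ico_self h'⟩
      exact ThomMap.tailIndex_side_snd hα hs h
  · obtain ⟨s₁, hs₁⟩ := ThomMap.exists_margin_pos h0.1 h1.1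
      fun h => hcorner.1 (Ioo_subset_Icc_self h)
    obtain ⟨s₂, hs₂⟩ := ThomMap.exists_margin_pos h0.2 h1.2
      fun h => hcorner.2 (Ioo_subset_Icc_self h)
    exact ThomMap.tailIndex_corner hα hs₁ hs₂
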